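/- All graphs are finite, undirected and simple. A \emph{tree decomposition} of a graph $G=(V,E)$ is a pair $(T,\{B_x\}_{x\in V(T)})$, where $T$ is a tree and each $B_x\subseteq V$, such that every vertex of $G$ lies in some $B_x$, for every edge $uv$ of $G$ some $B_x$ contains both $u$ and $v$, and, for every $v\in V$, the set $\{x : v\in B_x\}$ induces a subtree of $T$; its width is $\max_x |B_x|-1$. It is a \emph{spaghetti tree decomposition} if, for every $v\in V$, the set $\{x : v\in B_x\}$ induces a path of $T$ (possibly a single node). The \emph{spaghetti treewidth} of $G$ is the minimum width of a spaghetti tree decomposition of $G$. A graph $G=(V,E)$ is \emph{2-connected} if $|V|\ge 3$ and $G[V\setminus X]$ is connected for every $X\subseteq V$ with $|X|\le 1$. A \emph{block} of $G$ is a maximal (nonempty) connected subgraph without a cut vertex. The \emph{cell completion} $\widetilde G$ of a 2-connected graph $G=(V,E)$ is obtained from $G$ by adding an edge $vw$ for all pairs of nonadjacent vertices $v,w$ such that $G[V\setminus\{v,w\}]$ has at least three connected components. \emph{Trees of cycles} are defined recursively: every cycle is a tree of cycles, and if $G$ is a tree of cycles and $C$ is a cycle, then the graph obtained from the disjoint union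 of $G$ and $C$ by identifying an edge and its ends in $G$ with an edge and its ends in $C$ is a tree of cycles. A \emph{simplicial triangle} of a graph is a triangle containing a vertex whose neighbourhood is a clique. A \emph{chain tree of cycles} is a tree of cycles $G$ such that whenever an edge of $G$ is contained in $m\ge 3$ chordless cycles of $G$, at least $m-2$ of these cycles are simplicial triangles. $K_4$ is the complete graph on four vertices, and $D_3$ is the graph formed by two vertices and three internally vertex-disjoint paths of length three between them. \textbf{Theorem.} Let $G$ be a graph. (a) The following are equivalent: (1) $G$ has spaghetti treewidth at most two; (2) each block of $G$ is either a 2-connected subgraph whose cell completion is a chain tree of cycles, or a single edge, or an isolated vertex; (3) $G$ has no minor isomorphic to $K_4$ or $D_3$. (b) If $G$ is 2-connected, then $G$ has spaghetti treewidth (exactly) two if and only if the cell completion $\widetilde G$ is a chain tree of cycles. (c) If $G$ is 2-connected, then $G$ has spaghetti treewidth (exactly) two if and only if $G$ has no minor isomorphic to $K_4$ or $D_3$. -/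

import Mathlib

universe u v

namespace SpaghettiTw

open SimpleGraph

noncomputable section

/-! ### Connectivity, blocks, minors -/

/-- At least three vertices, and connected after deletion of any set of at most one vertex. -/
def IsTwoConnected {V : Type u} (G : SimpleGraph V) : Prop :=
  3 ≤ Nat.card V ∧ ∀ X : Set V, X.encard ≤ 1 → (G.induce Xᶜ).Connected

/-- `v` is a cut vertex of (the connected graph) `H`. Deleting the only vertex of a one-vertex
graph leaves the empty graph, which is preconnected, so such a vertex is not a cut vertex. -/
def IsCutVertex {V : Type u} {G : SimpleGraph V} (H : G.Subgraph) (v : V) : Prop :=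
  v ∈ H.verts ∧ ¬ (H.deleteVerts {v}).Preconnected

/-- A block: a maximal (nonempty) connected subgraph without a cut vertex. -/
def IsBlock {V : Type u} {G : SimpleGraph V} (H : G.Subgraph) : Prop :=
  Maximal (fun K : G.Subgraph => K.Connected ∧ ∀ v, ¬ IsCutVertex K v) H

/-- `H` is isomorphic to a minor of `G`: there are pairwise disjoint connected (nonempty) vertex
sets of `G`, one for each vertex of `H`, such that adjacent vertices of `H` have sets joined by an
edge of `G`. -/
def IsMinor {W : Type v} {V : Type u} (H : SimpleGraph W) (G : SimpleGraph V) : Prop :=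
  ∃ B : W → Set V,
    (∀ w, (G.induce (B w)).Connected) ∧
    (∀ w w', w ≠ w' → Disjoint (B w) (B w')) ∧
    ∀ w w', H.Adj w w' → ∃ x ∈ B w, ∃ y ∈ B w', G.Adj x y

/-- The complete graph on four vertices. -/
abbrev K4 : SimpleGraph (Fin 4) := ⊤

/-- Three internally disjoint paths of length three between the vertices `0` and `1`. -/
def D3 : SimpleGraph (Fin 8) :=
  fromEdgeSet {s(0, 2), s(2, 3), s(3, 1), s(0, 4), s(4, 5), s(5, 1), s(0, 6), s(6, 7), s(7, 1)}

/-! ### Spaghetti treewidth -/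

/-- A tree decomposition of `G`, over a finite tree. An induced subgraph of a tree is a tree as soon
as it is connected (and nonempty), so `connected` says that the bags containing `v` induce
a subtree. -/
structure TreeDecomposition {V : Type u} (G : SimpleGraph V) where
  node : Type
  [fintypeNode : Fintype node]
  tree : SimpleGraph node
  isTree : tree.IsTree
  bag : node → Finset V
  cover_vertex : ∀ v, ∃ x, v ∈ bag x
  cover_edge : ∀ u v, G.Adj u v → ∃ x, u ∈ bag x ∧ v ∈ bag x
  connected : ∀ v, (tree.induce {x | v ∈ bag x}).Connected

attribute [instance] TreeDecomposition.fintypeNode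

/-- The largest bag size minus one (which is `-1` for a decomposition of the empty graph). -/
def TreeDecomposition.width {V : Type u} {G : SimpleGraph V} (D : TreeDecomposition G) : ℤ :=
  ((Finset.univ.sup fun x => (D.bag x).card : ℕ) : ℤ) - 1

/-- For every vertex `v`, the bags containing `v` are exactly the nodes of a path of the tree.
(In a tree, the subgraph induced by the nodes of a path is that path.) -/
def TreeDecomposition.IsSpaghetti {V : Type u} {G : SimpleGraph V}
    (D : TreeDecomposition G) : Prop :=
  ∀ v : V, ∃ (x y : D.node) (p : D.tree.Walk x y),
    p.IsPath ∧ ∀ z, z ∈ p.support ↔ v ∈ D.bag z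

/-- The minimum width of a spaghetti tree decomposition. For finite `G` the set below is nonempty
and bounded below, so the infimum in `ℤ` is a minimum. -/
def spaghettiTreewidth {V : Type u} (G : SimpleGraph V) : ℤ :=
  sInf {w : ℤ | ∃ D : TreeDecomposition G, D.IsSpaghetti ∧ D.width = w}

/-! ### Cell completion and chain trees of cycles -/

/-- Add an edge `vw` for all nonadjacent `v ≠ w` such that deleting `v` and `w` leaves at least
three connected components. -/
def cellCompletion {V : Type u} (G : SimpleGraph V) : SimpleGraph V where
  Adj v w := G.Adj v w ∨
    (v ≠ w ∧ 3 ≤ Nat.card (G.induce ({v, w}ᶜ : Set V)).ConnectedComponent)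
  symm := ⟨by
    rintro v w (h | ⟨h, hc⟩)
    · exact Or.inl h.symm
    · refine Or.inr ⟨h.symm, ?_⟩
      rwa [Set.pair_comm]⟩
  loopless := ⟨by
    rintro v (h | ⟨h, -⟩)
    · exact G.loopless.irrefl v h
    · exact h rfl⟩

/-- `G` is a cycle. -/
def IsCycleGraph {V : Type u} (G : SimpleGraph V) : Prop :=
  ∃ n, 3 ≤ n ∧ Nonempty (cycleGraph n ≃g G)

/-- The class of trees of cycles. In `glue`, the graph `G'` is the union of the images of a tree of
cycles `G` and of a cycle, and these images meet exactly in the two ends of an edge of both: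
it arises from the disjoint union by identifying an edge of `G` with an edge of the cycle. -/
inductive IsTreeOfCycles : ∀ {V : Type u}, SimpleGraph V → Prop
  | cycle {V : Type u} (G : SimpleGraph V) : IsCycleGraph G → IsTreeOfCycles G
  | glue {V W : Type u} (G : SimpleGraph V) (G' : SimpleGraph W) (n : ℕ)
      (f : V ↪ W) (g : Fin n ↪ W) (a b : V) (i j : Fin n) :
      IsTreeOfCycles G → 3 ≤ n →
      G.Adj a b → (cycleGraph n).Adj i j → f a = g i → f b = g j →
      Set.range f ∪ Set.range g = Set.univ →
      Set.range f ∩ Set.range g = {f a, f b} →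
      G' = G.map f ⊔ (cycleGraph n).map g →
      IsTreeOfCycles G'

/-- A chordless cycle of `G`: a subgraph that is a cycle, such that vertices on it that are adjacent
in `G` are consecutive on it. Triangles are chordless. -/
def IsChordlessCycle {V : Type u} {G : SimpleGraph V} (C : G.Subgraph) : Prop :=
  IsCycleGraph C.coe ∧ C.IsInduced

/-- The neighbourhood of `v` is a clique. -/
def IsSimplicialVertex {V : Type u} (G : SimpleGraph V) (v : V) : Prop :=
  G.IsClique (G.neighborSet v)

/-- A triangle of `G` that contains a simplicial vertex of `G`. -/
def IsSimplicialTriangle {V : Type u} {G : SimpleGraph V} (C : G.Subgraph) : Prop :=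
  Nonempty (cycleGraph 3 ≃g C.coe) ∧ ∃ v ∈ C.verts, IsSimplicialVertex G v

/-- A tree of cycles in which, whenever an edge lies in `m ≥ 3` chordless cycles, at least `m - 2`
of these are simplicial triangles. -/
def IsChainTreeOfCycles {V : Type u} (G : SimpleGraph V) : Prop :=
  IsTreeOfCycles G ∧
    ∀ e ∈ G.edgeSet, ∀ m : ℕ,
      m = {C : G.Subgraph | IsChordlessCycle C ∧ e ∈ C.edgeSet}.ncard → 3 ≤ m →
      m - 2 ≤ {C : G.Subgraph | IsChordlessCycle C ∧ e ∈ C.edgeSet ∧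
        IsSimplicialTriangle C}.ncard

end

end SpaghettiTw

namespace SpaghettiTw

open SimpleGraph

noncomputable section

/-! ### Connected vertex sets -/

/-! Minors to width. In a decomposition, the nodes whose bags meet a connected vertex set form a
subtree, and sets joined by an edge have intersecting subtrees. Subtrees have the Helly property, so
a `K4` minor forces four vertices into one bag. For a `D3` minor, shrink the two hubs to vertices
`a` and `b`. If their node sets are disjoint, the node of `a` nearest to `b` meets all three routes.
Otherwise each route meets the common nodes of `a` and `b`, and since the nodes of `a` form a path,
one route is caught between the other two. Its half near `a` and its half near `b` then share a bag
with both `a` and `b`. This is the only place where paths, rather than subtrees, are needed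
(`TreeDecomposition.no_three_long_routes`).

For a 2-connected graph, everything is compared with one condition: no `K4` minor, and no pair `a`,
`b` whose deletion leaves three components with at least two vertices each (`NoThreeLarge`). Three
such components give `D3` (`IsTwoConnected.noThreeLarge`).

This condition implies width two. By Menger's theorem for two paths, a component of `G - {a, b}`
contains a vertex `c` separating `a` from `b` in it, since otherwise there is a `K4` minor. The
component thus splits into a part attached at `a, c` and a part attached at `b, c`, and a bag `{a,
b, c}` connects decompositions of the two. The induction carries a root node at which the paths of
both attachment vertices end (`IsTwoConnected.rooted`). One-vertex components only lengthen these
paths at the root; at most two large components can use the two ends, which is where `NoThreeLarge`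
enters. Graphs that are not 2-connected are assembled along cut vertices.

The same condition describes the chain trees of cycles. Without a `K4` minor, a vertex of degree at
least three lies on an edge of the cell completion whose ends separate the graph. Splitting there
and adding that edge to both sides commutes with cell completion, so induction builds a tree of
cycles from the two sides. Conversely a tree of cycles has no `K4` minor. Chordless cycles through
an edge `ab` of the completion that are not simplicial triangles correspond to large components of
`G - {a, b}`, so the chain condition says exactly `NoThreeLarge`
(`IsTwoConnected.isChainTreeOfCycles_iff`). -/

/-- The vertex set `S` is nonempty and induces a connected subgraph. -/
abbrev Conn {V : Type u} (G : SimpleGraph V) (S : Set V) : Prop := (G.induce S).Connected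

section Conn

variable {V : Type u} {G : SimpleGraph V}

theorem Conn.nonempty {S : Set V} (h : Conn G S) : S.Nonempty :=
  Set.nonempty_coe_sort.1 (Connected.nonempty h)

/-- Membership in `U` propagates along every walk in `S`. Together with the converse
`conn_of_closed`, this closure form replaces walks in nearly all connectivity arguments below. -/
theorem Conn.eq_of_closed {S U : Set V} (h : Conn G S) (hU : U ⊆ S) (hne : U.Nonempty)
    (hc : ∀ x ∈ U, ∀ y ∈ S, G.Adj x y → y ∈ U) : U = S := by
  refine Set.Subset.antisymm hU fun y hy => ?_
  obtain ⟨x, hx⟩ := hne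
  obtain ⟨w⟩ := h.preconnected ⟨x, hU hx⟩ ⟨y, hy⟩
  have key : ∀ (a b : S) (w : (G.induce S).Walk a b), a.1 ∈ U → b.1 ∈ U := by
    intro a b w
    induction w with
    | nil => exact id
    | cons hadj _ ih => exact fun ha => ih (hc _ ha _ (Subtype.coe_prop _) hadj)
  exact key _ _ w hx

theorem Conn.exists_adj {S U : Set V} (h : Conn G S) (hU : U ⊆ S) (hne : U.Nonempty)
    (hne' : U ≠ S) : ∃ x ∈ U, ∃ y ∈ S, y ∉ U ∧ G.Adj x y := by
  by_contra! hcon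
  refine hne' (h.eq_of_closed hU hne fun x hx y hy hxy => ?_)
  by_contra hyU
  exact hcon x hx y hy hyU hxy

theorem conn_singleton (x : V) : Conn G {x} := by
  have : Nonempty ({x} : Set V) := ⟨⟨x, rfl⟩⟩
  exact ⟨fun a b => by rw [Subsingleton.elim a b]⟩

theorem Conn.union_of_adj {S T : Set V} (hS : Conn G S) (hT : Conn G T) {x y : V} (hx : x ∈ S)
    (hy : y ∈ T) (h : G.Adj x y) : Conn G (S ∪ T) :=
  connected_induce_union hS.preconnected hT.preconnected hx hy h

theorem Conn.union_of_mem {S T : Set V} (hS : Conn G S) (hT : Conn G T) {x : V} (hx : x ∈ S)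
    (hy : x ∈ T) : Conn G (S ∪ T) :=
  induce_union_connected hS.preconnected hT.preconnected ⟨x, hx, hy⟩

/-- The connected component of `x` in the subgraph induced by `S`. -/
def compIn (G : SimpleGraph V) (S : Set V) (x : V) : Set V :=
  ⋃₀ {T | T ⊆ S ∧ Conn G T ∧ x ∈ T}

theorem compIn_subset (S : Set V) (x : V) : compIn G S x ⊆ S :=
  Set.sUnion_subset fun _ h => h.1

theorem mem_compIn_self {S : Set V} {x : V} (hx : x ∈ S) : x ∈ compIn G S x :=
  ⟨{x}, ⟨Set.singleton_subset_iff.2 hx, conn_singleton x, rfl⟩, rfl⟩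

theorem conn_compIn {S : Set V} {x : V} (hx : x ∈ S) : Conn G (compIn G S x) := by
  apply induce_sUnion_connected_of_pairwise_not_disjoint
  · exact ⟨{x}, Set.singleton_subset_iff.2 hx, conn_singleton x, rfl⟩
  · rintro s t ⟨-, -, hs⟩ ⟨-, -, ht⟩
    exact ⟨x, hs, ht⟩
  · rintro s ⟨-, hs, -⟩
    exact hs

theorem Conn.subset_compIn {S T : Set V} {x : V} (hT : Conn G T) (hTS : T ⊆ S) (hx : x ∈ T) :
    T ⊆ compIn G S x :=
  fun _ hy => ⟨T, ⟨hTS, hT, hx⟩, hy⟩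

theorem compIn_closed {S : Set V} {x y z : V} (hy : y ∈ compIn G S x) (hz : z ∈ S)
    (h : G.Adj y z) : z ∈ compIn G S x := by
  obtain ⟨T, ⟨hTS, hT, hx⟩, hyT⟩ := hy
  exact ⟨T ∪ {z}, ⟨Set.union_subset hTS (Set.singleton_subset_iff.2 hz),
    hT.union_of_adj (conn_singleton z) hyT rfl h, Or.inl hx⟩, Or.inr rfl⟩

/-- The component of any point of `S` is closed under adjacency, so the hypothesis makes it all of
`S`. -/
theorem conn_of_closed {S : Set V} (hne : S.Nonempty)
    (h : ∀ U ⊆ S, U.Nonempty → (∀ x ∈ U, ∀ y ∈ S, G.Adj x y → y ∈ U) → U = S) : Conn G S := by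
  obtain ⟨x, hx⟩ := hne
  rw [← h _ (compIn_subset S x) ⟨x, mem_compIn_self hx⟩ fun _ hy _ hz h => compIn_closed hy hz h]
  exact conn_compIn hx

theorem Conn.mono_graph {H : SimpleGraph V} {S : Set V} (hS : Conn G S) (h : G ≤ H) :
    Conn H S :=
  Connected.mono (fun _ _ hab => h hab) hS

/-- Deleting a suitable vertex other than `r` leaves a connected set connected. -/
theorem Conn.exists_diff_singleton [Finite V] {S : Set V} (h : Conn G S) {r : V} (hr : r ∈ S)
    (hS : S ≠ {r}) : ∃ x ∈ S, x ≠ r ∧ Conn G (S \ {x}) := by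
  classical
  have hne : (S \ {r}).Nonempty := by
    rw [Set.sdiff_nonempty]
    exact fun h' => hS (Set.Subset.antisymm h' (Set.singleton_subset_iff.2 hr))
  -- The vertex `x` is chosen so that the component of `r` left by its deletion is as large as
  -- possible.
  obtain ⟨x, ⟨hxS, hxr⟩, hmax⟩ := Set.exists_max_image (S \ {r})
    (fun x => (compIn G (S \ {x}) r).ncard) (Set.toFinite _) hne
  have hr' : r ∈ S \ {x} := ⟨hr, fun h => hxr h.symm⟩
  refine ⟨x, hxS, hxr, ?_⟩
  by_cases hE : compIn G (S \ {x}) r = S \ {x}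
  · rw [← hE]
    exact conn_compIn hr'
  exfalso
  obtain ⟨z, hz, hzE⟩ : ∃ z ∈ S \ {x}, z ∉ compIn G (S \ {x}) r := by
    by_contra! hcon
    exact hE (Set.Subset.antisymm (compIn_subset _ _) hcon)
  have hzr : z ≠ r := by
    rintro rfl
    exact hzE (mem_compIn_self hr')
  have hxE : x ∉ compIn G (S \ {x}) r := fun h => (compIn_subset _ _ h).2 rfl
  obtain ⟨p, hp, q, hq, hqE, hpq⟩ := h.exists_adj
    ((compIn_subset (S \ {x}) r).trans Set.sdiff_subset) ⟨r, mem_compIn_self hr'⟩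
    (fun h => hzE (h.symm ▸ hz.1))
  have hqx : q = x := by
    by_contra hne
    exact hqE (compIn_closed hp ⟨hq, hne⟩ hpq)
  subst hqx
  -- If the component misses `z`, then deleting `z` instead keeps the whole component and also the
  -- deleted vertex adjacent to it, contradicting maximality.
  have hsub : compIn G (S \ {q}) r ∪ {q} ⊆ compIn G (S \ {z}) r := by
    refine Conn.subset_compIn ((conn_compIn hr').union_of_adj (conn_singleton q) hp rfl hpq) ?_
      (Or.inl (mem_compIn_self hr'))
    rintro y (hy | hy)
    · exact ⟨(compIn_subset _ _ hy).1, fun h => hzE (h ▸ hy)⟩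
    · have hy' : y = q := hy
      exact ⟨hy' ▸ hxS, fun h => hz.2 (h ▸ hy)⟩
  have h1 := Set.ncard_le_ncard hsub (Set.toFinite _)
  have h2 := hmax z ⟨hz.1, hzr⟩
  rw [Set.union_singleton, Set.ncard_insert_of_notMem hxE (Set.toFinite _)] at h1
  omega

/-- A connected set with an attachment set for each of three indices can be shrunk to a single
vertex, from which disjoint connected sets lead to the attachment sets. -/
theorem Conn.exists_tripod [Finite V] {B : Set V} (hB : Conn G B) (R : Fin 3 → Set V)
    (hRB : ∀ i, R i ⊆ B) (hR : ∀ i, (R i).Nonempty) :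
    ∃ b ∈ B, ∃ X : Fin 3 → Set V, (∀ i, X i ⊆ B \ {b}) ∧
      (∀ i j, i ≠ j → Disjoint (X i) (X j)) ∧
      ∀ i, (X i = ∅ ∧ b ∈ R i) ∨
        (Conn G (X i) ∧ (∃ x ∈ X i, G.Adj b x) ∧ (X i ∩ R i).Nonempty) := by
  classical
  induction hn : B.ncard using Nat.strong_induction_on generalizing B R with
  | _ n ih =>
  obtain ⟨r, hr⟩ := hB.nonempty
  by_cases hBr : B = {r}
  · refine ⟨r, hr, fun _ => ∅, by simp, by simp, fun i => Or.inl ⟨rfl, ?_⟩⟩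
    obtain ⟨x, hx⟩ := hR i
    have := hRB i hx
    rw [hBr] at this
    exact this ▸ hx
  obtain ⟨l₁, hl₁, hl₁r, hc₁⟩ := hB.exists_diff_singleton hr hBr
  obtain ⟨l₂, hl₂, hl₂₁, hc₂⟩ := hB.exists_diff_singleton hl₁ (by
    rintro rfl
    exact hl₁r (hr : r = l₁).symm)
  -- At most one attachment set may be lost with the deleted vertex. With only three indices, `l₁`
  -- and `l₂` cannot both be the sole attachment vertex for two of them.
  obtain ⟨l, hl, hc, i₀, hi₀⟩ : ∃ l ∈ B, Conn G (B \ {l}) ∧ ∃ i₀, ∀ i, i ≠ i₀ → R i ≠ {l} := by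
    by_cases h : ∃ i₀, ∀ i, i ≠ i₀ → R i ≠ {l₁}
    · exact ⟨l₁, hl₁, hc₁, h⟩
    refine ⟨l₂, hl₂, hc₂, ?_⟩
    push Not at h
    by_contra! h'
    obtain ⟨i, -, hi⟩ := h 0
    obtain ⟨j, hji, hj⟩ := h i
    obtain ⟨k, hki, hk⟩ := h' i
    obtain ⟨m, hmk, hm⟩ := h' k
    have e : ∀ a b, R a = {l₁} → R b = {l₂} → a ≠ b := by
      rintro a b h1 h2 rfl
      exact hl₂₁ (Set.singleton_injective (h2.symm.trans h1))
    have e1 := e i k hi hk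
    have e2 := e i m hi hm
    have e3 := e j k hj hk
    have e4 := e j m hj hm
    omega
  have hlt : (B \ {l}).ncard < n := by
    rw [← hn]
    exact Set.ncard_sdiff_singleton_lt_of_mem hl (Set.toFinite _)
  -- The attachment set that would become empty is replaced by the neighbours of the deleted vertex,
  -- which is put back at the end of that leg.
  by_cases hs : R i₀ = {l}
  · obtain ⟨x₀, hx₀, y₀, hy₀, hyl, hadj⟩ := hB.exists_adj (U := {l})
      (Set.singleton_subset_iff.2 hl) ⟨l, rfl⟩ (by
        intro h
        obtain ⟨x, hx⟩ := hc.nonempty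
        exact hx.2 (h ▸ hx.1))
    obtain rfl : x₀ = l := hx₀
    obtain ⟨b, hb, X, hX, hd, hX'⟩ := ih _ hlt hc
      (fun i => if i = i₀ then {y | y ∈ B \ {x₀} ∧ G.Adj x₀ y} else R i \ {x₀})
      (by
        intro i
        split_ifs
        · exact fun y hy => hy.1
        · exact Set.sdiff_subset_sdiff_left (hRB i))
      (by
        intro i
        split_ifs with h
        · exact ⟨y₀, ⟨hy₀, hyl⟩, hadj⟩
        · rw [Set.sdiff_nonempty]
          intro h'
          rcases Set.subset_singleton_iff_eq.1 h' with h'' | h''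
          · exact (hR i).ne_empty h''
          · exact hi₀ i h h'')
      rfl
    have hx₀X : ∀ i, x₀ ∉ X i := fun i h => (hX i h).1.2 rfl
    refine ⟨b, hb.1, fun i => if i = i₀ then X i ∪ {x₀} else X i, ?_, ?_, ?_⟩
    · intro i
      dsimp only
      split_ifs
      · refine Set.union_subset (fun y hy => ⟨(hX i hy).1.1, (hX i hy).2⟩) ?_
        exact Set.singleton_subset_iff.2 ⟨hl, fun h => hb.2 h.symm⟩
      · exact fun y hy => ⟨(hX i hy).1.1, (hX i hy).2⟩
    · intro i j hij
      dsimp only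
      split_ifs with h1 h2 h2
      · exact absurd (h1.trans h2.symm) hij
      · exact Set.disjoint_union_left.2 ⟨hd i j hij, Set.disjoint_singleton_left.2 (hx₀X j)⟩
      · exact Set.disjoint_union_right.2 ⟨hd i j hij, Set.disjoint_singleton_right.2 (hx₀X i)⟩
      · exact hd i j hij
    · intro i
      have := hX' i
      dsimp only at this ⊢
      split_ifs at this ⊢ with h
      · right
        subst h
        rcases this with ⟨h1, h2⟩ | ⟨h1, ⟨x, hx, hbx⟩, z, hz, hz'⟩
        · refine ⟨by simpa [h1] using conn_singleton x₀, ⟨x₀, Or.inr rfl, h2.2.symm⟩,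
            x₀, Or.inr rfl, hs ▸ rfl⟩
        · exact ⟨h1.union_of_adj (conn_singleton x₀) hz rfl hz'.2.symm, ⟨x, Or.inl hx, hbx⟩,
            x₀, Or.inr rfl, hs ▸ rfl⟩
      · rcases this with ⟨h1, h2⟩ | ⟨h1, h2, z, hz, hz'⟩
        · exact Or.inl ⟨h1, h2.1⟩
        · exact Or.inr ⟨h1, h2, z, hz, hz'.1⟩
  · obtain ⟨b, hb, X, hX, hd, hX'⟩ := ih _ hlt hc (fun i => R i \ {l})
      (fun i => Set.sdiff_subset_sdiff_left (hRB i))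
      (by
        intro i
        rw [Set.sdiff_nonempty]
        intro h'
        rcases Set.subset_singleton_iff_eq.1 h' with h'' | h''
        · exact (hR i).ne_empty h''
        · by_cases h : i = i₀
          · exact hs (h ▸ h'')
          · exact hi₀ i h h'')
      rfl
    refine ⟨b, hb.1, X, fun i y hy => ⟨(hX i hy).1.1, (hX i hy).2⟩, hd, fun i => ?_⟩
    rcases hX' i with ⟨h1, h2⟩ | ⟨h1, h2, z, hz, hz'⟩
    · exact Or.inl ⟨h1, h2.1⟩
    · exact Or.inr ⟨h1, h2, z, hz, hz'.1⟩

/-! ### Menger's theorem for two disjoint connections -/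

/-- `S` is connected, contained in `D`, and meets both `A` and `B`. -/
def Connects (G : SimpleGraph V) (D A B S : Set V) : Prop :=
  S ⊆ D ∧ Conn G S ∧ (S ∩ A).Nonempty ∧ (S ∩ B).Nonempty

theorem Connects.symm {D A B S : Set V} (h : Connects G D A B S) : Connects G D B A S :=
  ⟨h.1, h.2.1, h.2.2.2, h.2.2.1⟩

theorem Connects.exists_adj {D A B S : Set V} (h : Connects G D A B S) :
    (S ∩ A ∩ B).Nonempty ∨ ∃ x ∈ S ∩ A, ∃ y ∈ S, y ∉ A ∧ G.Adj x y := by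
  obtain ⟨-, hS, hA, y, hyS, hyB⟩ := h
  by_cases hSA : S ∩ A = S
  · exact Or.inl ⟨y, ⟨hyS, (hSA.symm ▸ hyS : y ∈ S ∩ A).2⟩, hyB⟩
  · obtain ⟨x, hx, z, hz, hz', hxz⟩ := hS.exists_adj Set.inter_subset_left hA hSA
    exact Or.inr ⟨x, hx, z, hz, fun h => hz' ⟨hz, h⟩, hxz⟩

/-- The vertices of `D` that can be reached from `A` without passing through `P`, and `P`. -/
def sideOf (G : SimpleGraph V) (D A P : Set V) : Set V :=
  P ∪ {y | ∃ S, S ⊆ D \ P ∧ Conn G S ∧ y ∈ S ∧ (S ∩ A).Nonempty}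

/-- Starting in `A`, keep the component of `S \ P` and add one vertex of `P` adjacent to it. If the
start is already in `P`, that vertex suffices. -/
theorem Connects.restrict_side {D A B P S : Set V} (hS : Connects G D A B S)
    (hP : ∀ S, Connects G D A B S → (S ∩ P).Nonempty) :
    ∃ S' ⊆ S, Connects G (sideOf G D A P) A P S' := by
  obtain ⟨hSD, hSc, ⟨p, hpS, hpA⟩, hSB⟩ := hS
  by_cases hpP : p ∈ P
  · exact ⟨{p}, Set.singleton_subset_iff.2 hpS, Set.singleton_subset_iff.2 (Or.inl hpP),
      conn_singleton p, ⟨p, rfl, hpA⟩, ⟨p, rfl, hpP⟩⟩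
  have hp' : p ∈ S \ P := ⟨hpS, hpP⟩
  obtain ⟨z, hz, hzP⟩ := hP S ⟨hSD, hSc, ⟨p, hpS, hpA⟩, hSB⟩
  obtain ⟨x, hx, y, hy, hyE, hxy⟩ := hSc.exists_adj
    ((compIn_subset (S \ P) p).trans Set.sdiff_subset) ⟨p, mem_compIn_self hp'⟩
    (fun h => (compIn_subset (G := G) (S \ P) p (h.symm ▸ hz)).2 hzP)
  have hyP : y ∈ P := by
    by_contra hyP
    exact hyE (compIn_closed hx ⟨hy, hyP⟩ hxy)
  refine ⟨compIn G (S \ P) p ∪ {y}, ?_, ?_, (conn_compIn hp').union_of_adj (conn_singleton y) hx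
    rfl hxy, ⟨p, Or.inl (mem_compIn_self hp'), hpA⟩, ⟨y, Or.inr rfl, hyP⟩⟩
  · exact Set.union_subset ((compIn_subset _ _).trans Set.sdiff_subset)
      (Set.singleton_subset_iff.2 hy)
  · refine Set.union_subset (fun w hw => Or.inr ⟨_, ?_, conn_compIn hp', hw, p,
      mem_compIn_self hp', hpA⟩) (Set.singleton_subset_iff.2 (Or.inl hyP))
    exact (compIn_subset _ _).trans (Set.sdiff_subset_sdiff_left hSD)

/-- A vertex outside `P` on both sides would join them to a connection that avoids `P`. -/
theorem sideOf_inter {D A B P : Set V} (hP : ∀ S, Connects G D A B S → (S ∩ P).Nonempty) {y : V}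
    (hA : y ∈ sideOf G D A P) (hB : y ∈ sideOf G D B P) : y ∈ P := by
  rcases hA with hA | ⟨S, hS, hSc, hyS, hSA⟩
  · exact hA
  rcases hB with hB | ⟨T, hT, hTc, hyT, hTB⟩
  · exact hB
  exfalso
  obtain ⟨z, hz, hzP⟩ := hP (S ∪ T) ⟨Set.union_subset (hS.trans Set.sdiff_subset)
    (hT.trans Set.sdiff_subset), hSc.union_of_mem hTc hyS hyT,
    hSA.mono (Set.inter_subset_inter_left _ Set.subset_union_left),
    hTB.mono (Set.inter_subset_inter_left _ Set.subset_union_right)⟩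
  rcases hz with hz | hz
  · exact (hS hz).2 hzP
  · exact (hT hz).2 hzP

theorem sideOf_subset {D A P : Set V} (hP : P ⊆ D) : sideOf G D A P ⊆ D := by
  rintro y (hy | ⟨S, hS, -, hy, -⟩)
  · exact hP hy
  · exact (hS hy).1

/-- Menger's theorem for two paths, in terms of connected sets. -/
theorem exists_disjoint_connects [Finite V] {D A B : Set V} (h0 : ∃ S, Connects G D A B S)
    (h : ∀ c, ∃ S, Connects G D A B S ∧ c ∉ S) :
    ∃ S T, Connects G D A B S ∧ Connects G D A B T ∧ Disjoint S T := by
  classical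
  induction hn : D.ncard using Nat.strong_induction_on generalizing D A B with
  | _ n ih =>
  by_cases hx : ∃ x ∈ D, x ∈ A ∧ x ∈ B
  · obtain ⟨x, hxD, hxA, hxB⟩ := hx
    obtain ⟨S, hS, hxS⟩ := h x
    exact ⟨{x}, S, ⟨Set.singleton_subset_iff.2 hxD, conn_singleton x, ⟨x, rfl, hxA⟩,
      ⟨x, rfl, hxB⟩⟩, hS, Set.disjoint_singleton_left.2 hxS⟩
  push Not at hx
  by_cases hx' : ∃ x ∈ D, x ∉ A ∧ x ∉ B
  · obtain ⟨x, hxD, hxA, hxB⟩ := hx'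
    have lift : ∀ S, Connects G (D \ {x}) A B S → Connects G D A B S :=
      fun S hS => ⟨hS.1.trans Set.sdiff_subset, hS.2⟩
    have lower : ∀ S, Connects G D A B S → x ∉ S → Connects G (D \ {x}) A B S :=
      fun S hS hxS => ⟨fun y hy => ⟨hS.1 hy, fun h => hxS (h ▸ hy)⟩, hS.2⟩
    have hlt : (D \ {x}).ncard < n := by
      rw [← hn]
      exact Set.ncard_sdiff_singleton_lt_of_mem hxD (Set.toFinite _)
    obtain ⟨S₀, hS₀, hxS₀⟩ := h x
    -- Either `x` can be deleted, or a single `c` separates after its deletion. In the latter case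
    -- `{x, c}` meets every connection; the problem is solved on each side of this pair, and the
    -- halves are matched at `x` and at `c`.
    by_cases hc : ∀ c, ∃ S, Connects G (D \ {x}) A B S ∧ c ∉ S
    · obtain ⟨S, T, hS, hT, hST⟩ := ih _ hlt ⟨S₀, lower _ hS₀ hxS₀⟩ hc rfl
      exact ⟨S, T, lift S hS, lift T hT, hST⟩
    push Not at hc
    obtain ⟨c, hc⟩ := hc
    have hcS₀ := hc _ (lower _ hS₀ hxS₀)
    have hcx : c ≠ x := fun h => hxS₀ (h ▸ hcS₀)
    have hcD : c ∈ D := hS₀.1 hcS₀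
    have hP : ∀ S, Connects G D A B S → (S ∩ {x, c}).Nonempty := by
      intro S hS
      by_cases hxS : x ∈ S
      · exact ⟨x, hxS, Or.inl rfl⟩
      · exact ⟨c, hc S (lower S hS hxS), Or.inr rfl⟩
    have hP' : ∀ S, Connects G D B A S → (S ∩ {x, c}).Nonempty := fun S hS => hP S hS.symm
    have hPD : ({x, c} : Set V) ⊆ D := by
      rintro y (rfl | rfl)
      · exact hxD
      · exact hcD
    have main : ∀ A B : Set V, x ∉ B → (∀ S, Connects G D A B S → (S ∩ {x, c}).Nonempty) →
        (∀ d, ∃ S, Connects G D A B S ∧ d ∉ S) →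
        ∃ S T, Connects G (sideOf G D A {x, c}) A {x, c} S ∧
          Connects G (sideOf G D A {x, c}) A {x, c} T ∧ Disjoint S T := by
      intro A B hxB hP h
      -- The side is smaller because it misses the `B`-end of a connection that avoids `c`.
      have hlt : (sideOf G D A {x, c}).ncard < n := by
        rw [← hn]
        refine Set.ncard_lt_ncard ?_ (Set.toFinite _)
        obtain ⟨S, hS, hcS⟩ := h c
        obtain ⟨z, hzS, hzB⟩ := hS.2.2.2
        have hzP : z ∉ ({x, c} : Set V) := by
          rintro (rfl | rfl)
          · exact hxB hzB
          · exact hcS hzS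
        refine (Set.ssubset_iff_of_subset (sideOf_subset hPD)).2 ⟨z, hS.1 hzS, fun hz => hzP ?_⟩
        exact sideOf_inter hP hz (Or.inr ⟨{z}, Set.singleton_subset_iff.2 ⟨hS.1 hzS, hzP⟩,
          conn_singleton z, rfl, z, rfl, hzB⟩)
      refine ih _ hlt ?_ ?_ rfl
      · obtain ⟨S, hS, -⟩ := h c
        obtain ⟨S', -, hS'⟩ := hS.restrict_side hP
        exact ⟨S', hS'⟩
      · intro d
        obtain ⟨S, hS, hd⟩ := h d
        obtain ⟨S', hsub, hS'⟩ := hS.restrict_side hP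
        exact ⟨S', hS', fun h => hd (hsub h)⟩
    have order : ∀ A : Set V, (∃ S T, Connects G (sideOf G D A {x, c}) A {x, c} S ∧
          Connects G (sideOf G D A {x, c}) A {x, c} T ∧ Disjoint S T) →
        ∃ S T, (S ⊆ sideOf G D A {x, c} ∧ Conn G S ∧ (S ∩ A).Nonempty ∧ x ∈ S) ∧
          (T ⊆ sideOf G D A {x, c} ∧ Conn G T ∧ (T ∩ A).Nonempty ∧ c ∈ T) ∧ Disjoint S T := by
      rintro A ⟨S, T, ⟨hS1, hS2, hS3, y, hyS, hy⟩, ⟨hT1, hT2, hT3, z, hzT, hz⟩, hd⟩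
      rcases hy with rfl | hy <;> rcases hz with rfl | hz
      · exact absurd rfl (hd.ne_of_mem hyS hzT)
      · exact ⟨S, T, ⟨hS1, hS2, hS3, hyS⟩, ⟨hT1, hT2, hT3, (show z = c from hz) ▸ hzT⟩, hd⟩
      · exact ⟨T, S, ⟨hT1, hT2, hT3, hzT⟩, ⟨hS1, hS2, hS3, (show y = c from hy) ▸ hyS⟩, hd.symm⟩
      · exact absurd ((show y = c from hy).trans (show z = c from hz).symm)
          (hd.ne_of_mem hyS hzT)
    obtain ⟨S, T, ⟨hS1, hS2, hS3, hxS⟩, ⟨hT1, hT2, hT3, hcT⟩, hST⟩ :=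
      order A (main A B hxB hP h)
    obtain ⟨S', T', ⟨hS1', hS2', hS3', hxS'⟩, ⟨hT1', hT2', hT3', hcT'⟩, hST'⟩ :=
      order B (main B A hxA hP' fun d => let ⟨S, hS, hd⟩ := h d; ⟨S, hS.symm, hd⟩)
    refine ⟨S ∪ S', T ∪ T', ⟨Set.union_subset (hS1.trans (sideOf_subset hPD))
      (hS1'.trans (sideOf_subset hPD)), hS2.union_of_mem hS2' hxS hxS',
      hS3.mono (Set.inter_subset_inter_left _ Set.subset_union_left),
      hS3'.mono (Set.inter_subset_inter_left _ Set.subset_union_right)⟩,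
      ⟨Set.union_subset (hT1.trans (sideOf_subset hPD))
      (hT1'.trans (sideOf_subset hPD)), hT2.union_of_mem hT2' hcT hcT',
      hT3.mono (Set.inter_subset_inter_left _ Set.subset_union_left),
      hT3'.mono (Set.inter_subset_inter_left _ Set.subset_union_right)⟩, ?_⟩
    rw [Set.disjoint_left]
    rintro y (hy | hy) (hy' | hy')
    · exact Set.disjoint_left.1 hST hy hy'
    · rcases sideOf_inter hP (hS1 hy) (hT1' hy') with rfl | hyc
      · exact Set.disjoint_left.1 hST' hxS' hy'
      · exact Set.disjoint_left.1 hST hy ((show y = c from hyc) ▸ hcT)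
    · rcases sideOf_inter hP (hT1 hy') (hS1' hy) with rfl | hyc
      · exact Set.disjoint_left.1 hST hxS hy'
      · exact Set.disjoint_left.1 hST' hy ((show y = c from hyc) ▸ hcT')
    · exact Set.disjoint_left.1 hST' hy hy'
  push Not at hx'
  -- Now `D` splits into a part in `A` and a part in `B`, so every connection contains an edge
  -- between the two. No vertex covers all these edges; an edge `pq`, one avoiding `p` and one
  -- avoiding `q` include two disjoint ones.
  have edge : ∀ S, Connects G D A B S → ∃ p ∈ S, ∃ q ∈ S, p ∈ A ∧ q ∈ B ∧ G.Adj p q := by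
    intro S hS
    rcases hS.exists_adj with ⟨z, ⟨hzS, hzA⟩, hzB⟩ | ⟨p, ⟨hpS, hpA⟩, q, hqS, hqA, hpq⟩
    · exact absurd hzB (hx z (hS.1 hzS) hzA)
    · exact ⟨p, hpS, q, hqS, hpA, hx' q (hS.1 hqS) hqA, hpq⟩
  have edge' : ∀ c, ∃ p ∈ D, ∃ q ∈ D, p ∈ A ∧ q ∈ B ∧ G.Adj p q ∧ p ≠ c ∧ q ≠ c := by
    intro c
    obtain ⟨S, hS, hc⟩ := h c
    obtain ⟨p, hp, q, hq, hpA, hqB, hpq⟩ := edge S hS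
    exact ⟨p, hS.1 hp, q, hS.1 hq, hpA, hqB, hpq, fun h => hc (h ▸ hp), fun h => hc (h ▸ hq)⟩
  have fin : ∀ p q p' q', p ∈ D → q ∈ D → p ∈ A → q ∈ B → G.Adj p q → p' ∈ D → q' ∈ D →
      p' ∈ A → q' ∈ B → G.Adj p' q' → p ≠ p' → q ≠ q' →
      ∃ S T, Connects G D A B S ∧ Connects G D A B T ∧ Disjoint S T := by
    intro p q p' q' hp hq hpA hqB hpq hp' hq' hpA' hqB' hpq' h1 h2
    refine ⟨{p, q}, {p', q'}, ⟨Set.pair_subset hp hq, induce_pair_connected_of_adj hpq,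
      ⟨p, Or.inl rfl, hpA⟩, ⟨q, Or.inr rfl, hqB⟩⟩, ⟨Set.pair_subset hp' hq',
      induce_pair_connected_of_adj hpq', ⟨p', Or.inl rfl, hpA'⟩, ⟨q', Or.inr rfl, hqB'⟩⟩, ?_⟩
    have h3 : p ≠ q' := by rintro rfl; exact hx _ hp hpA hqB'
    have h4 : q ≠ p' := by rintro rfl; exact hx _ hq hpA' hqB
    simp [Set.disjoint_left, h1, h2, h3, h4]
  obtain ⟨S, hS⟩ := h0
  obtain ⟨p, hp, q, hq, hpA, hqB, hpq⟩ := edge S hS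
  have hp := hS.1 hp
  have hq := hS.1 hq
  obtain ⟨p', hp', q', hq', hpA', hqB', hpq', hne, -⟩ := edge' p
  by_cases hqq : q = q'
  · subst hqq
    obtain ⟨p'', hp'', q'', hq'', hpA'', hqB'', hpq'', -, hne''⟩ := edge' q
    by_cases h1 : p = p''
    · subst h1
      exact fin p' q p q'' hp' hq' hpA' hqB' hpq' hp'' hq'' hpA'' hqB'' hpq'' hne hne''.symm
    · exact fin p q p'' q'' hp hq hpA hqB hpq hp'' hq'' hpA'' hqB'' hpq'' h1 hne''.symm
  · exact fin p q p' q' hp hq hpA hqB hpq hp' hq' hpA' hqB' hpq' hne.symm hqq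

end Conn

end

end SpaghettiTw

namespace SpaghettiTw

open SimpleGraph

noncomputable section

/-! ### Subtrees of trees -/

section Trees

variable {N : Type v} {T : SimpleGraph N}

theorem isPath_append {x y z : N} {p : T.Walk x y} {q : T.Walk y z} (hp : p.IsPath)
    (hq : q.IsPath) (h : ∀ w ∈ p.support, w ∈ q.support → w = y) : (p.append q).IsPath := by
  rw [Walk.isPath_def, Walk.support_append, List.nodup_append']
  refine ⟨hp.support_nodup, hq.support_nodup.tail, fun w hw hw' => ?_⟩
  have hwy := h w hw (List.mem_of_mem_tail hw')
  subst hwy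
  have := hq.support_nodup
  rw [← Walk.cons_tail_support, List.nodup_cons] at this
  exact this.1 hw'

theorem Conn.exists_path {S : Set N} (hS : Conn T S) {x y : N} (hx : x ∈ S) (hy : y ∈ S) :
    ∃ p : T.Walk x y, p.IsPath ∧ ∀ z ∈ p.support, z ∈ S := by
  classical
  obtain ⟨w⟩ := hS.preconnected ⟨x, hx⟩ ⟨y, hy⟩
  refine ⟨(w.map (Embedding.induce S).toHom).bypass, Walk.bypass_isPath _, fun z hz => ?_⟩
  have := Walk.support_bypass_subset_support _ hz
  erw [Walk.support_map, List.mem_map] at this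
  obtain ⟨a, -, rfl⟩ := this
  exact a.2

theorem Conn.mem_of_mem_path {S : Set N} (hT : T.IsAcyclic) (hS : Conn T S) {x y : N} (hx : x ∈ S)
    (hy : y ∈ S) {p : T.Walk x y} (hp : p.IsPath) {z : N} (hz : z ∈ p.support) : z ∈ S := by
  obtain ⟨q, hq, hqS⟩ := hS.exists_path hx hy
  have : p = q := congrArg Subtype.val ((hT.subsingleton_path x y).elim ⟨p, hp⟩ ⟨q, hq⟩)
  exact hqS z (this ▸ hz)

theorem exists_first_mem {S : Set N} {x y : N} (p : T.Walk x y) (hy : y ∈ S) :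
    ∃ m ∈ S, ∃ q : T.Walk x m, (∀ w ∈ q.support, w ∈ p.support) ∧
      ∀ w ∈ q.support, w ∈ S → w = m := by
  induction p with
  | nil => exact ⟨_, hy, Walk.nil, by simp, by simp⟩
  | @cons a b c h p ih =>
    by_cases ha : a ∈ S
    · exact ⟨a, ha, Walk.nil, by simp, by simp⟩
    · obtain ⟨m, hm, q, hq, hq'⟩ := ih hy
      refine ⟨m, hm, Walk.cons h q, fun w hw => ?_, fun w hw hwS => ?_⟩
      · rw [Walk.support_cons, List.mem_cons] at hw ⊢
        exact hw.imp_right (hq w)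
      · rw [Walk.support_cons, List.mem_cons] at hw
        rcases hw with rfl | hw
        · exact absurd hwS ha
        · exact hq' w hw hwS

/-- Three pairwise intersecting subtrees of a tree have a common node. -/
theorem helly_three (hT : T.IsAcyclic) {A B C : Set N} (hA : Conn T A) (hB : Conn T B)
    (hC : Conn T C) (hAB : (A ∩ B).Nonempty) (hBC : (B ∩ C).Nonempty) (hAC : (A ∩ C).Nonempty) :
    (A ∩ B ∩ C).Nonempty := by
  classical
  obtain ⟨x, hxA, hxB⟩ := hAB
  obtain ⟨y, hyB, hyC⟩ := hBC
  obtain ⟨z, hzA, hzC⟩ := hAC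
  obtain ⟨P, hP, hPB⟩ := hB.exists_path hyB hxB
  obtain ⟨Q, hQ, hQC⟩ := hC.exists_path hzC hyC
  -- `m` is where the path in `C` from `z` first hits the path in `B` from `y` to `x`. Following the
  -- first to `m` and the second on to `x` gives a path with both ends in `A`, so `m` lies in `A` as
  -- well.
  obtain ⟨m, hm, q, hq, hqm⟩ := exists_first_mem (S := {w | w ∈ P.support}) Q
    (Walk.start_mem_support P)
  have hm' : m ∈ P.support := hm
  have hpath : (q.bypass.append (P.dropUntil m hm')).IsPath := by
    refine isPath_append (Walk.bypass_isPath q) (hP.dropUntil hm') fun w hw hw' => ?_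
    exact hqm w (Walk.support_bypass_subset_support _ hw) (Walk.support_dropUntil_subset_support _ _ hw')
  refine ⟨m, ⟨hA.mem_of_mem_path hT hzA hxA hpath ?_, hPB m hm'⟩, hQC m (hq m ?_)⟩
  · rw [Walk.mem_support_append_iff]
    exact Or.inl (Walk.end_mem_support _)
  · exact Walk.end_mem_support _

theorem Conn.inter (hT : T.IsAcyclic) {A B : Set N} (hA : Conn T A) (hB : Conn T B)
    (hAB : (A ∩ B).Nonempty) : Conn T (A ∩ B) := by
  refine conn_of_closed hAB fun U hU ⟨x, hx⟩ hc => ?_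
  refine Set.Subset.antisymm hU fun y hy => ?_
  obtain ⟨p, hp, hpA⟩ := hA.exists_path (hU hx).1 hy.1
  have hpB : ∀ z ∈ p.support, z ∈ B := fun z hz => hB.mem_of_mem_path hT (hU hx).2 hy.2 hp hz
  have key : ∀ {a b : N} (p : T.Walk a b), (∀ z ∈ p.support, z ∈ A ∩ B) → a ∈ U → b ∈ U := by
    intro a b p
    induction p with
    | nil => exact fun _ h => h
    | cons h p ih =>
      intro hp ha
      refine ih (fun z hz => hp z (by simp [hz])) (hc _ ha _ (hp _ (by simp)) h)
  exact key p (fun z hz => ⟨hpA z hz, hpB z hz⟩) hx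

/-- Three-set Helly is applied to the subtree `A 0 ∩ A 1` and the other two. -/
theorem helly_four (hT : T.IsAcyclic) {A : Fin 4 → Set N} (hA : ∀ i, Conn T (A i))
    (h : ∀ i j, i ≠ j → (A i ∩ A j).Nonempty) : ∃ x, ∀ i, x ∈ A i := by
  have h3 : ∀ i, i ≠ 0 → i ≠ 1 → (A 0 ∩ A 1 ∩ A i).Nonempty := fun i h0 h1 =>
    helly_three hT (hA 0) (hA 1) (hA i) (h 0 1 (by decide)) (h 1 i h1.symm) (h 0 i h0.symm)
  obtain ⟨x, ⟨⟨h0, h1⟩, h2⟩, h3⟩ := helly_three hT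
    ((hA 0).inter hT (hA 1) (h 0 1 (by decide))) (hA 2) (hA 3)
    (h3 2 (by decide) (by decide)) (h 2 3 (by decide)) (h3 3 (by decide) (by decide))
  refine ⟨x, fun i => ?_⟩
  fin_cases i <;> assumption

/-- The nodes of a walk with positions from `i` to `k`. -/
def walkSegment {x y : N} (p : T.Walk x y) (i k : ℕ) : Set N :=
  {z | ∃ j, i ≤ j ∧ j ≤ k ∧ p.getVert j = z}

theorem conn_walkSegment {x y : N} (p : T.Walk x y) {i k : ℕ} (hik : i ≤ k) :
    Conn T (walkSegment p i k) := by
  induction k, hik using Nat.le_induction with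
  | base =>
    have : walkSegment p i i = {p.getVert i} := by
      ext z
      constructor
      · rintro ⟨j, h1, h2, rfl⟩
        rw [le_antisymm h2 h1]
        rfl
      · rintro rfl
        exact ⟨i, le_rfl, le_rfl, rfl⟩
    rw [this]
    exact conn_singleton _
  | succ k hik ih =>
    have : walkSegment p i (k + 1) = walkSegment p i k ∪ {p.getVert (k + 1)} := by
      ext z
      constructor
      · rintro ⟨j, h1, h2, rfl⟩
        rcases Nat.lt_or_ge k j with h | h
        · right
          rw [le_antisymm h2 h]
          rfl
        · exact Or.inl ⟨j, h1, h, rfl⟩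
      · rintro (⟨j, h1, h2, rfl⟩ | rfl)
        · exact ⟨j, h1, by omega, rfl⟩
        · exact ⟨k + 1, by omega, le_rfl, rfl⟩
    rw [this]
    rcases Nat.lt_or_ge k p.length with h | h
    · exact ih.union_of_adj (conn_singleton _) ⟨k, hik, le_rfl, rfl⟩ rfl (p.adj_getVert_succ h)
    · refine ih.union_of_mem (conn_singleton _) (x := p.getVert (k + 1)) ⟨k, hik, le_rfl, ?_⟩ rfl
      rw [Walk.getVert_of_length_le p h, Walk.getVert_of_length_le p (by omega)]

theorem walkSegment_subset (hT : T.IsAcyclic) {x y : N} {p : T.Walk x y} (hp : p.IsPath) {i k : ℕ}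
    {S : Set N} (hS : Conn T S) (hi : p.getVert i ∈ S) (hk : p.getVert k ∈ S) :
    walkSegment p i k ⊆ S := by
  rintro z ⟨j, h1, h2, rfl⟩
  have hk' : (p.drop i).getVert (k - i) ∈ S := by
    rw [Walk.drop_getVert, Nat.add_sub_cancel' (h1.trans h2)]
    exact hk
  refine hS.mem_of_mem_path hT hi hk' ((hp.drop i).take (k - i)) ?_
  have : ((p.drop i).take (k - i)).getVert (j - i) = p.getVert j := by
    rw [Walk.take_getVert, Walk.drop_getVert]
    congr 1
    omega
  rw [← this]
  exact Walk.getVert_mem_support _ _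

/-- Subtrees are convex: one that contains position `j` but neither `i` nor `k` cannot reach past
them along the path. -/
theorem mem_walkSegment_of_notMem (hT : T.IsAcyclic) {x y : N} {p : T.Walk x y} (hp : p.IsPath)
    {i j k m : ℕ} {S : Set N} (hS : Conn T S) (hij : i ≤ j) (hjk : j ≤ k) (hi : p.getVert i ∉ S)
    (hk : p.getVert k ∉ S) (hj : p.getVert j ∈ S) (hm : p.getVert m ∈ S) :
    p.getVert m ∈ walkSegment p i k := by
  refine ⟨m, ?_, ?_, rfl⟩
  · by_contra! h
    exact hi (walkSegment_subset hT hp hS hm hj ⟨i, h.le, hij, rfl⟩)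
  · by_contra! h
    exact hk (walkSegment_subset hT hp hS hj hm ⟨k, hjk, h.le, rfl⟩)

end Trees

/-! ### Graphs of spaghetti treewidth at most two have no `K₄` and no `D₃` minor -/

section NoMinor

variable {V : Type u} {G : SimpleGraph V} (D : TreeDecomposition G)

/-- The nodes whose bags meet `Y`. -/
def TreeDecomposition.nodesOf (Y : Set V) : Set D.node := {x | ∃ v ∈ Y, v ∈ D.bag x}

variable {D}

/-- The node sets of single vertices are subtrees, those of adjacent vertices overlap, and `Y` is
connected, so their union is connected. -/
theorem TreeDecomposition.conn_nodesOf {Y : Set V} (hY : Conn G Y) : Conn D.tree (D.nodesOf Y) := by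
  refine conn_of_closed ?_ fun U hU ⟨x, hx⟩ hc => ?_
  · obtain ⟨v, hv⟩ := hY.nonempty
    obtain ⟨x, hx⟩ := D.cover_vertex v
    exact ⟨x, v, hv, hx⟩
  have key : ∀ v ∈ Y, ∀ x ∈ U, v ∈ D.bag x → ∀ y, v ∈ D.bag y → y ∈ U := by
    intro v hv x hxU hx y hy
    have hcon : Conn D.tree {x | v ∈ D.bag x} := D.connected v
    have h1 : U ∩ {x | v ∈ D.bag x} = {x | v ∈ D.bag x} := by
      refine hcon.eq_of_closed Set.inter_subset_right ⟨x, hxU, hx⟩ ?_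
      rintro a ⟨haU, ha⟩ b hb hab
      exact ⟨hc a haU b ⟨v, hv, hb⟩ hab, hb⟩
    exact (h1.symm ▸ hy : y ∈ U ∩ {x | v ∈ D.bag x}).1
  have hY' : {v | v ∈ Y ∧ ∃ x ∈ U, v ∈ D.bag x} = Y := by
    refine hY.eq_of_closed (fun v hv => hv.1) ?_ ?_
    · obtain ⟨v, hv, hvx⟩ := hU hx
      exact ⟨v, hv, x, hx, hvx⟩
    · rintro a ⟨haY, z, hzU, hz⟩ b hb hab
      obtain ⟨w, hw1, hw2⟩ := D.cover_edge a b hab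
      exact ⟨hb, w, key a haY z hzU hz w hw1, hw2⟩
  refine Set.Subset.antisymm hU ?_
  rintro y ⟨v, hv, hvy⟩
  obtain ⟨-, z, hzU, hz⟩ := hY'.symm ▸ hv
  exact key v hv z hzU hz y hvy

theorem TreeDecomposition.nodesOf_inter {Y Z : Set V} {y z : V} (hy : y ∈ Y) (hz : z ∈ Z)
    (h : G.Adj y z) : (D.nodesOf Y ∩ D.nodesOf Z).Nonempty := by
  obtain ⟨x, hx, hx'⟩ := D.cover_edge y z h
  exact ⟨x, ⟨y, hy, hx⟩, z, hz, hx'⟩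

theorem TreeDecomposition.nodesOf_mono {Y Z : Set V} (h : Y ⊆ Z) : D.nodesOf Y ⊆ D.nodesOf Z :=
  fun _ ⟨v, hv, hx⟩ => ⟨v, h hv, hx⟩

/-- Disjoint sets have distinct representatives in the bag. This turns a common node found by Helly
into a lower bound on a bag. -/
theorem TreeDecomposition.card_le_card_bag {n : ℕ} {Y : Fin n → Set V} {x : D.node}
    (hY : ∀ i j, i ≠ j → Disjoint (Y i) (Y j)) (hx : ∀ i, x ∈ D.nodesOf (Y i)) :
    n ≤ (D.bag x).card := by
  classical
  choose f hf hf' using hx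
  have hinj : Function.Injective f := by
    intro i j hij
    by_contra hne
    exact Set.disjoint_left.1 (hY i j hne) (hf i) (hij ▸ hf j)
  calc n = (Finset.univ.image f).card := by
        rw [Finset.card_image_of_injective _ hinj, Finset.card_univ, Fintype.card_fin]
    _ ≤ _ := Finset.card_le_card fun v hv => by
        obtain ⟨i, -, rfl⟩ := Finset.mem_image.1 hv
        exact hf' i

theorem TreeDecomposition.not_isMinor_K4 (hD : ∀ x, (D.bag x).card ≤ 3) : ¬ IsMinor K4 G := by
  rintro ⟨B, hB, hd, hadj⟩
  obtain ⟨x, hx⟩ := helly_four D.isTree.isAcyclic (fun i => D.conn_nodesOf (hB i))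
    fun i j hij => by
      obtain ⟨y, hy, z, hz, hyz⟩ := hadj i j hij
      exact D.nodesOf_inter hy hz hyz
  have := D.card_le_card_bag hd hx
  have := hD x
  omega

theorem TreeDecomposition.notMem_nodesOf_four (hD : ∀ x, (D.bag x).card ≤ 3) {A B C E : Set V}
    (hAB : Disjoint A B) (hAC : Disjoint A C) (hAE : Disjoint A E) (hBC : Disjoint B C)
    (hBE : Disjoint B E) (hCE : Disjoint C E) {x : D.node} (hA : x ∈ D.nodesOf A)
    (hB : x ∈ D.nodesOf B) (hC : x ∈ D.nodesOf C) (hE : x ∈ D.nodesOf E) : False := by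
  have := D.card_le_card_bag (Y := ![A, B, C, E]) (x := x) (fun i j hij => by
    fin_cases i <;> fin_cases j <;> first
      | exact absurd rfl hij
      | assumption
      | exact Disjoint.symm (by assumption)) (fun i => by
    fin_cases i <;> assumption)
  have := hD x
  omega

theorem TreeDecomposition.nodesOf_singleton (v : V) : D.nodesOf {v} = {x | v ∈ D.bag x} := by
  ext x
  simp [TreeDecomposition.nodesOf]

/-- Here `Y i` and `Z i` are the halves of the `i`-th route near `a` and near `b`. In every case
four disjoint sets end up in one bag: `a` with three routes if the node sets of `a` and `b` are
disjoint, and otherwise `a` and `b` with either two routes or both halves of one route. -/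
theorem TreeDecomposition.no_three_long_routes (hD : ∀ x, (D.bag x).card ≤ 3)
    (hs : D.IsSpaghetti) {a b : V} (hab : a ≠ b) {Y Z : Fin 3 → Set V}
    (hY : ∀ i, Conn G (Y i)) (hZ : ∀ i, Conn G (Z i))
    (hYZ : ∀ i j, Disjoint (Y i) (Z j)) (hYY : ∀ i j, i ≠ j → Disjoint (Y i) (Y j))
    (hZZ : ∀ i j, i ≠ j → Disjoint (Z i) (Z j)) (haY : ∀ i, a ∉ Y i) (haZ : ∀ i, a ∉ Z i)
    (hbY : ∀ i, b ∉ Y i) (hbZ : ∀ i, b ∉ Z i) (hY' : ∀ i, ∃ y ∈ Y i, G.Adj a y)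
    (hZ' : ∀ i, ∃ z ∈ Z i, G.Adj b z) (hYZ' : ∀ i, ∃ y ∈ Y i, ∃ z ∈ Z i, G.Adj y z) : False := by
  have hac := D.isTree.isAcyclic
  have hX : ∀ i, Conn G (Y i ∪ Z i) := fun i => by
    obtain ⟨y, hy, z, hz, hyz⟩ := hYZ' i
    exact (hY i).union_of_adj (hZ i) hy hz hyz
  have hXX : ∀ i j, i ≠ j → Disjoint (Y i ∪ Z i) (Y j ∪ Z j) := fun i j hij =>
    Set.disjoint_union_left.2 ⟨Set.disjoint_union_right.2 ⟨hYY i j hij, hYZ i j⟩,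
      Set.disjoint_union_right.2 ⟨(hYZ j i).symm, hZZ i j hij⟩⟩
  have haX : ∀ i, Disjoint {a} (Y i ∪ Z i) := fun i => by
    simp [haY i, haZ i]
  have hbX : ∀ i, Disjoint {b} (Y i ∪ Z i) := fun i => by
    simp [hbY i, hbZ i]
  have hdab : Disjoint ({a} : Set V) {b} := by simpa using hab
  have hA : Conn D.tree (D.nodesOf {a}) := D.conn_nodesOf (conn_singleton a)
  have hB : Conn D.tree (D.nodesOf {b}) := D.conn_nodesOf (conn_singleton b)
  have hTX : ∀ i, Conn D.tree (D.nodesOf (Y i ∪ Z i)) := fun i => D.conn_nodesOf (hX i)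
  have hAY : ∀ i, (D.nodesOf {a} ∩ D.nodesOf (Y i)).Nonempty := fun i => by
    obtain ⟨y, hy, hay⟩ := hY' i
    exact D.nodesOf_inter (by rfl) hy hay
  have hBZ : ∀ i, (D.nodesOf {b} ∩ D.nodesOf (Z i)).Nonempty := fun i => by
    obtain ⟨y, hy, hay⟩ := hZ' i
    exact D.nodesOf_inter (by rfl) hy hay
  have hAX : ∀ i, (D.nodesOf {a} ∩ D.nodesOf (Y i ∪ Z i)).Nonempty := fun i =>
    (hAY i).mono (Set.inter_subset_inter_right _ (D.nodesOf_mono Set.subset_union_left))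
  have hBX : ∀ i, (D.nodesOf {b} ∩ D.nodesOf (Y i ∪ Z i)).Nonempty := fun i =>
    (hBZ i).mono (Set.inter_subset_inter_right _ (D.nodesOf_mono Set.subset_union_right))
  by_cases hAB : (D.nodesOf {a} ∩ D.nodesOf {b}).Nonempty
  · have hq : ∀ i, (D.nodesOf {a} ∩ D.nodesOf {b} ∩ D.nodesOf (Y i ∪ Z i)).Nonempty := fun i =>
      helly_three hac hA hB (hTX i) hAB (hBX i) (hAX i)
    choose q hq using hq
    have hqne : ∀ i j, i ≠ j → q i ∉ D.nodesOf (Y j ∪ Z j) := fun i j hij h =>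
      D.notMem_nodesOf_four hD hdab (haX i) (haX j) (hbX i) (hbX j) (hXX i j hij)
        (hq i).1.1 (hq i).1.2 (hq i).2 h
    obtain ⟨xa, ya, p, hp, hpa⟩ := hs a
    obtain ⟨xb, yb, p', hp', hpb⟩ := hs b
    have hpa' : ∀ z, z ∈ p.support ↔ z ∈ D.nodesOf {a} := by
      rw [D.nodesOf_singleton]
      exact hpa
    have hpb' : ∀ z, z ∈ p'.support ↔ z ∈ D.nodesOf {b} := by
      rw [D.nodesOf_singleton]
      exact hpb
    have hn : ∀ i, ∃ n, p.getVert n = q i := fun i => by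
      obtain ⟨n, hn, -⟩ := Walk.mem_support_iff_exists_getVert.1 ((hpa' _).2 (hq i).1.1)
      exact ⟨n, hn⟩
    have hn' : ∀ i, ∃ n, p'.getVert n = q i := fun i => by
      obtain ⟨n, hn, -⟩ := Walk.mem_support_iff_exists_getVert.1 ((hpb' _).2 (hq i).1.2)
      exact ⟨n, hn⟩
    choose n hn using hn
    choose n' hn' using hn'
    -- The common nodes are sorted by their position on the path of `a`; the route `j` is the middle
    -- one.
    obtain ⟨i, j, k, hij, hjk, hnij, hnjk⟩ : ∃ i j k, i ≠ j ∧ j ≠ k ∧ n i ≤ n j ∧ n j ≤ n k := by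
      have hmono := Tuple.monotone_sort n
      refine ⟨Tuple.sort n 0, Tuple.sort n 1, Tuple.sort n 2, ?_, ?_, hmono (by decide),
        hmono (by decide)⟩
      · exact fun h => absurd ((Tuple.sort n).injective h) (by decide)
      · exact fun h => absurd ((Tuple.sort n).injective h) (by decide)
    have hS : Conn D.tree (walkSegment p (n i) (n k)) := conn_walkSegment p (hnij.trans hnjk)
    have hSmin : ∀ {S : Set D.node}, Conn D.tree S → q i ∈ S → q k ∈ S →
        walkSegment p (n i) (n k) ⊆ S := fun hS hi hk =>
      walkSegment_subset hac hp hS ((hn i).symm ▸ hi) ((hn k).symm ▸ hk)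
    have hqi : q i ∈ walkSegment p (n i) (n k) := ⟨n i, le_rfl, hnij.trans hnjk, hn i⟩
    have hqk : q k ∈ walkSegment p (n i) (n k) := ⟨n k, hnij.trans hnjk, le_rfl, hn k⟩
    have hqj : q j ∈ walkSegment p (n i) (n k) := ⟨n j, hnij, hnjk, hn j⟩
    have hSA := hSmin hA (hq i).1.1 (hq k).1.1
    have hSB := hSmin hB (hq i).1.2 (hq k).1.2
    have hi' := hqne i j hij
    have hk' := hqne k j hjk.symm
    -- The subtree of route `j` contains the middle node but neither end of the segment, so its
    -- nodes on the path of `a` all lie in the segment.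
    have hSY : (walkSegment p (n i) (n k) ∩ D.nodesOf (Y j)).Nonempty := by
      obtain ⟨y, hyA, hy⟩ := hAY j
      refine ⟨y, ?_, hy⟩
      obtain ⟨m, rfl, -⟩ := Walk.mem_support_iff_exists_getVert.1 ((hpa' _).2 hyA)
      exact mem_walkSegment_of_notMem hac hp (hTX j) hnij hnjk ((hn i).symm ▸ hi')
        ((hn k).symm ▸ hk') ((hn j).symm ▸ (hq j).2) (D.nodesOf_mono Set.subset_union_left hy)
    -- The same on the path of `b`, where the two ends may come in the opposite order. The segment
    -- is contained in every subtree containing its ends, so the middle node is between them there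
    -- too.
    have hSZ : (walkSegment p (n i) (n k) ∩ D.nodesOf (Z j)).Nonempty := by
      obtain ⟨z, hzB, hz⟩ := hBZ j
      refine ⟨z, ?_, hz⟩
      have hz' := D.nodesOf_mono (Set.subset_union_right (s := Y j)) hz
      obtain ⟨m, rfl, -⟩ := Walk.mem_support_iff_exists_getVert.1 ((hpb' _).2 hzB)
      rcases le_total (n' i) (n' k) with h | h
      · have h1 := hSmin (conn_walkSegment p' h) ⟨n' i, le_rfl, h, hn' i⟩ ⟨n' k, h, le_rfl, hn' k⟩
        obtain ⟨l, hl1, hl2, hl⟩ := h1 hqj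
        exact walkSegment_subset hac hp' hS ((hn' i).symm ▸ hqi) ((hn' k).symm ▸ hqk)
          (mem_walkSegment_of_notMem hac hp' (hTX j) hl1 hl2 ((hn' i).symm ▸ hi')
            ((hn' k).symm ▸ hk') (hl.symm ▸ (hq j).2) hz')
      · have h1 := hSmin (conn_walkSegment p' h) ⟨n' i, h, le_rfl, hn' i⟩ ⟨n' k, le_rfl, h, hn' k⟩
        obtain ⟨l, hl1, hl2, hl⟩ := h1 hqj
        exact walkSegment_subset hac hp' hS ((hn' k).symm ▸ hqk) ((hn' i).symm ▸ hqi)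
          (mem_walkSegment_of_notMem hac hp' (hTX j) hl1 hl2 ((hn' k).symm ▸ hk')
            ((hn' i).symm ▸ hi') (hl.symm ▸ (hq j).2) hz')
    have hYZn : (D.nodesOf (Y j) ∩ D.nodesOf (Z j)).Nonempty := by
      obtain ⟨y, hy, z, hz, hyz⟩ := hYZ' j
      exact D.nodesOf_inter hy hz hyz
    obtain ⟨w, ⟨hwS, hwY⟩, hwZ⟩ := helly_three hac hS (D.conn_nodesOf (hY j))
      (D.conn_nodesOf (hZ j)) hSY hYZn hSZ
    exact D.notMem_nodesOf_four hD hdab (by simp [haY j]) (by simp [haZ j]) (by simp [hbY j])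
      (by simp [hbZ j]) (hYZ j j) (hSA hwS) (hSB hwS) hwY hwZ
  · obtain ⟨xb, hxb⟩ := hB.nonempty
    obtain ⟨xa, hxa⟩ := hA.nonempty
    obtain ⟨w⟩ := D.isTree.connected.preconnected xb xa
    -- `t` is the node at which a walk from the nodes of `b` first reaches those of `a`. Adjoining
    -- this walk to the nodes of `b` makes Helly applicable, and the common node can only be `t`.
    obtain ⟨t, ht, q, -, hq⟩ := exists_first_mem w hxa
    have hE : Conn D.tree (D.nodesOf {b} ∪ {x | x ∈ q.support}) :=
      hB.union_of_mem q.connected_induce_support hxb (Walk.start_mem_support q)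
    have hall : ∀ i, t ∈ D.nodesOf (Y i ∪ Z i) := fun i => by
      obtain ⟨s, ⟨hsA, hsE⟩, hsX⟩ := helly_three hac hA hE (hTX i)
        ⟨t, ht, Or.inr (Walk.end_mem_support q)⟩
        ((hBX i).mono (Set.inter_subset_inter_left _ Set.subset_union_left)) (hAX i)
      rcases hsE with hsE | hsE
      · exact absurd ⟨s, hsA, hsE⟩ hAB
      · rwa [← hq s hsE hsA]
    exact D.notMem_nodesOf_four hD (haX 0) (haX 1) (haX 2) (hXX 0 1 (by decide))
      (hXX 0 2 (by decide)) (hXX 1 2 (by decide)) ht (hall 0) (hall 1) (hall 2)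

/-- A connected set that is joined to three disjoint connected sets can be shrunk to one of its
vertices while enlarging the three sets inside it. -/
theorem Conn.exists_shrink [Finite V] {B : Set V} (hB : Conn G B) {Y : Fin 3 → Set V}
    (hY : ∀ i, Conn G (Y i)) (hd : ∀ i j, i ≠ j → Disjoint (Y i) (Y j))
    (hBY : ∀ i, Disjoint B (Y i)) (hadj : ∀ i, ∃ x ∈ B, ∃ y ∈ Y i, G.Adj x y) :
    ∃ b ∈ B, ∃ Y' : Fin 3 → Set V, (∀ i, Y i ⊆ Y' i) ∧ (∀ i, Y' i ⊆ Y i ∪ B \ {b}) ∧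
      (∀ i, Conn G (Y' i)) ∧ (∀ i j, i ≠ j → Disjoint (Y' i) (Y' j)) ∧
      ∀ i, ∃ y ∈ Y' i, G.Adj b y := by
  obtain ⟨b, hb, X, hXB, hXd, hX⟩ := hB.exists_tripod
    (fun i => {x | x ∈ B ∧ ∃ y ∈ Y i, G.Adj x y}) (fun i x hx => hx.1)
    (fun i => let ⟨x, hx, y, hy, h⟩ := hadj i; ⟨x, hx, y, hy, h⟩)
  refine ⟨b, hb, fun i => Y i ∪ X i, fun i => Set.subset_union_left,
    fun i => Set.union_subset_union_right _ (hXB i), fun i => ?_, fun i j hij => ?_, fun i => ?_⟩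
  · rcases hX i with ⟨h, -⟩ | ⟨h1, -, z, hz, -, y, hy, hzy⟩
    · simpa [h] using hY i
    · exact (hY i).union_of_adj h1 hy hz hzy.symm
  · have h1 : ∀ i j, Disjoint (Y i) (X j) := fun i j =>
      (hBY i).symm.mono_right ((hXB j).trans Set.sdiff_subset)
    exact Set.disjoint_union_left.2 ⟨Set.disjoint_union_right.2 ⟨hd i j hij, h1 i j⟩,
      Set.disjoint_union_right.2 ⟨(h1 j i).symm, hXd i j hij⟩⟩
  · rcases hX i with ⟨-, -, y, hy, hby⟩ | ⟨-, ⟨x, hx, hbx⟩, -⟩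
    · exact ⟨y, Or.inl hy, hby⟩
    · exact ⟨x, Or.inr hx, hbx⟩

/-- The spaghetti condition speaks of single vertices, so both hubs of the minor are shrunk to
vertices first. In the labelling of `D3`, hub `0` is adjacent to `2, 4, 6` and hub `1` to `3, 5, 7`.
-/
theorem TreeDecomposition.not_isMinor_D3 [Finite V] (hD : ∀ x, (D.bag x).card ≤ 3)
    (hs : D.IsSpaghetti) : ¬ IsMinor D3 G := by
  rintro ⟨B, hB, hd, hadj⟩
  obtain ⟨a, ha, Y, hYl, hYu, hYc, hYd, hYa⟩ := Conn.exists_shrink (hB 0) (Y := ![B 2, B 4, B 6])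
    (by intro i; fin_cases i <;> exact hB _)
    (by
      intro i j hij
      fin_cases i <;> fin_cases j <;> first
        | exact absurd rfl hij
        | exact hd _ _ (by decide))
    (by intro i; fin_cases i <;> exact hd _ _ (by decide))
    (by intro i; fin_cases i <;> exact hadj _ _ (by simp [D3]))
  obtain ⟨b, hb, Z, hZl, hZu, hZc, hZd, hZb⟩ := Conn.exists_shrink (hB 1) (Y := ![B 3, B 5, B 7])
    (by intro i; fin_cases i <;> exact hB _)
    (by
      intro i j hij
      fin_cases i <;> fin_cases j <;> first
        | exact absurd rfl hij
        | exact hd _ _ (by decide))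
    (by intro i; fin_cases i <;> exact hd _ _ (by decide))
    (by intro i; fin_cases i <;> exact hadj _ _ (by simp [D3]))
  have h0 : ∀ i, Disjoint (B 0) (![B 3, B 5, B 7] i) := by
    intro i; fin_cases i <;> exact hd _ _ (by decide)
  have h1 : ∀ i, Disjoint (B 1) (![B 2, B 4, B 6] i) := by
    intro i; fin_cases i <;> exact hd _ _ (by decide)
  have h01 := hd 0 1 (by decide)
  have h23 : ∀ i j, Disjoint (![B 2, B 4, B 6] i) (![B 3, B 5, B 7] j) := by
    intro i j; fin_cases i <;> fin_cases j <;> exact hd _ _ (by decide)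
  refine D.no_three_long_routes hD hs (by rintro rfl; exact Set.disjoint_left.1 h01 ha hb) hYc hZc
    (fun i j => ?_) hYd hZd (fun i h => ?_) (fun i h => ?_) (fun i h => ?_) (fun i h => ?_)
    hYa hZb (fun i => ?_)
  · refine (Set.disjoint_union_left.2 ⟨Set.disjoint_union_right.2 ⟨h23 i j, ?_⟩,
      Set.disjoint_union_right.2 ⟨?_, ?_⟩⟩).mono (hYu i) (hZu j)
    · exact (h1 i).symm.mono_right Set.sdiff_subset
    · exact (h0 j).mono_left Set.sdiff_subset
    · exact h01.mono Set.sdiff_subset Set.sdiff_subset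
  · rcases hYu i h with h | h
    · have : Disjoint (B 0) (![B 2, B 4, B 6] i) := by fin_cases i <;> exact hd _ _ (by decide)
      exact Set.disjoint_left.1 this ha h
    · exact h.2 rfl
  · rcases hZu i h with h | h
    · exact Set.disjoint_left.1 (h0 i) ha h
    · exact Set.disjoint_left.1 h01 ha h.1
  · rcases hYu i h with h | h
    · exact Set.disjoint_left.1 (h1 i) hb h
    · exact Set.disjoint_left.1 h01 h.1 hb
  · rcases hZu i h with h | h
    · have : Disjoint (B 1) (![B 3, B 5, B 7] i) := by fin_cases i <;> exact hd _ _ (by decide)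
      exact Set.disjoint_left.1 this hb h
    · exact h.2 rfl
  · obtain ⟨y, hy, z, hz, hyz⟩ : ∃ y ∈ ![B 2, B 4, B 6] i, ∃ z ∈ ![B 3, B 5, B 7] i,
        G.Adj y z := by
      fin_cases i <;> exact hadj _ _ (by simp [D3])
    exact ⟨y, hYl i hy, z, hZl i hz, hyz⟩

end NoMinor

/-! ### 2-connected graphs -/

section TwoConnected

variable {V : Type u} {G : SimpleGraph V}

theorem IsTwoConnected.conn_compl (hG : IsTwoConnected G) (x : V) : Conn G {x}ᶜ :=
  hG.2 {x} (by simp)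

theorem IsTwoConnected.conn_univ (hG : IsTwoConnected G) : Conn G Set.univ := by
  have := hG.2 ∅ (by simp)
  rwa [Set.compl_empty] at this

/-- Otherwise `E` is closed under adjacency in `G - y`, hence is all of it, although it misses `x`.
-/
theorem IsTwoConnected.exists_adj (hG : IsTwoConnected G) {E : Set V} {x y : V} (hxy : x ≠ y)
    (hE : E.Nonempty) (hx : x ∉ E) (hy : y ∉ E)
    (hc : ∀ e ∈ E, ∀ z, G.Adj e z → z ∈ E ∨ z = x ∨ z = y) : ∃ e ∈ E, G.Adj x e := by
  by_contra! hcon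
  have : E = {y}ᶜ := by
    refine (hG.conn_compl y).eq_of_closed (fun e he h => hy ((show e = y from h) ▸ he)) hE ?_
    intro e he z hz hez
    rcases hc e he z hez with h | rfl | rfl
    · exact h
    · exact absurd hez.symm (hcon e he)
    · exact absurd rfl hz
  exact hx (this ▸ hxy)

theorem IsTwoConnected.exists_third (hG : IsTwoConnected G) (x y : V) : ∃ z, z ≠ x ∧ z ≠ y := by
  by_contra! hcon
  have hsub : (Set.univ : Set V) ⊆ {x, y} := fun z _ => by
    by_cases h : z = x
    · exact Or.inl h
    · exact Or.inr (hcon z h)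
  have h1 := Set.ncard_le_ncard hsub (Set.toFinite _)
  rw [Set.ncard_univ] at h1
  have h2 := Set.ncard_insert_le x {y}
  rw [Set.ncard_singleton] at h2
  have := hG.1
  omega

theorem IsTwoConnected.exists_edge (hG : IsTwoConnected G) : ∃ a b, G.Adj a b := by
  obtain ⟨v, -⟩ := hG.conn_univ.nonempty
  obtain ⟨u, huv, -⟩ := hG.exists_third v v
  obtain ⟨a, -, b, -, -, h⟩ := hG.conn_univ.exists_adj (U := {v}) (Set.subset_univ _) ⟨v, rfl⟩
    (fun h => huv (h.symm ▸ Set.mem_univ u : u ∈ ({v} : Set V)))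
  exact ⟨a, b, h⟩

/-- An edge together with a component of the rest forms a triangle minor; Helly puts its three parts
into one bag. -/
theorem TreeDecomposition.exists_three_le_card (D : TreeDecomposition G) (hG : IsTwoConnected G) :
    ∃ x, 3 ≤ (D.bag x).card := by
  obtain ⟨v, x, hvx⟩ := hG.exists_edge
  have hvx' : v ≠ x := hvx.ne
  obtain ⟨w, hwv, hwx⟩ := hG.exists_third v x
  have hw : w ∈ ({v, x}ᶜ : Set V) := by simp [hwv, hwx]
  have hC := conn_compIn (G := G) hw
  have hsub := compIn_subset (G := G) {v, x}ᶜ w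
  have hvC : v ∉ compIn G {v, x}ᶜ w := fun h => hsub h (Or.inl rfl)
  have hxC : x ∉ compIn G {v, x}ᶜ w := fun h => hsub h (Or.inr rfl)
  have hcl : ∀ e ∈ compIn G {v, x}ᶜ w, ∀ z, G.Adj e z →
      z ∈ compIn G {v, x}ᶜ w ∨ z = v ∨ z = x := by
    intro e he z hez
    by_cases hz : z = v ∨ z = x
    · exact Or.inr hz
    · exact Or.inl (compIn_closed he hz hez)
  obtain ⟨e, he, hve⟩ := hG.exists_adj hvx' hC.nonempty hvC hxC hcl
  obtain ⟨e', he', hxe⟩ := hG.exists_adj hvx'.symm hC.nonempty hxC hvC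
    (fun e he z hez => (hcl e he z hez).imp_right Or.symm)
  obtain ⟨t, ⟨h1, h2⟩, h3⟩ := helly_three D.isTree.isAcyclic
    (D.conn_nodesOf (conn_singleton v)) (D.conn_nodesOf (conn_singleton x)) (D.conn_nodesOf hC)
    (D.nodesOf_inter rfl rfl hvx) (D.nodesOf_inter rfl he' hxe) (D.nodesOf_inter rfl he hve)
  refine ⟨t, D.card_le_card_bag (Y := ![{v}, {x}, compIn G {v, x}ᶜ w]) (fun i j hij => ?_)
    (fun i => ?_)⟩
  · have a1 : Disjoint ({v} : Set V) {x} := by simpa using hvx'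
    have a2 : Disjoint {v} (compIn G {v, x}ᶜ w) := by simpa using hvC
    have a3 : Disjoint {x} (compIn G {v, x}ᶜ w) := by simpa using hxC
    fin_cases i <;> fin_cases j <;> first
      | exact absurd rfl hij
      | assumption
      | exact Disjoint.symm (by assumption)
  · fin_cases i <;> assumption

end TwoConnected

end

end SpaghettiTw

namespace SpaghettiTw

open SimpleGraph

noncomputable section

/-! ### Joining trees of bags -/

section Join

variable {N₁ N₂ : Type} (T₁ : SimpleGraph N₁) (T₂ : SimpleGraph N₂) (x₁ : N₁) (x₂ : N₂)

/-- The disjoint union of two graphs with an additional edge between them. -/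
def joinTree : SimpleGraph (N₁ ⊕ N₂) := (T₁ ⊕g T₂) ⊔ edge (Sum.inl x₁) (Sum.inr x₂)

variable {T₁ T₂ x₁ x₂}

theorem joinTree_adj_inl {a b : N₁} (h : T₁.Adj a b) :
    (joinTree T₁ T₂ x₁ x₂).Adj (Sum.inl a) (Sum.inl b) := Or.inl h

theorem joinTree_adj_inr {a b : N₂} (h : T₂.Adj a b) :
    (joinTree T₁ T₂ x₁ x₂).Adj (Sum.inr a) (Sum.inr b) := Or.inl h

theorem joinTree_adj_inl_inr : (joinTree T₁ T₂ x₁ x₂).Adj (Sum.inl x₁) (Sum.inr x₂) :=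
  Or.inr (by simp [edge_adj])

theorem exists_path_map {N : Type} {T : SimpleGraph N} (f : N₁ → N) (hf : Function.Injective f)
    (h : ∀ a b, T₁.Adj a b → T.Adj (f a) (f b)) {x y : N₁} {p : T₁.Walk x y} (hp : p.IsPath) :
    ∃ q : T.Walk (f x) (f y), q.IsPath ∧ ∀ z, z ∈ q.support ↔ ∃ w ∈ p.support, f w = z := by
  induction p with
  | nil => exact ⟨Walk.nil, Walk.IsPath.nil, by simp [eq_comm]⟩
  | @cons a b c hab p ih =>
    rw [Walk.cons_isPath_iff] at hp
    obtain ⟨q, hq, hqs⟩ := ih hp.1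
    refine ⟨Walk.cons (h _ _ hab) q, hq.cons fun hmem => ?_, fun z => ?_⟩
    · obtain ⟨w, hw, hwa⟩ := (hqs _).1 hmem
      exact hp.2 (hf hwa ▸ hw)
    · rw [Walk.support_cons, List.mem_cons, hqs]
      simp only [Walk.support_cons, List.mem_cons, exists_eq_or_imp]
      rw [eq_comm]

theorem isTree_joinTree [Finite N₁] [Finite N₂] (h₁ : T₁.IsTree) (h₂ : T₂.IsTree) :
    (joinTree T₁ T₂ x₁ x₂).IsTree := by
  rw [isTree_iff_connected_and_card] at h₁ h₂ ⊢
  constructor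
  · rw [connected_iff_exists_forall_reachable]
    refine ⟨Sum.inl x₁, ?_⟩
    rintro (z | z)
    · exact (h₁.1.preconnected x₁ z).map ⟨Sum.inl, fun h => joinTree_adj_inl h⟩
    · exact joinTree_adj_inl_inr.reachable.trans
        ((h₂.1.preconnected x₂ z).map ⟨Sum.inr, fun h => joinTree_adj_inr h⟩)
  · have hne : (Sum.inl x₁ : N₁ ⊕ N₂) ≠ Sum.inr x₂ := by simp
    have hnot : s(Sum.inl x₁, Sum.inr x₂) ∉ (T₁ ⊕g T₂).edgeSet := by simp
    have h3 : Nat.card (T₁ ⊕g T₂).edgeSet = Nat.card T₁.edgeSet + Nat.card T₂.edgeSet := by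
      rw [Nat.card_congr edgeSetSumEquiv, Nat.card_sum]
    have h4 : (joinTree T₁ T₂ x₁ x₂).edgeSet =
        insert s(Sum.inl x₁, Sum.inr x₂) (T₁ ⊕g T₂).edgeSet := by
      rw [joinTree, edgeSet_sup, edgeSet_edge_of_ne hne, Set.union_singleton]
    rw [h4, Nat.card_coe_set_eq, Set.ncard_insert_of_notMem hnot (Set.toFinite _),
      ← Nat.card_coe_set_eq, h3, Nat.card_sum]
    omega

end Join

/-! ### Trees of bags and their joins -/

/-- A tree with bags of at most three vertices, such that the bags containing a given vertex, if
there are any, are the nodes of a path. -/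
structure BagTree (V : Type u) where
  node : Type
  [fintypeNode : Fintype node]
  tree : SimpleGraph node
  isTree : tree.IsTree
  bag : node → Finset V
  card_le : ∀ x, (bag x).card ≤ 3
  path : ∀ v, (∃ x, v ∈ bag x) → ∃ (x y : node) (p : tree.Walk x y),
    p.IsPath ∧ ∀ z, z ∈ p.support ↔ v ∈ bag z

attribute [instance] BagTree.fintypeNode

namespace BagTree

variable {V : Type u}

/-- The bags containing `v` form a path from `x` to `y`. -/
def PathOf (D : BagTree V) (v : V) (x y : D.node) : Prop :=
  ∃ p : D.tree.Walk x y, p.IsPath ∧ ∀ z, z ∈ p.support ↔ v ∈ D.bag z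

/-- The vertex `v` lies in some bag. -/
def Has (D : BagTree V) (v : V) : Prop := ∃ x, v ∈ D.bag x

theorem PathOf.symm {D : BagTree V} {v : V} {x y : D.node} (h : D.PathOf v x y) :
    D.PathOf v y x := by
  obtain ⟨p, hp, h⟩ := h
  exact ⟨p.reverse, hp.reverse, fun z => by rw [Walk.support_reverse, List.mem_reverse, h]⟩

/-- The tree with one node. -/
def single (s : Finset V) (hs : s.card ≤ 3) : BagTree V where
  node := Unit
  tree := ⊥
  isTree := IsTree.of_subsingleton
  bag _ := s
  card_le _ := hs
  path := fun v ⟨x, hx⟩ => ⟨x, x, Walk.nil, Walk.IsPath.nil, fun z => by simp [hx]⟩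

theorem pathOf_single {s : Finset V} {hs : s.card ≤ 3} {v : V} (hv : v ∈ s) :
    (single s hs).PathOf v () () :=
  ⟨Walk.nil, Walk.IsPath.nil, fun _ => ⟨fun _ => hv, fun _ => List.mem_singleton.2 rfl⟩⟩

section join

variable (D₁ D₂ : BagTree V) (x₁ : D₁.node) (x₂ : D₂.node)

theorem joinPath_left {v : V} {x y : D₁.node} (h : D₁.PathOf v x y) (h₂ : ¬ D₂.Has v) :
    ∃ p : (joinTree D₁.tree D₂.tree x₁ x₂).Walk (Sum.inl x) (Sum.inl y), p.IsPath ∧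
      ∀ z, z ∈ p.support ↔ v ∈ Sum.elim D₁.bag D₂.bag z := by
  obtain ⟨p, hp, h⟩ := h
  obtain ⟨q, hq, hqs⟩ := exists_path_map Sum.inl Sum.inl_injective
    (fun a b hab => joinTree_adj_inl (T₂ := D₂.tree) (x₁ := x₁) (x₂ := x₂) hab) hp
  refine ⟨q, hq, ?_⟩
  rintro (z | z)
  · simp [hqs, h]
  · simp only [hqs, reduceCtorEq, and_false, exists_false, Sum.elim_inr, false_iff]
    exact fun hz => h₂ ⟨z, hz⟩

theorem joinPath_right {v : V} {x y : D₂.node} (h : D₂.PathOf v x y) (h₁ : ¬ D₁.Has v) :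
    ∃ p : (joinTree D₁.tree D₂.tree x₁ x₂).Walk (Sum.inr x) (Sum.inr y), p.IsPath ∧
      ∀ z, z ∈ p.support ↔ v ∈ Sum.elim D₁.bag D₂.bag z := by
  obtain ⟨p, hp, h⟩ := h
  obtain ⟨q, hq, hqs⟩ := exists_path_map Sum.inr Sum.inr_injective
    (fun a b hab => joinTree_adj_inr (T₁ := D₁.tree) (x₁ := x₁) (x₂ := x₂) hab) hp
  refine ⟨q, hq, ?_⟩
  rintro (z | z)
  · simp only [hqs, reduceCtorEq, and_false, exists_false, Sum.elim_inl, false_iff]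
    exact fun hz => h₁ ⟨z, hz⟩
  · simp [hqs, h]

theorem joinPath_both {v : V} {x : D₁.node} {y : D₂.node} (h₁ : D₁.PathOf v x x₁)
    (h₂ : D₂.PathOf v x₂ y) :
    ∃ p : (joinTree D₁.tree D₂.tree x₁ x₂).Walk (Sum.inl x) (Sum.inr y), p.IsPath ∧
      ∀ z, z ∈ p.support ↔ v ∈ Sum.elim D₁.bag D₂.bag z := by
  obtain ⟨p, hp, h₁⟩ := h₁
  obtain ⟨q, hq, h₂⟩ := h₂
  obtain ⟨p', hp', hps⟩ := exists_path_map Sum.inl Sum.inl_injective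
    (fun a b hab => joinTree_adj_inl (T₂ := D₂.tree) (x₁ := x₁) (x₂ := x₂) hab) hp
  obtain ⟨q', hq', hqs⟩ := exists_path_map Sum.inr Sum.inr_injective
    (fun a b hab => joinTree_adj_inr (T₁ := D₁.tree) (x₁ := x₁) (x₂ := x₂) hab) hq
  have hq'' : (Walk.cons joinTree_adj_inl_inr q').IsPath := hq'.cons (by simp [hqs])
  refine ⟨p'.append (Walk.cons joinTree_adj_inl_inr q'), isPath_append hp' hq'' ?_, ?_⟩
  · intro w hw hw'
    rw [hps] at hw
    obtain ⟨a, -, rfl⟩ := hw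
    rw [Walk.support_cons, List.mem_cons, hqs] at hw'
    rcases hw' with h | ⟨b, -, hb⟩
    · exact h
    · exact absurd hb Sum.inr_ne_inl
  · intro z
    rw [Walk.mem_support_append_iff, Walk.support_cons, List.mem_cons, hps, hqs]
    have hx₁ : v ∈ D₁.bag x₁ := (h₁ _).1 (Walk.end_mem_support p)
    rcases z with z | z
    · simp only [Sum.inl.injEq, exists_eq_right, reduceCtorEq, and_false, exists_false, or_false,
        Sum.elim_inl, h₁]
      exact ⟨fun h => h.elim id fun h => h ▸ hx₁, Or.inl⟩
    · simp [h₂]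

/-- Two trees of bags, joined by an edge between nodes at which the paths of all common vertices
end. -/
def join (h : ∀ v, D₁.Has v → D₂.Has v → (∃ x, D₁.PathOf v x x₁) ∧ ∃ y, D₂.PathOf v x₂ y) :
    BagTree V where
  node := D₁.node ⊕ D₂.node
  tree := joinTree D₁.tree D₂.tree x₁ x₂
  isTree := isTree_joinTree D₁.isTree D₂.isTree
  bag := Sum.elim D₁.bag D₂.bag
  card_le := by
    rintro (x | x)
    · exact D₁.card_le x
    · exact D₂.card_le x
  path := by
    intro v hv
    by_cases h₁ : D₁.Has v
    · by_cases h₂ : D₂.Has v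
      · obtain ⟨⟨x, hx⟩, y, hy⟩ := h v h₁ h₂
        exact ⟨_, _, joinPath_both D₁ D₂ x₁ x₂ hx hy⟩
      · obtain ⟨x, y, hp⟩ := D₁.path v h₁
        exact ⟨_, _, joinPath_left D₁ D₂ x₁ x₂ hp h₂⟩
    · have h₂ : D₂.Has v := by
        obtain ⟨z | z, hz⟩ := hv
        · exact absurd ⟨z, hz⟩ h₁
        · exact ⟨z, hz⟩
      obtain ⟨x, y, hp⟩ := D₂.path v h₂
      exact ⟨_, _, joinPath_right D₁ D₂ x₁ x₂ hp h₁⟩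

variable {D₁ D₂ x₁ x₂}
variable {h : ∀ v, D₁.Has v → D₂.Has v → (∃ x, D₁.PathOf v x x₁) ∧ ∃ y, D₂.PathOf v x₂ y}

theorem PathOf.join_left {v : V} {x y : D₁.node} (hp : D₁.PathOf v x y) (h₂ : ¬ D₂.Has v) :
    (D₁.join D₂ x₁ x₂ h).PathOf v (Sum.inl x) (Sum.inl y) :=
  joinPath_left D₁ D₂ x₁ x₂ hp h₂

theorem PathOf.join_right {v : V} {x y : D₂.node} (hp : D₂.PathOf v x y) (h₁ : ¬ D₁.Has v) :
    (D₁.join D₂ x₁ x₂ h).PathOf v (Sum.inr x) (Sum.inr y) :=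
  joinPath_right D₁ D₂ x₁ x₂ hp h₁

theorem PathOf.join_both {v : V} {x : D₁.node} {y : D₂.node} (h₁ : D₁.PathOf v x x₁)
    (h₂ : D₂.PathOf v x₂ y) : (D₁.join D₂ x₁ x₂ h).PathOf v (Sum.inl x) (Sum.inr y) :=
  joinPath_both D₁ D₂ x₁ x₂ h₁ h₂

end join

/-- The restriction of a tree of bags to a set of vertices. -/
def restrict (D : BagTree V) (S : Set V) : BagTree V where
  node := D.node
  tree := D.tree
  isTree := D.isTree
  bag := by
    classical
    exact fun x => (D.bag x).filter (· ∈ S)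
  card_le x := by
    classical
    exact (Finset.card_filter_le _ _).trans (D.card_le x)
  path := by
    classical
    rintro v ⟨x, hx⟩
    obtain ⟨hx, hvS⟩ := Finset.mem_filter.1 hx
    obtain ⟨a, b, p, hp, h⟩ := D.path v ⟨x, hx⟩
    exact ⟨a, b, p, hp, fun z => by rw [h, Finset.mem_filter, and_iff_left hvS]⟩

/-- The image of a tree of bags. -/
def map {W : Type v} (D : BagTree V) (f : V ↪ W) : BagTree W where
  node := D.node
  tree := D.tree
  isTree := D.isTree
  bag x := (D.bag x).map f
  card_le x := by
    rw [Finset.card_map]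
    exact D.card_le x
  path := by
    rintro v ⟨x, hx⟩
    obtain ⟨w, hw, rfl⟩ := Finset.mem_map.1 hx
    obtain ⟨a, b, p, hp, h⟩ := D.path w ⟨x, hw⟩
    exact ⟨a, b, p, hp, fun z => by rw [h, Finset.mem_map' f]⟩

end BagTree

/-- A tree of bags all of whose vertices lie in `S`, which covers the vertices and edges of the
subgraph of `G` induced by `S`. -/
structure Decomposes {V : Type u} (D : BagTree V) (G : SimpleGraph V) (S : Set V) : Prop where
  subset : ∀ v, D.Has v → v ∈ S
  cover : ∀ v ∈ S, D.Has v
  cover_edge : ∀ u ∈ S, ∀ v ∈ S, G.Adj u v → ∃ x, u ∈ D.bag x ∧ v ∈ D.bag x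

section Decomposes

variable {V : Type u} {G : SimpleGraph V}

theorem Decomposes.join {D₁ D₂ : BagTree V} {x₁ : D₁.node} {x₂ : D₂.node} {A B : Set V}
    (h₁ : Decomposes D₁ G A) (h₂ : Decomposes D₂ G B)
    (hAB : ∀ a ∈ A, ∀ b ∈ B, G.Adj a b → a ∈ B ∨ b ∈ A)
    (h : ∀ v, D₁.Has v → D₂.Has v → (∃ x, D₁.PathOf v x x₁) ∧ ∃ y, D₂.PathOf v x₂ y) :
    Decomposes (D₁.join D₂ x₁ x₂ h) G (A ∪ B) where
  subset := by
    rintro v ⟨x | x, hx⟩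
    · exact Or.inl (h₁.subset v ⟨x, hx⟩)
    · exact Or.inr (h₂.subset v ⟨x, hx⟩)
  cover := by
    rintro v (hv | hv)
    · obtain ⟨x, hx⟩ := h₁.cover v hv
      exact ⟨Sum.inl x, hx⟩
    · obtain ⟨x, hx⟩ := h₂.cover v hv
      exact ⟨Sum.inr x, hx⟩
  cover_edge := by
    have hA : ∀ u ∈ A, ∀ v ∈ A, G.Adj u v → ∃ x, u ∈ (D₁.join D₂ x₁ x₂ h).bag x ∧
        v ∈ (D₁.join D₂ x₁ x₂ h).bag x := fun u hu v hv huv => by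
      obtain ⟨x, hx⟩ := h₁.cover_edge u hu v hv huv
      exact ⟨Sum.inl x, hx⟩
    have hB : ∀ u ∈ B, ∀ v ∈ B, G.Adj u v → ∃ x, u ∈ (D₁.join D₂ x₁ x₂ h).bag x ∧
        v ∈ (D₁.join D₂ x₁ x₂ h).bag x := fun u hu v hv huv => by
      obtain ⟨x, hx⟩ := h₂.cover_edge u hu v hv huv
      exact ⟨Sum.inr x, hx⟩
    rintro u (hu | hu) v (hv | hv) huv
    · exact hA u hu v hv huv
    · rcases hAB u hu v hv huv with h' | h'
      · exact hB u h' v hv huv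
      · exact hA u hu v h' huv
    · rcases hAB v hv u hu huv.symm with h' | h'
      · exact hB u hu v h' huv
      · exact hA u h' v hv huv
    · exact hB u hu v hv huv

theorem Decomposes.restrict {D : BagTree V} {S T : Set V} (h : Decomposes D G T) (hST : S ⊆ T) :
    Decomposes (D.restrict S) G S where
  subset := by
    classical
    rintro v ⟨x, hx⟩
    exact (Finset.mem_filter.1 hx).2
  cover v hv := by
    classical
    obtain ⟨x, hx⟩ := h.cover v (hST hv)
    exact ⟨x, Finset.mem_filter.2 ⟨hx, hv⟩⟩
  cover_edge u hu v hv huv := by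
    classical
    obtain ⟨x, hx, hx'⟩ := h.cover_edge u (hST hu) v (hST hv) huv
    exact ⟨x, Finset.mem_filter.2 ⟨hx, hu⟩, Finset.mem_filter.2 ⟨hx', hv⟩⟩

theorem Decomposes.map {W : Type v} {H : SimpleGraph W} {D : BagTree V} {S : Set V}
    (h : Decomposes D G S) (f : V ↪ W)
    (hf : ∀ u ∈ S, ∀ v ∈ S, H.Adj (f u) (f v) → G.Adj u v) : Decomposes (D.map f) H (f '' S) where
  subset := by
    rintro v ⟨x, hx⟩
    obtain ⟨w, hw, rfl⟩ := Finset.mem_map.1 hx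
    exact ⟨w, h.subset w ⟨x, hw⟩, rfl⟩
  cover := by
    rintro _ ⟨v, hv, rfl⟩
    obtain ⟨x, hx⟩ := h.cover v hv
    exact ⟨x, Finset.mem_map_of_mem f hx⟩
  cover_edge := by
    rintro _ ⟨u, hu, rfl⟩ _ ⟨v, hv, rfl⟩ huv
    obtain ⟨x, hx, hx'⟩ := h.cover_edge u hu v hv (hf u hu v hv huv)
    exact ⟨x, Finset.mem_map_of_mem f hx, Finset.mem_map_of_mem f hx'⟩

theorem decomposes_single {s : Finset V} (hs : s.card ≤ 3) :
    Decomposes (BagTree.single s hs) G s where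
  subset := fun _ ⟨_, hx⟩ => hx
  cover := fun _ hv => ⟨(), hv⟩
  cover_edge := fun _ hu _ hv _ => ⟨(), hu, hv⟩

/-- An edge is added between ends of the two paths of the shared vertex, so that they concatenate to
a path. If nothing is shared, any two nodes may be joined. -/
theorem exists_decomposes_union {A B : Set V} (hA : ∃ D, Decomposes D G A)
    (hB : ∃ D, Decomposes D G B) (hsub : (A ∩ B).Subsingleton)
    (hAB : ∀ a ∈ A, ∀ b ∈ B, G.Adj a b → a ∈ B ∨ b ∈ A) : ∃ D, Decomposes D G (A ∪ B) := by
  obtain ⟨D₁, h₁⟩ := hA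
  obtain ⟨D₂, h₂⟩ := hB
  by_cases hne : (A ∩ B).Nonempty
  · obtain ⟨v, hvA, hvB⟩ := hne
    obtain ⟨x, x', hx⟩ := D₁.path v (h₁.cover v hvA)
    obtain ⟨y, y', hy⟩ := D₂.path v (h₂.cover v hvB)
    refine ⟨_, h₁.join h₂ hAB (x₁ := x') (x₂ := y) fun w hw hw' => ?_⟩
    rw [hsub ⟨h₁.subset w hw, h₂.subset w hw'⟩ ⟨hvA, hvB⟩]
    exact ⟨⟨x, hx⟩, y', hy⟩
  · obtain ⟨x⟩ := D₁.isTree.connected.nonempty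
    obtain ⟨y⟩ := D₂.isTree.connected.nonempty
    exact ⟨_, h₁.join h₂ hAB (x₁ := x) (x₂ := y) fun w hw hw' =>
      absurd ⟨w, h₁.subset w hw, h₂.subset w hw'⟩ hne⟩

theorem Conn.image {V' : Type v} {G' : SimpleGraph V'} (f : G →g G') {U : Set V} (h : Conn G U) :
    Conn G' (f '' U) := by
  refine conn_of_closed (h.nonempty.image _) fun X hX hne hc => ?_
  have : U ∩ f ⁻¹' X = U := by
    refine h.eq_of_closed Set.inter_subset_left ?_ ?_
    · obtain ⟨x, hx⟩ := hne
      obtain ⟨y, hy, rfl⟩ := hX hx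
      exact ⟨y, hy, hx⟩
    · rintro a ⟨-, haX⟩ b hb hab
      exact ⟨hb, hc _ haX _ ⟨b, hb, rfl⟩ (f.map_adj hab)⟩
  refine Set.Subset.antisymm hX ?_
  rintro _ ⟨y, hy, rfl⟩
  exact (this.symm ▸ hy : y ∈ U ∩ f ⁻¹' X).2

theorem Conn.of_image {V' : Type v} {G' : SimpleGraph V'} (f : G ↪g G') {U : Set V}
    (h : Conn G' (f '' U)) : Conn G U := by
  refine conn_of_closed (Set.image_nonempty.1 h.nonempty) fun X hX hne hc => ?_
  have : f '' X = f '' U := by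
    refine h.eq_of_closed (Set.image_mono hX) (hne.image _) ?_
    rintro _ ⟨a, ha, rfl⟩ _ ⟨b, hb, rfl⟩ hab
    exact ⟨b, hc a ha b hb (f.map_adj_iff.1 hab), rfl⟩
  exact f.injective.image_injective this

theorem conn_induce_iff {S : Set V} {U : Set S} :
    Conn (G.induce S) U ↔ Conn G (Subtype.val '' U) :=
  ⟨fun h => h.image (Embedding.induce S).toHom, fun h => Conn.of_image (Embedding.induce S) h⟩

/-- If all 2-connected induced subgraphs have spaghetti decompositions of width at most two, then
so do all induced subgraphs. -/
theorem exists_decomposes_of_twoConnected [Finite V]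
    (h : ∀ S : Set V, IsTwoConnected (G.induce S) → ∃ D, Decomposes D G S) (S : Set V) :
    ∃ D, Decomposes D G S := by
  classical
  induction hn : S.ncard using Nat.strong_induction_on generalizing S with
  | _ n ih =>
  have hfin : S.Finite := S.toFinite
  by_cases h3 : n ≤ 3
  · have hc : hfin.toFinset.card ≤ 3 := by
      rw [← Set.ncard_eq_toFinset_card S hfin]
      omega
    have := decomposes_single (G := G) hc
    rw [hfin.coe_toFinset] at this
    exact ⟨_, this⟩
  by_cases h2 : IsTwoConnected (G.induce S)
  · exact h S h2
  have hcard : 3 ≤ Nat.card S := by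
    rw [Nat.card_coe_set_eq]
    omega
  -- With at least three vertices, failure of 2-connectedness means a disconnecting set of at most
  -- one vertex. One component together with this set, and the complement of that component in `S`,
  -- are the smaller pieces.
  obtain ⟨X, hX, hXc⟩ : ∃ X : Set S, X.encard ≤ 1 ∧ ¬ Conn (G.induce S) Xᶜ := by
    by_contra! hcon
    exact h2 ⟨hcard, hcon⟩
  rw [conn_induce_iff] at hXc
  set Y : Set V := Subtype.val '' X with hY
  have hYc : Subtype.val '' Xᶜ = S \ Y := by
    rw [Set.image_compl_eq_range_sdiff_image Subtype.val_injective, Subtype.range_coe]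
  rw [hYc] at hXc
  have hYS : Y ⊆ S := by
    rintro _ ⟨x, -, rfl⟩
    exact x.2
  have hYsub : Y.Subsingleton := by
    rw [Set.encard_le_one_iff_subsingleton] at hX
    exact hX.image _
  have hYn : Y.ncard ≤ 1 := Set.ncard_le_one_iff_subsingleton.2 hYsub
  obtain ⟨r, hr⟩ : (S \ Y).Nonempty := by
    rw [Set.sdiff_nonempty]
    intro h'
    have := Set.ncard_le_ncard h' (Set.toFinite _)
    omega
  have hE := conn_compIn (G := G) hr
  have hsub := compIn_subset (G := G) (S \ Y) r
  have hcl : ∀ y ∈ compIn G (S \ Y) r, ∀ z ∈ S \ Y, G.Adj y z → z ∈ compIn G (S \ Y) r :=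
    fun y hy z hz => compIn_closed hy hz
  have hrE := mem_compIn_self (G := G) hr
  generalize compIn G (S \ Y) r = E at hE hsub hcl hrE
  obtain ⟨z, hz, hzE⟩ : ∃ z ∈ S \ Y, z ∉ E := by
    by_contra! hcon
    exact hXc (Set.Subset.antisymm hsub hcon ▸ hE)
  have hA := ih (E ∪ Y).ncard (by
    rw [← hn]
    refine Set.ncard_lt_ncard ((Set.ssubset_iff_of_subset ?_).2 ⟨z, hz.1, ?_⟩) (Set.toFinite _)
    · exact Set.union_subset (hsub.trans Set.sdiff_subset) hYS
    · rintro (h | h)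
      · exact hzE h
      · exact hz.2 h) _ rfl
  have hB := ih (S \ E).ncard (by
    rw [← hn]
    refine Set.ncard_lt_ncard ((Set.ssubset_iff_of_subset Set.sdiff_subset).2
      ⟨r, hr.1, fun h => h.2 hrE⟩) (Set.toFinite _)) _ rfl
  have hun : (E ∪ Y) ∪ (S \ E) = S := by
    ext w
    constructor
    · rintro ((h | h) | h)
      · exact (hsub h).1
      · exact hYS h
      · exact h.1
    · intro h
      by_cases hwE : w ∈ E
      · exact Or.inl (Or.inl hwE)
      · exact Or.inr ⟨h, hwE⟩
  rw [← hun]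
  refine exists_decomposes_union hA hB ?_ ?_
  · refine hYsub.anti ?_
    rintro w ⟨h | h, h'⟩
    · exact absurd h h'.2
    · exact h
  · rintro a (ha | ha) b hb hab
    · right
      by_cases hbY : b ∈ Y
      · exact Or.inr hbY
      · exact Or.inl (hcl a ha b ⟨hb.1, hbY⟩ hab)
    · exact Or.inl ⟨hYS ha, fun h => (hsub h).2 ha⟩

end Decomposes

/-! ### The value of the spaghetti treewidth -/

section Value

variable {V : Type u} [Finite V] {G : SimpleGraph V}

/-- The infimum is attained: putting all vertices into one bag gives a decomposition, and all widths
are at least `-1`. -/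
theorem exists_isSpaghetti_width_eq (G : SimpleGraph V) :
    ∃ D : TreeDecomposition G, D.IsSpaghetti ∧ D.width = spaghettiTreewidth G := by
  classical
  have := Fintype.ofFinite V
  refine Int.csInf_mem (s := {w : ℤ | ∃ D : TreeDecomposition G, D.IsSpaghetti ∧ D.width = w})
    ?_ ⟨-1, ?_⟩
  · let D : TreeDecomposition G :=
      { node := Unit
        tree := ⊥
        isTree := IsTree.of_subsingleton
        bag := fun _ => Finset.univ
        cover_vertex := fun v => ⟨(), by simp⟩
        cover_edge := fun u v _ => ⟨(), by simp⟩
        connected := fun v => by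
          have : {x : Unit | v ∈ (Finset.univ : Finset V)} = {()} := by
            ext
            simp
          rw [this]
          exact conn_singleton _ }
    exact ⟨_, D, fun v => ⟨(), (), Walk.nil, Walk.IsPath.nil,
      fun _ => ⟨fun _ => Finset.mem_univ v, fun _ => List.mem_singleton.2 rfl⟩⟩, rfl⟩
  · rintro w ⟨D, -, rfl⟩
    unfold TreeDecomposition.width
    omega

theorem width_le_iff {V : Type u} {G : SimpleGraph V} (D : TreeDecomposition G) (k : ℕ) :
    D.width ≤ k ↔ ∀ x, (D.bag x).card ≤ k + 1 := by
  unfold TreeDecomposition.width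
  rw [sub_le_iff_le_add]
  norm_cast
  rw [Finset.sup_le_iff]
  simp

theorem spaghettiTreewidth_le_iff (k : ℕ) :
    spaghettiTreewidth G ≤ k ↔
      ∃ D : TreeDecomposition G, D.IsSpaghetti ∧ ∀ x, (D.bag x).card ≤ k + 1 := by
  constructor
  · intro h
    obtain ⟨D, hD, hw⟩ := exists_isSpaghetti_width_eq G
    exact ⟨D, hD, (width_le_iff D k).1 (hw ▸ h)⟩
  · rintro ⟨D, hD, hk⟩
    refine le_trans (csInf_le ⟨-1, ?_⟩ ⟨D, hD, rfl⟩) ((width_le_iff D k).2 hk)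
    rintro w ⟨D, -, rfl⟩
    unfold TreeDecomposition.width
    omega

theorem Decomposes.spaghettiTreewidth_le {D : BagTree V} (h : Decomposes D G Set.univ) :
    spaghettiTreewidth G ≤ 2 := by
  refine (spaghettiTreewidth_le_iff 2).2 ⟨{
    node := D.node
    tree := D.tree
    isTree := D.isTree
    bag := D.bag
    cover_vertex := fun v => h.cover v (Set.mem_univ v)
    cover_edge := fun u v huv => h.cover_edge u (Set.mem_univ u) v (Set.mem_univ v) huv
    connected := fun v => ?_ }, fun v => D.path v (h.cover v (Set.mem_univ v)), D.card_le⟩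
  obtain ⟨x, y, p, -, hp⟩ := D.path v (h.cover v (Set.mem_univ v))
  have : {x | v ∈ D.bag x} = {x | x ∈ p.support} := by
    ext z
    exact (hp z).symm
  rw [this]
  exact p.connected_induce_support

theorem not_isMinor_of_spaghettiTreewidth_le (h : spaghettiTreewidth G ≤ 2) :
    ¬ IsMinor K4 G ∧ ¬ IsMinor D3 G := by
  obtain ⟨D, hD, hk⟩ := (spaghettiTreewidth_le_iff 2).1 h
  exact ⟨D.not_isMinor_K4 hk, D.not_isMinor_D3 hk hD⟩

theorem IsTwoConnected.two_le_spaghettiTreewidth (hG : IsTwoConnected G) :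
    2 ≤ spaghettiTreewidth G := by
  by_contra! h
  obtain ⟨D, -, hk⟩ := (spaghettiTreewidth_le_iff (G := G) 1).1 (by norm_num; omega)
  obtain ⟨x, hx⟩ := D.exists_three_le_card hG
  have := hk x
  omega

end Value

end

end SpaghettiTw

namespace SpaghettiTw

open SimpleGraph

noncomputable section

/-! ### Spaghetti decompositions of 2-connected graphs -/

section Construct

variable {V : Type u} {G : SimpleGraph V}

/-- The set `D` avoids `a` and `b`, and its vertices have all their neighbours in `D ∪ {a, b}`. -/
def IsClosedAt (G : SimpleGraph V) (a b : V) (D : Set V) : Prop :=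
  a ∉ D ∧ b ∉ D ∧ ∀ x ∈ D, ∀ y, G.Adj x y → y ∈ D ∨ y = a ∨ y = b

/-- The set `D` is a connected component of `G - {a, b}`. -/
def IsComp (G : SimpleGraph V) (a b : V) (D : Set V) : Prop :=
  Conn G D ∧ IsClosedAt G a b D

theorem IsClosedAt.symm {a b : V} {D : Set V} (h : IsClosedAt G a b D) : IsClosedAt G b a D :=
  ⟨h.2.1, h.1, fun x hx y hxy => (h.2.2 x hx y hxy).imp_right Or.symm⟩

theorem IsClosedAt.compIn {a b x : V} {D : Set V} (h : IsClosedAt G a b D) (hx : x ∈ D) :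
    IsComp G a b (compIn G D x) := by
  refine ⟨conn_compIn hx, fun ha => h.1 (compIn_subset _ _ ha),
    fun hb => h.2.1 (compIn_subset _ _ hb), fun y hy z hyz => ?_⟩
  exact (h.2.2 y (compIn_subset _ _ hy) z hyz).imp_left fun hz => compIn_closed hy hz hyz

theorem isClosedAt_compl (G : SimpleGraph V) (a b : V) : IsClosedAt G a b {a, b}ᶜ := by
  refine ⟨fun h => h (Or.inl rfl), fun h => h (Or.inr rfl), fun x _ y _ => ?_⟩
  by_cases h : y = a ∨ y = b
  · exact Or.inr h
  · exact Or.inl h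

theorem IsClosedAt.compl {a b : V} {D : Set V} (h : IsClosedAt G a b D) :
    IsClosedAt G a b (D ∪ {a, b})ᶜ := by
  refine ⟨fun h' => h' (Or.inr (Or.inl rfl)), fun h' => h' (Or.inr (Or.inr rfl)),
    fun x hx y hxy => ?_⟩
  by_cases hy : y = a ∨ y = b
  · exact Or.inr hy
  · refine Or.inl ?_
    rintro (hyD | hy')
    · exact hx ((h.2.2 y hyD x hxy.symm).imp_right id)
    · exact hy hy'

theorem IsTwoConnected.exists_adj_of_isComp (hG : IsTwoConnected G) {a b : V} {D : Set V}
    (hab : a ≠ b) (hD : IsClosedAt G a b D) (hne : D.Nonempty) : ∃ e ∈ D, G.Adj a e :=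
  hG.exists_adj hab hne hD.1 hD.2.1 hD.2.2

theorem isMinor_K4 {A B C D : Set V} (hA : Conn G A) (hB : Conn G B) (hC : Conn G C)
    (hD : Conn G D) (hAB : Disjoint A B) (hAC : Disjoint A C) (hAD : Disjoint A D)
    (hBC : Disjoint B C) (hBD : Disjoint B D) (hCD : Disjoint C D)
    (eAB : ∃ x ∈ A, ∃ y ∈ B, G.Adj x y) (eAC : ∃ x ∈ A, ∃ y ∈ C, G.Adj x y)
    (eAD : ∃ x ∈ A, ∃ y ∈ D, G.Adj x y) (eBC : ∃ x ∈ B, ∃ y ∈ C, G.Adj x y)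
    (eBD : ∃ x ∈ B, ∃ y ∈ D, G.Adj x y) (eCD : ∃ x ∈ C, ∃ y ∈ D, G.Adj x y) :
    IsMinor K4 G := by
  have flip : ∀ {S T : Set V}, (∃ x ∈ S, ∃ y ∈ T, G.Adj x y) → ∃ x ∈ T, ∃ y ∈ S, G.Adj x y :=
    fun ⟨x, hx, y, hy, h⟩ => ⟨y, hy, x, hx, h.symm⟩
  refine ⟨![A, B, C, D], fun i => by fin_cases i <;> assumption, fun i j hij => ?_,
    fun i j hij => ?_⟩
  · fin_cases i <;> fin_cases j <;> first
      | exact absurd rfl hij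
      | assumption
      | exact Disjoint.symm (by assumption)
  · fin_cases i <;> fin_cases j <;> first
      | exact absurd rfl hij.ne
      | assumption
      | exact flip (by assumption)

/-- Two disjoint connections between `a` and `b` inside one connected set, together with a
connection outside of this set, give a `K₄` minor. -/
theorem isMinor_K4_of_two_routes {a b : V} (hab : a ≠ b) {D S T : Set V} (hD : Conn G D)
    (haD : a ∉ D) (hbD : b ∉ D) (hS : S ⊆ D) (hT : T ⊆ D) (hSc : Conn G S) (hTc : Conn G T)
    (hST : Disjoint S T) (haS : ∃ x ∈ S, G.Adj a x) (hbS : ∃ x ∈ S, G.Adj b x)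
    (haT : ∃ x ∈ T, G.Adj a x) (hbT : ∃ x ∈ T, G.Adj b x)
    (hO : G.Adj a b ∨ ∃ O, Conn G O ∧ Disjoint O D ∧ a ∉ O ∧ b ∉ O ∧ (∃ x ∈ O, G.Adj a x) ∧
      ∃ x ∈ O, G.Adj b x) : IsMinor K4 G := by
  obtain ⟨t, ht⟩ := hTc.nonempty
  have htDS : t ∈ D \ S := ⟨hT ht, Set.disjoint_right.1 hST ht⟩
  -- `T` is enlarged to its component in `D \ S`, which is adjacent to `S` because `D` is connected.
  -- With `a`, and with `b` extended by the outside connection, these are the four branch sets.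
  have hTE : T ⊆ compIn G (D \ S) t := hTc.subset_compIn
    (fun x hx => ⟨hT hx, Set.disjoint_right.1 hST hx⟩) ht
  have hEc := conn_compIn (G := G) htDS
  have hEsub := compIn_subset (G := G) (D \ S) t
  obtain ⟨s, hs⟩ := hSc.nonempty
  obtain ⟨x, hx, y, hy, hyE, hxy⟩ := hD.exists_adj (hEsub.trans Set.sdiff_subset) hEc.nonempty
    (fun h => (hEsub (h.symm ▸ hS hs)).2 hs)
  have hyS : y ∈ S := by
    by_contra hyS
    exact hyE (compIn_closed hx ⟨hy, hyS⟩ hxy)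
  have hES : Disjoint S (compIn G (D \ S) t) :=
    Set.disjoint_left.2 fun z hz hz' => (hEsub hz').2 hz
  have main : ∀ B : Set V, Conn G B → Disjoint B D → a ∉ B → b ∈ B → (∃ x ∈ B, G.Adj a x) →
      IsMinor K4 G := by
    rintro B hB hBD haB hbB ⟨z, hz, haz⟩
    obtain ⟨s₁, hs₁, has₁⟩ := haS
    obtain ⟨s₂, hs₂, hbs₂⟩ := hbS
    obtain ⟨t₁, ht₁, hat₁⟩ := haT
    obtain ⟨t₂, ht₂, hbt₂⟩ := hbT
    refine isMinor_K4 (conn_singleton a) hB hSc hEc (by simpa using haB)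
      (by simpa using fun h => haD (hS h)) (by simpa using fun h => haD (hEsub h).1)
      (hBD.mono_right hS) (hBD.mono_right (hEsub.trans Set.sdiff_subset)) hES
      ⟨a, rfl, z, hz, haz⟩ ⟨a, rfl, s₁, hs₁, has₁⟩ ⟨a, rfl, t₁, hTE ht₁, hat₁⟩
      ⟨b, hbB, s₂, hs₂, hbs₂⟩ ⟨b, hbB, t₂, hTE ht₂, hbt₂⟩ ⟨y, hyS, x, hx, hxy.symm⟩
  rcases hO with h | ⟨O, hO, hOD, haO, hbO, ⟨o₁, ho₁, hao₁⟩, o₂, ho₂, hbo₂⟩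
  · exact main {b} (conn_singleton b) (by simpa using hbD) (by simpa using hab) rfl ⟨b, rfl, h⟩
  · refine main (O ∪ {b}) (hO.union_of_adj (conn_singleton b) ho₂ rfl hbo₂.symm) ?_ ?_
      (Or.inr rfl) ⟨o₁, Or.inl ho₁, hao₁⟩
    · exact Set.disjoint_union_left.2 ⟨hOD, by simpa using hbD⟩
    · rintro (h | h)
      · exact haO h
      · exact hab h

/-- Among any three components left by the deletion of two vertices, one has a single vertex. -/
def NoThreeLarge (G : SimpleGraph V) : Prop :=
  ∀ a b, a ≠ b → ∀ X Y Z : Set V, IsComp G a b X → IsComp G a b Y → IsComp G a b Z →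
    Disjoint X Y → Disjoint X Z → Disjoint Y Z →
    X.Subsingleton ∨ Y.Subsingleton ∨ Z.Subsingleton

/-- Among any two components left by the deletion of two vertices, one has a single vertex. -/
def NoTwoLarge (G : SimpleGraph V) : Prop :=
  ∀ a b, a ≠ b → ∀ X Y : Set V, IsComp G a b X → IsComp G a b Y → Disjoint X Y →
    X.Subsingleton ∨ Y.Subsingleton

/-- Everything outside `A ∪ {a, c}` hangs on `b`: a piece that does not reach `b` would be cut off
by `c` alone if it meets `B`, and by `a` alone if it lies outside `D`. This supplies the outer
component when recursing from `D` to `A`. -/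
theorem IsTwoConnected.isComp_compl (hG : IsTwoConnected G) {a b c : V} (hab : a ≠ b)
    {D A B : Set V} (hD : IsClosedAt G a b D) (hA : IsClosedAt G a c A) (hB : IsClosedAt G b c B)
    (hc : c ∈ D) (hAD : A ⊆ D) (hBD : B ⊆ D) (hDAB : ∀ x ∈ D, x = c ∨ x ∈ A ∨ x ∈ B) :
    IsComp G a c (A ∪ {a, c})ᶜ := by
  refine ⟨?_, hA.compl⟩
  have hcb : c ≠ b := fun h => hD.2.1 (h ▸ hc)
  have hbO : b ∈ (A ∪ {a, c})ᶜ := by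
    rintro (h | h | h)
    · exact hD.2.1 (hAD h)
    · exact hab h.symm
    · exact hcb (show b = c from h).symm
  suffices h : compIn G (A ∪ {a, c})ᶜ b = (A ∪ {a, c})ᶜ by
    rw [← h]
    exact conn_compIn hbO
  have hself := mem_compIn_self (G := G) hbO
  refine Set.Subset.antisymm (compIn_subset _ _) fun w hw => ?_
  by_contra hwR
  by_cases hwD : w ∈ D
  · have hwB : w ∈ B := by
      rcases hDAB w hwD with h | h | h
      · exact absurd (Or.inr (Or.inr h)) hw
      · exact absurd (Or.inl h) hw
      · exact h
    have : (B ∩ (A ∪ {a, c})ᶜ) \ compIn G (A ∪ {a, c})ᶜ b = {c}ᶜ := by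
      refine (hG.conn_compl c).eq_of_closed ?_ ⟨w, ⟨hwB, hw⟩, hwR⟩ ?_
      · rintro x ⟨⟨hx, -⟩, -⟩ rfl
        exact hB.2.1 hx
      · rintro x ⟨⟨hxB, hx⟩, hxR⟩ y hy hxy
        rcases hB.2.2 x hxB y hxy with h | h | h
        · have hyO : y ∈ (A ∪ {a, c})ᶜ := by
            rintro (h' | h' | h')
            · rcases hA.2.2 y h' x hxy.symm with h' | h' | h'
              · exact hx (Or.inl h')
              · exact hx (Or.inr (Or.inl h'))
              · exact hx (Or.inr (Or.inr h'))
            · exact hD.1 ((show y = a from h') ▸ hBD h)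
            · exact hy h'
          exact ⟨⟨h, hyO⟩, fun hyR => hxR (compIn_closed hyR hx hxy.symm)⟩
        · subst h
          exact absurd (compIn_closed hself hx hxy.symm) hxR
        · exact absurd h hy
    exact hB.1 (this.symm ▸ hcb.symm : b ∈ (B ∩ (A ∪ {a, c})ᶜ) \ compIn G (A ∪ {a, c})ᶜ b).1.1
  · have : (D ∪ {a, b})ᶜ \ compIn G (A ∪ {a, c})ᶜ b = {a}ᶜ := by
      refine (hG.conn_compl a).eq_of_closed ?_ ⟨w, ?_, hwR⟩ ?_
      · rintro x ⟨hx, -⟩ rfl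
        exact hx (Or.inr (Or.inl rfl))
      · rintro (h | h | h)
        · exact hwD h
        · exact hw (Or.inr (Or.inl h))
        · exact hwR ((show w = b from h) ▸ hself)
      · rintro x ⟨hx, hxR⟩ y hy hxy
        have hxO : x ∈ (A ∪ {a, c})ᶜ := by
          rintro (h | h | h)
          · exact hx (Or.inl (hAD h))
          · exact hx (Or.inr (Or.inl h))
          · exact hx (Or.inl ((show x = c from h) ▸ hc))
        refine ⟨?_, fun hyR => hxR (compIn_closed hyR hxO hxy.symm)⟩
        rcases hD.compl.2.2 x hx y hxy with h | h | h
        · exact h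
        · exact absurd h hy
        · subst h
          exact absurd (compIn_closed hself hxO hxy.symm) hxR
    exact (this.symm ▸ hab.symm : b ∈ (D ∪ {a, b})ᶜ \ compIn G (A ∪ {a, c})ᶜ b).1
      (Or.inr (Or.inr rfl))

/-- A component of `G - {a, b}` has a vertex that separates `a` from `b` in it. -/
theorem IsTwoConnected.exists_separator [Finite V] (hG : IsTwoConnected G)
    (hK : ¬ IsMinor K4 G) {a b : V} (hab : a ≠ b) {D : Set V} (hD : IsComp G a b D)
    (hO : G.Adj a b ∨ ∃ O, IsComp G a b O ∧ Disjoint O D) :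
    ∃ c ∈ D, ∃ A B, IsClosedAt G a c A ∧ IsClosedAt G b c B ∧ A ⊆ D ∧ B ⊆ D ∧ Disjoint A B ∧
      ∀ x ∈ D, x = c ∨ x ∈ A ∨ x ∈ B := by
  -- If no vertex meets all connections from neighbours of `a` to neighbours of `b` in `D`, then
  -- Menger gives two disjoint ones, and with the outside route a `K4` minor.
  obtain ⟨c, hc⟩ : ∃ c, ∀ S, Connects G D {x | G.Adj a x} {x | G.Adj b x} S → c ∈ S := by
    by_contra! hcon
    obtain ⟨S, T, ⟨hSD, hSc, ⟨s₁, hs₁, hs₁'⟩, s₂, hs₂, hs₂'⟩,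
      ⟨hTD, hTc, ⟨t₁, ht₁, ht₁'⟩, t₂, ht₂, ht₂'⟩, hST⟩ :=
      exists_disjoint_connects (let ⟨S, hS, _⟩ := hcon a; ⟨S, hS⟩) hcon
    refine hK (isMinor_K4_of_two_routes hab hD.1 hD.2.1 hD.2.2.1 hSD hTD hSc hTc hST
      ⟨s₁, hs₁, hs₁'⟩ ⟨s₂, hs₂, hs₂'⟩ ⟨t₁, ht₁, ht₁'⟩ ⟨t₂, ht₂, ht₂'⟩ ?_)
    refine hO.imp_right ?_
    rintro ⟨O, hO, hOD⟩
    exact ⟨O, hO.1, hOD, hO.2.1, hO.2.2.1, hG.exists_adj_of_isComp hab hO.2 hO.1.nonempty,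
      hG.exists_adj_of_isComp hab.symm hO.2.symm hO.1.nonempty⟩
  have hcD : c ∈ D := by
    refine hc D ⟨subset_rfl, hD.1, ?_, ?_⟩
    · exact hG.exists_adj_of_isComp hab hD.2 hD.1.nonempty
    · exact hG.exists_adj_of_isComp hab.symm hD.2.symm hD.1.nonempty
  have hstep : ∀ x ∈ D \ {c}, ∀ y ∈ D \ {c}, G.Adj x y →
      compIn G (D \ {c}) y ⊆ compIn G (D \ {c}) x := by
    intro x hx y hy hxy
    refine Set.Subset.trans Set.subset_union_left (Conn.subset_compIn
      ((conn_compIn hy).union_of_adj (conn_singleton x) (mem_compIn_self hy) rfl hxy.symm) ?_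
      (Or.inr rfl))
    exact Set.union_subset (compIn_subset _ _) (Set.singleton_subset_iff.2 hx)
  -- `B` collects the components of `D - c` adjacent to `b`. None of them is adjacent to `a`, since
  -- that would be a connection avoiding `c`.
  set B : Set V := {x | x ∈ D \ {c} ∧ ∃ e ∈ compIn G (D \ {c}) x, G.Adj b e} with hB
  refine ⟨c, hcD, (D \ {c}) \ B, B, ⟨fun h => hD.2.1 h.1.1, fun h => h.1.2 rfl, ?_⟩,
    ⟨fun h => hD.2.2.1 h.1.1, fun h => h.1.2 rfl, ?_⟩, fun x hx => hx.1.1, fun x hx => hx.1.1,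
    Set.disjoint_sdiff_left, fun x hx => ?_⟩
  · rintro x ⟨hx, hxB⟩ y hxy
    rcases hD.2.2.2 x hx.1 y hxy with h | h | h
    · by_cases hyc : y = c
      · exact Or.inr (Or.inr hyc)
      refine Or.inl ⟨⟨h, hyc⟩, ?_⟩
      rintro ⟨hy, e, he, hbe⟩
      exact hxB ⟨hx, e, hstep x hx y hy hxy he, hbe⟩
    · exact Or.inr (Or.inl h)
    · exact absurd ⟨hx, x, mem_compIn_self hx, h ▸ hxy.symm⟩ hxB
  · rintro x ⟨hx, e, he, hbe⟩ y hxy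
    rcases hD.2.2.2 x hx.1 y hxy with h | h | h
    · by_cases hyc : y = c
      · exact Or.inr (Or.inr hyc)
      exact Or.inl ⟨⟨h, hyc⟩, e, hstep y ⟨h, hyc⟩ x hx hxy.symm he, hbe⟩
    · refine absurd (hc (compIn G (D \ {c}) x) ⟨(compIn_subset _ _).trans Set.sdiff_subset,
        conn_compIn hx, ⟨x, mem_compIn_self hx, ?_⟩, e, he, hbe⟩) fun h' =>
        (compIn_subset _ _ h').2 rfl
      exact h ▸ hxy.symm
    · exact Or.inr (Or.inl h)
  · by_cases hxc : x = c
    · exact Or.inl hxc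
    · by_cases hxB : x ∈ B
      · exact Or.inr (Or.inr hxB)
      · exact Or.inr (Or.inl ⟨⟨hx, hxc⟩, hxB⟩)

/-! ### Recursive construction of rooted decompositions -/

/-- The subgraph induced by `D ∪ {a, b}` has a decomposition with a node at which the paths of both
`a` and `b` end. -/
def Rooted (G : SimpleGraph V) (a b : V) (D : Set V) : Prop :=
  ∃ (T : BagTree V) (x y z : T.node), Decomposes T G (D ∪ {a, b}) ∧ T.PathOf a x y ∧
    T.PathOf b x z

theorem rooted_empty (a b : V) : Rooted G a b ∅ := by
  classical
  have hcard : ({a, b} : Finset V).card ≤ 3 := Finset.card_le_two.trans (by norm_num)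
  refine ⟨BagTree.single {a, b} hcard, (), (), (), ?_, BagTree.pathOf_single (by simp),
    BagTree.pathOf_single (by simp)⟩
  have := decomposes_single (G := G) hcard
  simpa using this

theorem exists_decomposes_triple (G : SimpleGraph V) (a b c : V) :
    ∃ (S : BagTree V) (s : S.node), Decomposes S G {a, b, c} ∧ S.PathOf a s s ∧ S.PathOf b s s ∧
      S.PathOf c s s := by
  classical
  have hcard : ({a, b, c} : Finset V).card ≤ 3 := Finset.card_le_three
  refine ⟨BagTree.single {a, b, c} hcard, (), ?_, BagTree.pathOf_single (by simp),
    BagTree.pathOf_single (by simp), BagTree.pathOf_single (by simp)⟩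
  have := decomposes_single (G := G) hcard
  simpa using this

/-- A node with bag `{a, b, c}` is attached to the root and becomes the new root; the paths of `a`
and `b` grow by one node at their common end. -/
theorem Rooted.add_vertex {a b c : V} {D : Set V} (h : Rooted G a b D) (hc : c ∉ D) (hca : a ≠ c)
    (hcb : b ≠ c) (hcnbr : ∀ y, G.Adj c y → y = a ∨ y = b) : Rooted G a b (D ∪ {c}) := by
  obtain ⟨T, x, y, z, hT, ha, hb⟩ := h
  obtain ⟨S, s, hS, hSa, hSb, -⟩ := exists_decomposes_triple G a b c
  have hj : ∀ v, T.Has v → S.Has v → (∃ w, T.PathOf v w x) ∧ ∃ w, S.PathOf v s w := by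
    intro v hv hv'
    rcases hS.subset v hv' with rfl | rfl | rfl
    · exact ⟨⟨_, ha.symm⟩, _, hSa⟩
    · exact ⟨⟨_, hb.symm⟩, _, hSb⟩
    · rcases hT.subset _ hv with h | h | h
      · exact absurd h hc
      · exact absurd h.symm hca
      · exact absurd h.symm hcb
  have hJ := hT.join hS (by
    rintro u hu v (rfl | rfl | hv) huv
    · exact Or.inr (Or.inr (Or.inl rfl))
    · exact Or.inr (Or.inr (Or.inr rfl))
    · obtain rfl : v = c := hv
      exact Or.inl ((hcnbr u huv.symm).imp_right Or.inl)) hj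
  refine ⟨T.join S x s hj, Sum.inr s, Sum.inl y, Sum.inl z, ?_,
    (ha.symm.join_both hSa).symm, (hb.symm.join_both hSb).symm⟩
  have hun : D ∪ {c} ∪ {a, b} = D ∪ {a, b} ∪ {a, b, c} := by
    ext w
    simp only [Set.mem_union, Set.mem_insert_iff, Set.mem_singleton_iff]
    tauto
  rw [hun]
  exact hJ

/-- First half of `Rooted.triangle`: the bag `{a, b, c}` is attached to the root for `A`. At the new
node the paths of `a` and `c` end, and `b` occurs only there. -/
theorem Rooted.exists_triangle {a b c : V} {A : Set V} (hA' : Rooted G a c A)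
    (hA : IsClosedAt G a c A) (hab : a ≠ b) (hbc : b ≠ c) (hbA : b ∉ A) :
    ∃ (J : BagTree V) (s y z : J.node), Decomposes J G (A ∪ {a, c} ∪ {a, b, c}) ∧
      J.PathOf a s y ∧ J.PathOf c s z ∧ J.PathOf b s s := by
  obtain ⟨T, x, y, z, hT, ha, hc⟩ := hA'
  obtain ⟨S, s, hS, hSa, hSb, hSc⟩ := exists_decomposes_triple G a b c
  have hbT : ¬ T.Has b := by
    intro h
    rcases hT.subset b h with h | h | h
    · exact hbA h
    · exact hab h.symm
    · exact hbc h
  have hj : ∀ v, T.Has v → S.Has v → (∃ w, T.PathOf v w x) ∧ ∃ w, S.PathOf v s w := by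
    intro v hv hv'
    rcases hS.subset v hv' with rfl | rfl | rfl
    · exact ⟨⟨_, ha.symm⟩, _, hSa⟩
    · exact absurd hv hbT
    · exact ⟨⟨_, hc.symm⟩, _, hSc⟩
  have hJ := hT.join hS (by
    rintro u hu v (rfl | rfl | hv) huv
    · exact Or.inr (Or.inr (Or.inl rfl))
    · rcases hu with hu | hu | hu
      · rcases hA.2.2 u hu _ huv with h | h | h
        · exact absurd h hbA
        · exact absurd h.symm hab
        · exact absurd h hbc
      · exact Or.inl (Or.inl hu)
      · exact Or.inl (Or.inr (Or.inr hu))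
    · exact Or.inr (Or.inr (Or.inr hv))) hj
  exact ⟨T.join S x s hj, Sum.inr s, Sum.inl y, Sum.inl z, hJ, (ha.symm.join_both hSa).symm,
    (hc.symm.join_both hSc).symm, hSb.join_right hbT⟩

/-- From the bag `{a, b, c}`, the path of `a` runs only into the decomposition of `A`, that of `b`
only into that of `B`, and that of `c` passes through. So the paths of `a` and `b` both end at this
bag, which serves as root for the next step. -/
theorem Rooted.triangle {a b c : V} {A B : Set V} (hA' : Rooted G a c A) (hB' : Rooted G b c B)
    (hA : IsClosedAt G a c A) (hB : IsClosedAt G b c B) (hab : a ≠ b) (hac : a ≠ c) (hbc : b ≠ c)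
    (haB : a ∉ B) (hbA : b ∉ A) (hAB : Disjoint A B) : Rooted G a b (A ∪ B ∪ {c}) := by
  obtain ⟨J, s, y, z, hJ, hJa, hJc, hJb⟩ := hA'.exists_triangle hA hab hbc hbA
  obtain ⟨T, x, y', z', hT, hb, hc⟩ := hB'
  have haT : ¬ T.Has a := by
    intro h
    rcases hT.subset a h with h | h | h
    · exact haB h
    · exact hab h
    · exact hac h
  have hj : ∀ v, J.Has v → T.Has v → (∃ w, J.PathOf v w s) ∧ ∃ w, T.PathOf v x w := by
    intro v hv hv'
    rcases hT.subset v hv' with h | rfl | h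
    · rcases hJ.subset v hv with (h' | rfl | rfl) | rfl | rfl | rfl
      · exact absurd h (Set.disjoint_left.1 hAB h')
      · exact absurd h haB
      · exact absurd h hB.2.1
      · exact absurd h haB
      · exact absurd h hB.1
      · exact absurd h hB.2.1
    · exact ⟨⟨_, hJb⟩, _, hb⟩
    · obtain rfl : v = c := h
      exact ⟨⟨_, hJc.symm⟩, _, hc⟩
  have hbc' : ({b, c} : Set V) ⊆ A ∪ {a, c} ∪ {a, b, c} := by
    rintro w (rfl | hw)
    · exact Or.inr (Or.inr (Or.inl rfl))
    · exact Or.inr (Or.inr (Or.inr hw))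
  have hU := hJ.join hT (by
    rintro u hu v hv huv
    rcases hv with hv | hv
    · left
      rcases hB.2.2 v hv u huv.symm with h | h
      · exact Or.inl h
      · exact Or.inr h
    · exact Or.inr (hbc' hv)) hj
  refine ⟨J.join T s x hj, Sum.inl s, Sum.inl y, Sum.inr y', ?_, hJa.join_left haT,
    hJb.join_both hb⟩
  have hun : A ∪ B ∪ {c} ∪ {a, b} = A ∪ {a, c} ∪ {a, b, c} ∪ (B ∪ {b, c}) := by
    ext w
    simp only [Set.mem_union, Set.mem_insert_iff, Set.mem_singleton_iff]
    tauto
  rw [hun]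
  exact hU

/-- Induction on the size of `D`. Hypothesis `h₁` ensures that of any two components inside `D` one
is a single vertex, as a third large one lies outside or no two large ones exist at all. Hypothesis
`h₂` provides the route outside `D` that the `K4` argument of `IsTwoConnected.exists_separator`
needs. -/
theorem IsTwoConnected.rooted [Finite V] (hG : IsTwoConnected G) (hK : ¬ IsMinor K4 G)
    (h3 : NoThreeLarge G) {a b : V} (hab : a ≠ b) {D : Set V} (hD : IsClosedAt G a b D)
    (h₁ : (∃ O, IsComp G a b O ∧ ¬ O.Subsingleton ∧ Disjoint O D) ∨ NoTwoLarge G)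
    (h₂ : G.Adj a b ∨ ∃ O, IsComp G a b O ∧ Disjoint O D) : Rooted G a b D := by
  induction hn : D.ncard using Nat.strong_induction_on generalizing D a b with
  | _ n ih =>
  rcases D.eq_empty_or_nonempty with rfl | ⟨d, hd⟩
  · exact rooted_empty a b
  by_cases hED : compIn G D d = D
  · have hDc : IsComp G a b D := ⟨hED ▸ conn_compIn hd, hD⟩
    obtain ⟨c, hcD, A, B, hA, hB, hAD, hBD, hABd, hABc⟩ := hG.exists_separator hK hab hDc h₂
    have hac : a ≠ c := fun h => hD.1 (h ▸ hcD)
    have hbc : b ≠ c := fun h => hD.2.1 (h ▸ hcD)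
    have hOA := hG.isComp_compl hab hD hA hB hcD hAD hBD hABc
    have hOB := hG.isComp_compl hab.symm hD.symm hB hA hcD hBD hAD
      fun x hx => (hABc x hx).imp_right Or.symm
    have lt : ∀ A : Set V, A ⊆ D → c ∉ A → A.ncard < n := fun A hA hc => by
      rw [← hn]
      exact Set.ncard_lt_ncard ((Set.ssubset_iff_of_subset hA).2 ⟨c, hcD, hc⟩) (Set.toFinite _)
    have disj : ∀ A S : Set V, Disjoint (A ∪ S)ᶜ A := fun A S =>
      Set.disjoint_left.2 fun x hx hx' => hx (Or.inl hx')
    -- The outer component of the smaller problem is again large: it contains both the other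
    -- attachment vertex and a vertex of the old outer component.
    have big : ∀ A : Set V, A ⊆ D → ∀ a b : V, a ≠ b → b ≠ c → b ∉ D → ∀ o, o ∉ D → o ≠ a →
        o ≠ b → ¬ ((A ∪ {a, c})ᶜ).Subsingleton := by
      intro A hA a b hab hbc hbD o ho hoa hob hss
      refine hob (hss ?_ ?_)
      · rintro (h | h | h)
        · exact ho (hA h)
        · exact hoa h
        · exact ho ((show o = c from h) ▸ hcD)
      · rintro (h | h | h)
        · exact hbD (hA h)
        · exact hab h.symm
        · exact hbc h
    have hRA := ih _ (lt A hAD hA.2.1) hac hA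
      (h₁.imp_left fun ⟨O, hO, _, hOD⟩ => by
        obtain ⟨o, ho⟩ := hO.1.nonempty
        exact ⟨_, hOA, big A hAD a b hab hbc hD.2.1 o (Set.disjoint_left.1 hOD ho)
          (fun h => hO.2.1 (h ▸ ho)) (fun h => hO.2.2.1 (h ▸ ho)), disj _ _⟩)
      (Or.inr ⟨_, hOA, disj _ _⟩) rfl
    have hRB := ih _ (lt B hBD hB.2.1) hbc hB
      (h₁.imp_left fun ⟨O, hO, _, hOD⟩ => by
        obtain ⟨o, ho⟩ := hO.1.nonempty
        exact ⟨_, hOB, big B hBD b a hab.symm hac hD.1 o (Set.disjoint_left.1 hOD ho)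
          (fun h => hO.2.2.1 (h ▸ ho)) (fun h => hO.2.1 (h ▸ ho)), disj _ _⟩)
      (Or.inr ⟨_, hOB, disj _ _⟩) rfl
    have hDeq : D = A ∪ B ∪ {c} := by
      refine Set.Subset.antisymm (fun x hx => ?_) ?_
      · rcases hABc x hx with h | h | h
        · exact Or.inr h
        · exact Or.inl (Or.inl h)
        · exact Or.inl (Or.inr h)
      · exact Set.union_subset (Set.union_subset hAD hBD) (Set.singleton_subset_iff.2 hcD)
    rw [hDeq]
    exact hRA.triangle hRB hA hB hab hac hbc (fun h => hD.1 (hBD h)) (fun h => hD.2.1 (hAD h)) hABd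
  · obtain ⟨d', hd', hd'E⟩ : ∃ d' ∈ D, d' ∉ compIn G D d := by
      by_contra! hcon
      exact hED (Set.Subset.antisymm (compIn_subset _ _) hcon)
    have hE := hD.compIn hd
    have hE' := hD.compIn hd'
    have hEE' : Disjoint (compIn G D d) (compIn G D d') := by
      rw [Set.disjoint_left]
      intro x hx hx'
      exact hd'E (((conn_compIn hd).union_of_mem (conn_compIn hd') hx hx').subset_compIn
        (Set.union_subset (compIn_subset _ _) (compIn_subset _ _)) (Or.inl (mem_compIn_self hd))
        (Or.inr (mem_compIn_self hd')))
    -- When `D` is disconnected, a one-vertex component can be removed and added back at the root.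
    obtain ⟨c, hcD, hc⟩ : ∃ c ∈ D, IsComp G a b {c} := by
      have hor : (compIn G D d).Subsingleton ∨ (compIn G D d').Subsingleton := by
        rcases h₁ with ⟨O, hO, hO', hOD⟩ | h
        · rcases h3 a b hab O _ _ hO hE hE' (hOD.mono_right (compIn_subset _ _))
            (hOD.mono_right (compIn_subset _ _)) hEE' with h | h | h
          · exact absurd h hO'
          · exact Or.inl h
          · exact Or.inr h
        · exact h a b hab _ _ hE hE' hEE'
      rcases hor with h | h
      · refine ⟨d, hd, ?_⟩
        rwa [← h.eq_singleton_of_mem (mem_compIn_self hd)]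
      · refine ⟨d', hd', ?_⟩
        rwa [← h.eq_singleton_of_mem (mem_compIn_self hd')]
    have hca : a ≠ c := fun h => hD.1 (h ▸ hcD)
    have hcb : b ≠ c := fun h => hD.2.1 (h ▸ hcD)
    have hcnbr : ∀ y, G.Adj c y → y = a ∨ y = b := by
      intro y hy
      rcases hc.2.2.2 c rfl y hy with h | h
      · obtain rfl : y = c := h
        exact absurd hy (G.loopless.irrefl y)
      · exact h
    have hR := ih (D \ {c}).ncard (by
        rw [← hn]
        exact Set.ncard_sdiff_singleton_lt_of_mem hcD (Set.toFinite _)) hab (D := D \ {c})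
      ⟨fun h => hD.1 h.1, fun h => hD.2.1 h.1, fun x hx y hxy => by
        rcases hD.2.2 x hx.1 y hxy with h | h
        · refine Or.inl ⟨h, ?_⟩
          rintro rfl
          rcases hcnbr x hxy.symm with rfl | rfl
          · exact hD.1 hx.1
          · exact hD.2.1 hx.1
        · exact Or.inr h⟩
      (h₁.imp_left fun ⟨O, hO, hO', hOD⟩ => ⟨O, hO, hO', hOD.mono_right Set.sdiff_subset⟩)
      (h₂.imp_right fun ⟨O, hO, hOD⟩ => ⟨O, hO, hOD.mono_right Set.sdiff_subset⟩) rfl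
    have := hR.add_vertex (fun h => h.2 rfl) hca hcb hcnbr
    rwa [Set.sdiff_union_of_subset (Set.singleton_subset_iff.2 hcD)] at this

/-- If some pair leaves two large components, one of them and the rest of the graph each see a large
component outside, and their rooted decompositions are joined at the roots. Otherwise any edge
serves as the starting pair. -/
theorem IsTwoConnected.exists_decomposes [Finite V] (hG : IsTwoConnected G)
    (hK : ¬ IsMinor K4 G) (h3 : NoThreeLarge G) : ∃ D, Decomposes D G Set.univ := by
  by_cases h2 : NoTwoLarge G
  · obtain ⟨a, b, hab⟩ := hG.exists_edge
    obtain ⟨T, -, -, -, hT, -⟩ := hG.rooted hK h3 hab.ne (isClosedAt_compl G a b)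
      (Or.inr h2) (Or.inl hab)
    rw [Set.compl_union_self] at hT
    exact ⟨T, hT⟩
  · unfold NoTwoLarge at h2
    push Not at h2
    obtain ⟨a, b, hab, X, Y, hX, hY, hXY, hX', hY'⟩ := h2
    have hd : Disjoint X (X ∪ {a, b})ᶜ := Set.disjoint_left.2 fun x hx hx' => hx' (Or.inl hx)
    obtain ⟨T₁, x₁, y₁, z₁, hT₁, ha₁, hb₁⟩ := hG.rooted hK h3 hab hX.2
      (Or.inl ⟨Y, hY, Set.not_subsingleton_iff.2 hY', hXY.symm⟩) (Or.inr ⟨Y, hY, hXY.symm⟩)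
    obtain ⟨T₂, x₂, y₂, z₂, hT₂, ha₂, hb₂⟩ := hG.rooted hK h3 hab hX.2.compl
      (Or.inl ⟨X, hX, Set.not_subsingleton_iff.2 hX', hd⟩) (Or.inr ⟨X, hX, hd⟩)
    have hJ := hT₁.join hT₂ (x₁ := x₁) (x₂ := x₂) (by
      rintro u hu v hv huv
      rcases hu with hu | hu
      · exact Or.inr (hX.2.2.2 u hu v huv)
      · exact Or.inl (Or.inr hu)) (by
      intro v hv hv'
      have h1 := hT₁.subset v hv
      have h2 := hT₂.subset v hv'
      have : v = a ∨ v = b := by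
        rcases h2 with h2 | h2
        · exact absurd h1 h2
        · exact h2
      rcases this with rfl | rfl
      · exact ⟨⟨_, ha₁.symm⟩, _, ha₂⟩
      · exact ⟨⟨_, hb₁.symm⟩, _, hb₂⟩)
    have hun : X ∪ {a, b} ∪ ((X ∪ {a, b})ᶜ ∪ {a, b}) = Set.univ := by
      rw [Set.eq_univ_iff_forall]
      intro x
      by_cases h : x ∈ X ∪ {a, b}
      · exact Or.inl h
      · exact Or.inr (Or.inl h)
    exact ⟨_, hun ▸ hJ⟩

end Construct

end

end SpaghettiTw

namespace SpaghettiTw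

open SimpleGraph

noncomputable section

/-! ### Cycles -/

section Cycles

theorem cycleGraph_succ_adj {n : ℕ} (hn : 3 ≤ n) (k : ℕ) :
    (cycleGraph n).Adj ⟨k % n, Nat.mod_lt _ (by omega)⟩ ⟨(k + 1) % n, Nat.mod_lt _ (by omega)⟩ := by
  rw [cycleGraph_adj']
  right
  have h := Nat.mod_lt k (show n > 0 by omega)
  simp only [Fin.sub_def]
  rw [Nat.add_mod k 1 n, Nat.mod_eq_of_lt (show 1 < n by omega)]
  rcases Nat.lt_or_ge (k % n + 1) n with h1 | h1
  · rw [Nat.mod_eq_of_lt h1, Nat.mod_eq_sub_mod (by omega), Nat.mod_eq_of_lt (by omega)]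
    omega
  · have : k % n + 1 = n := by omega
    rw [this, Nat.mod_self, Nat.add_zero, Nat.mod_eq_of_lt (by omega)]
    omega

theorem cycleGraph_adj_iff {n : ℕ} (hn : 3 ≤ n) {i j : Fin n} :
    (cycleGraph n).Adj i j ↔ j.val = (i.val + 1) % n ∨ i.val = (j.val + 1) % n := by
  have hi := i.isLt
  have hj := j.isLt
  constructor
  · intro h
    rw [cycleGraph_adj'] at h
    have key : ∀ i j : Fin n, (i - j).val = 1 → i.val = (j.val + 1) % n := by
      intro i j h
      have hi := i.isLt
      have hj := j.isLt
      simp only [Fin.sub_def] at h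
      rcases Nat.lt_or_ge i.val j.val with h1 | h1
      · rw [Nat.mod_eq_of_lt (by omega)] at h
        have : j.val + 1 = n := by omega
        rw [this, Nat.mod_self]
        omega
      · rw [Nat.mod_eq_sub_mod (by omega), Nat.mod_eq_of_lt (by omega)] at h
        rw [Nat.mod_eq_of_lt (by omega)]
        omega
    rcases h with h | h
    · exact Or.inr (key _ _ h)
    · exact Or.inl (key _ _ h)
  · have key : ∀ i j : Fin n, j.val = (i.val + 1) % n → (cycleGraph n).Adj i j := by
      intro i j h
      have := cycleGraph_succ_adj hn i.val
      convert this using 1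
      · rw [Fin.ext_iff]
        exact (Nat.mod_eq_of_lt i.isLt).symm
      · rw [Fin.ext_iff]
        exact h
    rintro (h | h)
    · exact key _ _ h
    · exact (key _ _ h).symm

theorem conn_of_seq {V : Type u} {G : SimpleGraph V} (φ : ℕ → V)
    (h : ∀ k, G.Adj (φ k) (φ (k + 1))) (t : ℕ) : Conn G {z | ∃ s ≤ t, φ s = z} := by
  induction t with
  | zero =>
    have : {z | ∃ s ≤ 0, φ s = z} = {φ 0} := by
      ext z
      simp [eq_comm]
    rw [this]
    exact conn_singleton _
  | succ t ih =>
    have : {z | ∃ s ≤ t + 1, φ s = z} = {z | ∃ s ≤ t, φ s = z} ∪ {φ (t + 1)} := by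
      ext z
      constructor
      · rintro ⟨s, hs, rfl⟩
        rcases Nat.lt_or_ge t s with h | h
        · obtain rfl : s = t + 1 := by omega
          exact Or.inr rfl
        · exact Or.inl ⟨s, h, rfl⟩
      · rintro (⟨s, hs, rfl⟩ | rfl)
        · exact ⟨s, by omega, rfl⟩
        · exact ⟨t + 1, le_rfl, rfl⟩
    rw [this]
    exact ih.union_of_adj (conn_singleton _) ⟨t, le_rfl, rfl⟩ rfl (h t)

theorem conn_cycleGraph_compl {n : ℕ} (hn : 3 ≤ n) {i j : Fin n} (h : (cycleGraph n).Adj i j) :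
    Conn (cycleGraph n) {i, j}ᶜ := by
  have key : ∀ i j : Fin n, j.val = (i.val + 1) % n → Conn (cycleGraph n) {i, j}ᶜ := by
    intro i j h
    -- Going round from `j + 1`, the steps `0, …, n - 3` visit the `n - 2` vertices other than `i`
    -- and `j`.
    have := conn_of_seq (G := cycleGraph n)
      (fun s => ⟨(j.val + 1 + s) % n, Nat.mod_lt _ (by omega)⟩)
      (fun k => by
        have := cycleGraph_succ_adj hn (j.val + 1 + k)
        simpa only [Nat.add_assoc] using this) (n - 3)
    convert this using 1
    ext k
    have hi := i.isLt
    have hj := j.isLt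
    have hk := k.isLt
    simp only [Set.mem_compl_iff, Set.mem_insert_iff, Set.mem_singleton_iff, Fin.ext_iff,
      Set.mem_ofPred_eq]
    have hij : j.val = i.val + 1 ∨ (j.val = 0 ∧ i.val + 1 = n) := by
      rcases Nat.lt_or_ge (i.val + 1) n with h1 | h1
      · rw [Nat.mod_eq_of_lt h1] at h
        exact Or.inl h
      · have h2 : i.val + 1 = n := by omega
        rw [h2, Nat.mod_self] at h
        exact Or.inr ⟨h, h2⟩
    constructor
    · intro hne
      rcases Nat.lt_or_ge j.val k.val with h1 | h1
      · refine ⟨k.val - j.val - 1, by omega, ?_⟩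
        rw [show j.val + 1 + (k.val - j.val - 1) = k.val by omega, Nat.mod_eq_of_lt hk]
      · refine ⟨k.val + n - j.val - 1, by omega, ?_⟩
        rw [show j.val + 1 + (k.val + n - j.val - 1) = k.val + n by omega, Nat.add_mod_right,
          Nat.mod_eq_of_lt hk]
    · rintro ⟨s, hs, hsk⟩
      rcases Nat.lt_or_ge (j.val + 1 + s) n with h1 | h1
      · rw [Nat.mod_eq_of_lt h1] at hsk
        omega
      · rw [Nat.mod_eq_sub_mod h1, Nat.mod_eq_of_lt (by omega)] at hsk
        omega
  rcases (cycleGraph_adj_iff hn).1 h with h | h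
  · exact key i j h
  · rw [Set.pair_comm]
    exact key j i h

/-- Every vertex has exactly two neighbours. -/
def IsTwoRegular {V : Type u} (G : SimpleGraph V) : Prop :=
  ∀ x, ∃ y z, y ≠ z ∧ ∀ w, G.Adj x w ↔ w = y ∨ w = z

theorem isTwoRegular_cycleGraph {n : ℕ} (hn : 3 ≤ n) : IsTwoRegular (cycleGraph n) := by
  intro i
  have hi := i.isLt
  refine ⟨⟨(i.val + 1) % n, Nat.mod_lt _ (by omega)⟩, ⟨(i.val + (n - 1)) % n,
    Nat.mod_lt _ (by omega)⟩, ?_, fun w => ?_⟩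
  · rw [Ne, Fin.ext_iff]
    simp only
    rcases Nat.lt_or_ge (i.val + 1) n with h1 | h1
    · rw [Nat.mod_eq_of_lt h1]
      rcases Nat.lt_or_ge (i.val + (n - 1)) n with h2 | h2
      · rw [Nat.mod_eq_of_lt h2]
        omega
      · rw [Nat.mod_eq_sub_mod h2, Nat.mod_eq_of_lt (by omega)]
        omega
    · rw [show i.val + 1 = n by omega, Nat.mod_self, Nat.mod_eq_sub_mod (by omega),
        Nat.mod_eq_of_lt (by omega)]
      omega
  · have hw := w.isLt
    rw [cycleGraph_adj_iff hn, Fin.ext_iff, Fin.ext_iff]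
    refine or_congr Iff.rfl ?_
    simp only
    rcases Nat.eq_zero_or_pos i.val with h1 | h1
    · rw [h1, Nat.zero_add, Nat.mod_eq_of_lt (a := n - 1) (by omega)]
      rcases Nat.lt_or_ge (w.val + 1) n with h2 | h2
      · rw [Nat.mod_eq_of_lt h2]
        omega
      · rw [show w.val + 1 = n by omega, Nat.mod_self]
        omega
    · rw [Nat.mod_eq_sub_mod (a := i.val + (n - 1)) (by omega), Nat.mod_eq_of_lt (a := i.val + (n - 1) - n) (by omega)]
      rcases Nat.lt_or_ge (w.val + 1) n with h2 | h2
      · rw [Nat.mod_eq_of_lt h2]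
        omega
      · rw [show w.val + 1 = n by omega, Nat.mod_self]
        omega

theorem IsTwoRegular.eq_of_adj {V : Type u} {G : SimpleGraph V} (hG : IsTwoRegular G)
    {x y z w : V} (hy : G.Adj x y) (hz : G.Adj x z) (hyz : y ≠ z) (hw : G.Adj x w) :
    w = y ∨ w = z := by
  obtain ⟨a, b, hab, h⟩ := hG x
  rcases (h y).1 hy with rfl | rfl <;> rcases (h z).1 hz with rfl | rfl <;>
    rcases (h w).1 hw with rfl | rfl <;> tauto

theorem IsTwoRegular.iso {V : Type u} {W : Type v} {G : SimpleGraph V} {H : SimpleGraph W}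
    (hG : IsTwoRegular G) (e : G ≃g H) : IsTwoRegular H := by
  intro x
  obtain ⟨y, z, hyz, h⟩ := hG (e.symm x)
  refine ⟨e y, e z, fun h => hyz (e.injective h), fun w => ?_⟩
  rw [← e.symm.map_adj_iff, h, ← e.symm_apply_eq, ← e.symm_apply_eq]

theorem IsCycleGraph.isTwoRegular {V : Type u} {G : SimpleGraph V} (h : IsCycleGraph G) :
    IsTwoRegular G := by
  obtain ⟨n, hn, ⟨e⟩⟩ := h
  exact (isTwoRegular_cycleGraph hn).iso e

theorem IsCycleGraph.conn {V : Type u} {G : SimpleGraph V} (h : IsCycleGraph G) :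
    Conn G Set.univ := by
  obtain ⟨n, hn, ⟨e⟩⟩ := h
  obtain ⟨m, rfl⟩ : ∃ m, n = m + 1 := ⟨n - 1, by omega⟩
  have h1 : Conn (cycleGraph (m + 1)) Set.univ := by
    have h0 := cycleGraph_connected (n := m)
    rwa [← (induceUnivIso (cycleGraph (m + 1))).connected_iff] at h0
  have := h1.image e.toHom
  rwa [Set.image_univ, show Set.range e.toHom = Set.univ from e.surjective.range_eq] at this

theorem IsCycleGraph.iso {V : Type u} {W : Type v} {G : SimpleGraph V} {H : SimpleGraph W}
    (hG : IsCycleGraph G) (e : G ≃g H) : IsCycleGraph H := by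
  obtain ⟨n, hn, ⟨e'⟩⟩ := hG
  exact ⟨n, hn, ⟨e'.trans e⟩⟩

/-- The vertex set of a chordless cycle. -/
def IsCycleSet {V : Type u} (G : SimpleGraph V) (C : Set V) : Prop := IsCycleGraph (G.induce C)

theorem IsCycleSet.conn {V : Type u} {G : SimpleGraph V} {C : Set V} (h : IsCycleSet G C) :
    Conn G C := by
  have := IsCycleGraph.conn h
  rw [conn_induce_iff, Set.image_univ, Subtype.range_coe] at this
  exact this

theorem IsCycleSet.exists_nbrs {V : Type u} {G : SimpleGraph V} {C : Set V} (h : IsCycleSet G C)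
    {x : V} (hx : x ∈ C) : ∃ y ∈ C, ∃ z ∈ C, y ≠ z ∧ G.Adj x y ∧ G.Adj x z := by
  obtain ⟨⟨y, hy⟩, ⟨z, hz⟩, hyz, h⟩ := IsCycleGraph.isTwoRegular h ⟨x, hx⟩
  exact ⟨y, hy, z, hz, fun h' => hyz (Subtype.ext h'), (h ⟨y, hy⟩).2 (Or.inl rfl),
    (h ⟨z, hz⟩).2 (Or.inr rfl)⟩

theorem IsCycleSet.eq_of_adj {V : Type u} {G : SimpleGraph V} {C : Set V} (h : IsCycleSet G C)
    {x y z w : V} (hx : x ∈ C) (hy : y ∈ C) (hz : z ∈ C) (hw : w ∈ C) (hxy : G.Adj x y)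
    (hxz : G.Adj x z) (hyz : y ≠ z) (hxw : G.Adj x w) : w = y ∨ w = z := by
  have := (IsCycleGraph.isTwoRegular h).eq_of_adj (x := ⟨x, hx⟩) (y := ⟨y, hy⟩) (z := ⟨z, hz⟩)
    (w := ⟨w, hw⟩) hxy hxz (fun h' => hyz (congrArg Subtype.val h')) hxw
  simpa using this

/-- If a vertex of a cycle set has at most two neighbours, these lie on the cycle. -/
theorem IsCycleSet.mem_of_adj {V : Type u} {G : SimpleGraph V} {C : Set V} (h : IsCycleSet G C)
    {x w : V} (hx : x ∈ C) (hxw : G.Adj x w)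
    (h2 : ∀ p q r, G.Adj x p → G.Adj x q → G.Adj x r → p = q ∨ p = r ∨ q = r) : w ∈ C := by
  obtain ⟨y, hy, z, hz, hyz, hxy, hxz⟩ := h.exists_nbrs hx
  rcases h2 y z w hxy hxz hxw with h | rfl | rfl
  · exact absurd h hyz
  · exact hy
  · exact hz

end Cycles

end

end SpaghettiTw

namespace SpaghettiTw

open SimpleGraph

noncomputable section

/-! ### Trees of cycles -/

/-! ### Induced subgraphs and vertex sets of chordless cycles -/

section InducedSets

variable {V : Type u} {G : SimpleGraph V}

theorem conn_induce_preimage_iff {A S : Set V} (h : S ⊆ A) :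
    Conn (G.induce A) (Subtype.val ⁻¹' S) ↔ Conn G S := by
  rw [conn_induce_iff, Subtype.image_preimage_coe, Set.inter_eq_self_of_subset_right h]

/-- The subgraph of `G` induced by `S` is the subgraph of `G.induce A` induced by `S`. -/
def induceInduceIso (G : SimpleGraph V) {A S : Set V} (h : S ⊆ A) :
    (G.induce A).induce (Subtype.val ⁻¹' S) ≃g G.induce S where
  toFun x := ⟨x.1.1, x.2⟩
  invFun x := ⟨⟨x.1, h x.2⟩, x.2⟩
  left_inv _ := rfl
  right_inv _ := rfl
  map_rel_iff' := Iff.rfl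

/-- An embedding of graphs restricts to an isomorphism of induced subgraphs. -/
def induceImageIso {W : Type v} {H : SimpleGraph W} (e : G ↪g H) (S : Set V) :
    G.induce S ≃g H.induce (e '' S) where
  toEquiv := Equiv.Set.image e S e.injective
  map_rel_iff' := e.map_rel_iff

theorem nonempty_iso_induce_range {W : Type v} {H : SimpleGraph W} (e : G ↪g H) :
    Nonempty (G ≃g H.induce (Set.range e)) := by
  rw [← Set.image_univ]
  exact ⟨(induceUnivIso G).symm.trans (induceImageIso e Set.univ)⟩

theorem isCycleSet_induce_preimage_iff {A C : Set V} (h : C ⊆ A) :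
    IsCycleSet (G.induce A) (Subtype.val ⁻¹' C) ↔ IsCycleSet G C :=
  ⟨fun hC => IsCycleGraph.iso hC (induceInduceIso G h),
    fun hC => IsCycleGraph.iso hC (induceInduceIso G h).symm⟩

theorem isCycleSet_image_iff {W : Type v} {H : SimpleGraph W} (e : G ↪g H) {C : Set V} :
    IsCycleSet H (e '' C) ↔ IsCycleSet G C :=
  ⟨fun hC => IsCycleGraph.iso hC (induceImageIso e C).symm,
    fun hC => IsCycleGraph.iso hC (induceImageIso e C)⟩

theorem isCycleSet_univ_iff : IsCycleSet G Set.univ ↔ IsCycleGraph G :=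
  ⟨fun hC => IsCycleGraph.iso hC (induceUnivIso G),
    fun hC => IsCycleGraph.iso hC (induceUnivIso G).symm⟩

/-- A vertex of `C` already has its two neighbours on `C'` inside `C`, so `C` is closed in the
connected set `C'`. -/
theorem IsCycleSet.eq_of_subset {C C' : Set V} (hC : IsCycleSet G C) (hC' : IsCycleSet G C')
    (h : C ⊆ C') : C = C' := by
  refine hC'.conn.eq_of_closed h hC.conn.nonempty fun x hx y hy hxy => ?_
  obtain ⟨z, hz, w, hw, hzw, hxz, hxw⟩ := hC.exists_nbrs hx
  rcases hC'.eq_of_adj (h hx) (h hz) (h hw) hy hxz hxw hzw hxy with rfl | rfl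
  · exact hz
  · exact hw

theorem IsCycleGraph.conn_compl (hG : IsCycleGraph G) {x y : V} (h : G.Adj x y) :
    Conn G {x, y}ᶜ := by
  obtain ⟨n, hn, ⟨e⟩⟩ := hG
  have h1 := (conn_cycleGraph_compl hn (e.symm.map_adj_iff.2 h)).image e.toHom
  convert h1 using 1
  ext z
  constructor
  · intro hz
    refine ⟨e.symm z, fun h => hz ?_, e.apply_symm_apply z⟩
    simpa using h
  · rintro ⟨w, hw, rfl⟩ hz
    apply hw
    rcases hz with hz | hz
    · left
      rw [← hz]
      exact (e.symm_apply_apply w).symm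
    · right
      rw [← hz]
      exact (e.symm_apply_apply w).symm

theorem IsCycleSet.conn_diff {C : Set V} (hC : IsCycleSet G C) {x y : V} (hx : x ∈ C) (hy : y ∈ C)
    (h : G.Adj x y) : Conn G (C \ {x, y}) := by
  have h1 := IsCycleGraph.conn_compl hC (x := ⟨x, hx⟩) (y := ⟨y, hy⟩) h
  rw [conn_induce_iff] at h1
  convert h1 using 1
  ext z
  constructor
  · rintro ⟨hz, hz'⟩
    refine ⟨⟨z, hz⟩, fun h => hz' ?_, rfl⟩
    simpa [Subtype.ext_iff] using h
  · rintro ⟨⟨z, hz⟩, hz', rfl⟩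
    refine ⟨hz, fun h => hz' ?_⟩
    simpa [Subtype.ext_iff] using h

end InducedSets

/-! ### Gluing along an edge in terms of vertex sets -/

/-- The vertex sets `A` and `C` of `T` meet exactly in the ends of the edge `pq`, and no edge joins
`A \ C` to `C \ A`. -/
structure MeetInEdge {V : Type u} (T : SimpleGraph V) (A C : Set V) (p q : V) : Prop where
  adj : T.Adj p q
  inter : A ∩ C = {p, q}
  cross : ∀ x ∈ A, ∀ y ∈ C, T.Adj x y → y ∈ A ∨ x ∈ C

theorem IsTreeOfCycles.iso {V W : Type u} {G : SimpleGraph V} {H : SimpleGraph W}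
    (hG : IsTreeOfCycles G) (e : G ≃g H) : IsTreeOfCycles H := by
  cases hG with
  | cycle _ h => exact .cycle _ (h.iso e)
  | glue G₁ G n f g a b i j h₁ hn hab hij hai hbj hU hI hG' =>
    refine .glue G₁ H n (f.trans e.toEquiv.toEmbedding) (g.trans e.toEquiv.toEmbedding) a b i j h₁
      hn hab hij ?_ ?_ ?_ ?_ ?_
    · exact congrArg e hai
    · exact congrArg e hbj
    · have h1 : Set.range (f.trans e.toEquiv.toEmbedding) = e '' Set.range f := Set.range_comp e f
      have h2 : Set.range (g.trans e.toEquiv.toEmbedding) = e '' Set.range g := Set.range_comp e g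
      rw [h1, h2, ← Set.image_union, hU, Set.image_univ]
      exact e.surjective.range_eq
    · have h1 : Set.range (f.trans e.toEquiv.toEmbedding) = e '' Set.range f := Set.range_comp e f
      have h2 : Set.range (g.trans e.toEquiv.toEmbedding) = e '' Set.range g := Set.range_comp e g
      rw [h1, h2, ← Set.image_inter e.injective, hI, Set.image_pair]
      rfl
    · ext x y
      have h0 : ∀ x y, G.Adj x y ↔ (G₁.map f ⊔ (cycleGraph n).map g).Adj x y := by
        rw [hG']
        exact fun _ _ => Iff.rfl
      rw [← e.symm.map_adj_iff, h0, sup_adj, sup_adj, SimpleGraph.map_adj, SimpleGraph.map_adj,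
        SimpleGraph.map_adj, SimpleGraph.map_adj]
      have h1 : ∀ s x, f s = e.symm x ↔ (f.trans e.toEquiv.toEmbedding) s = x :=
        fun s x => e.toEquiv.eq_symm_apply
      have h2 : ∀ s x, g s = e.symm x ↔ (g.trans e.toEquiv.toEmbedding) s = x :=
        fun s x => e.toEquiv.eq_symm_apply
      simp only [h1, h2]

/-- Induction over trees of cycles, with the parts given as vertex sets. -/
theorem IsTreeOfCycles.induction_sets {P : ∀ {V : Type u}, SimpleGraph V → Prop}
    (cycle : ∀ {V : Type u} (G : SimpleGraph V), IsCycleGraph G → P G)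
    (glue : ∀ {V : Type u} (T : SimpleGraph V) (A C : Set V) (p q : V), MeetInEdge T A C p q →
      A ∪ C = Set.univ → IsCycleSet T C → P (T.induce A) → P T)
    {V : Type u} {G : SimpleGraph V} (hG : IsTreeOfCycles G) : P G := by
  -- The induction runs over all isomorphic copies, because the smaller tree is given as an abstract
  -- graph while it is needed as an induced subgraph of `T`.
  have key : ∀ {V : Type u} {G : SimpleGraph V} (hG : IsTreeOfCycles G) {W : Type u}
      {T : SimpleGraph W} (e : G ≃g T), P T := by
    intro V G hG
    induction hG with
    | cycle G h => exact fun e => cycle _ (h.iso e)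
    | @glue V₁ V G₁ G n f g a b i j h₁ hn hab hij hai hbj hU hI hG' ih =>
      intro W T e
      -- Gluing adds no edge inside the first part: the images share only two vertices, which are
      -- adjacent in it already.
      have hfa : ∀ x y, G.Adj (f x) (f y) ↔ G₁.Adj x y := by
        intro x y
        rw [hG', sup_adj, SimpleGraph.map_adj, SimpleGraph.map_adj]
        refine ⟨?_, fun h => Or.inl ⟨x, y, h, rfl, rfl⟩⟩
        rintro (⟨x', y', h, hx, hy⟩ | ⟨k, l, h, hx, hy⟩)
        · rwa [f.injective hx, f.injective hy] at h
        · have h1 : f x ∈ Set.range f ∩ Set.range g := ⟨⟨x, rfl⟩, ⟨k, hx⟩⟩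
          have h2 : f y ∈ Set.range f ∩ Set.range g := ⟨⟨y, rfl⟩, ⟨l, hy⟩⟩
          have h3 : f x ≠ f y := fun h' => h.ne (g.injective (hx.trans (h'.trans hy.symm)))
          rw [hI] at h1 h2
          rcases h1 with h1 | h1 <;> rcases h2 with h2 | h2
          · exact absurd (h1.trans h2.symm) h3
          · rwa [f.injective h1, f.injective h2]
          · rw [f.injective h1, f.injective h2]
            exact hab.symm
          · exact absurd (h1.trans h2.symm) h3
      have hga : ∀ x y, G.Adj (g x) (g y) ↔ (cycleGraph n).Adj x y := by
        intro x y
        rw [hG', sup_adj, SimpleGraph.map_adj, SimpleGraph.map_adj]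
        refine ⟨?_, fun h => Or.inr ⟨x, y, h, rfl, rfl⟩⟩
        rintro (⟨k, l, h, hx, hy⟩ | ⟨x', y', h, hx, hy⟩)
        · have h1 : g x ∈ Set.range f ∩ Set.range g := ⟨⟨k, hx⟩, ⟨x, rfl⟩⟩
          have h2 : g y ∈ Set.range f ∩ Set.range g := ⟨⟨l, hy⟩, ⟨y, rfl⟩⟩
          have h3 : g x ≠ g y := fun h' => h.ne (f.injective (hx.trans (h'.trans hy.symm)))
          rw [hI, hai, hbj] at h1 h2
          rcases h1 with h1 | h1 <;> rcases h2 with h2 | h2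
          · exact absurd (h1.trans h2.symm) h3
          · rwa [g.injective h1, g.injective h2]
          · rw [g.injective h1, g.injective h2]
            exact hij.symm
          · exact absurd (h1.trans h2.symm) h3
        · rwa [g.injective hx, g.injective hy] at h
      let ef : G₁ ↪g T := (⟨f, hfa _ _⟩ : G₁ ↪g G).trans e.toEmbedding
      let eg : cycleGraph n ↪g T := (⟨g, hga _ _⟩ : cycleGraph n ↪g G).trans e.toEmbedding
      have hrf : Set.range ef = e '' Set.range f := Set.range_comp e f
      have hrg : Set.range eg = e '' Set.range g := Set.range_comp e g
      obtain ⟨e₁⟩ := nonempty_iso_induce_range ef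
      obtain ⟨e₂⟩ := nonempty_iso_induce_range eg
      refine glue T (Set.range ef) (Set.range eg) (e (f a)) (e (f b)) ⟨?_, ?_, ?_⟩ ?_
        ⟨n, hn, ⟨e₂⟩⟩ (ih e₁)
      · exact e.map_adj_iff.2 ((hfa _ _).2 hab)
      · rw [hrf, hrg, ← Set.image_inter e.injective, hI, Set.image_pair]
      · rintro x ⟨x, rfl⟩ y ⟨y, rfl⟩ h
        have h1 : G.Adj (f x) (g y) := e.map_adj_iff.1 h
        rw [hG', sup_adj, SimpleGraph.map_adj, SimpleGraph.map_adj] at h1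
        rcases h1 with ⟨x', y', h, hx, hy⟩ | ⟨x', y', h, hx, hy⟩
        · exact Or.inl ⟨y', congrArg e hy⟩
        · exact Or.inr ⟨x', congrArg e hx⟩
      · rw [hrf, hrg, ← Set.image_union, hU, Set.image_univ]
        exact e.surjective.range_eq
  exact key hG Iso.refl

namespace MeetInEdge

variable {V : Type u} {T : SimpleGraph V} {A C : Set V} {p q : V}

theorem left_mem (h : MeetInEdge T A C p q) : p ∈ A ∩ C := h.inter ▸ Or.inl rfl

theorem right_mem (h : MeetInEdge T A C p q) : q ∈ A ∩ C := h.inter ▸ Or.inr rfl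

theorem glue (h : MeetInEdge T A C p q) (hU : A ∪ C = Set.univ) (hC : IsCycleSet T C)
    (hA : IsTreeOfCycles (T.induce A)) : IsTreeOfCycles T := by
  obtain ⟨n, hn, ⟨e⟩⟩ := hC
  refine .glue (T.induce A) T n (Function.Embedding.subtype _)
    (e.toEquiv.toEmbedding.trans (Function.Embedding.subtype _)) ⟨p, h.left_mem.1⟩
    ⟨q, h.right_mem.1⟩ (e.symm ⟨p, h.left_mem.2⟩) (e.symm ⟨q, h.right_mem.2⟩) hA hn h.adj
    (e.symm.map_adj_iff.2 h.adj) ?_ ?_ ?_ ?_ ?_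
  · simp
  · simp
  · have h1 : Set.range (e.toEquiv.toEmbedding.trans (Function.Embedding.subtype (· ∈ C))) = C := by
      ext x
      constructor
      · rintro ⟨y, rfl⟩
        exact (e y).2
      · exact fun hx => ⟨e.symm ⟨x, hx⟩, by simp⟩
    erw [h1]
    simpa using hU
  · have h1 : Set.range (e.toEquiv.toEmbedding.trans (Function.Embedding.subtype (· ∈ C))) = C := by
      ext x
      constructor
      · rintro ⟨y, rfl⟩
        exact (e y).2
      · exact fun hx => ⟨e.symm ⟨x, hx⟩, by simp⟩
    erw [h1]
    simpa using h.inter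
  · ext x y
    rw [sup_adj, SimpleGraph.map_adj, SimpleGraph.map_adj]
    constructor
    · intro hxy
      have hc : x ∈ C → y ∈ C → ∃ s t, (cycleGraph n).Adj s t ∧
          (e.toEquiv.toEmbedding.trans (Function.Embedding.subtype (· ∈ C))) s = x ∧
          (e.toEquiv.toEmbedding.trans (Function.Embedding.subtype (· ∈ C))) t = y := by
        intro hx hy
        have hxy' : (T.induce C).Adj ⟨x, hx⟩ ⟨y, hy⟩ := hxy
        refine ⟨e.symm ⟨x, hx⟩, e.symm ⟨y, hy⟩, e.symm.map_adj_iff.2 hxy', ?_, ?_⟩ <;> simp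
      have ha : x ∈ A → y ∈ A → ∃ s t, (T.induce A).Adj s t ∧
          Function.Embedding.subtype (· ∈ A) s = x ∧ Function.Embedding.subtype (· ∈ A) t = y :=
        fun hx hy => ⟨⟨x, hx⟩, ⟨y, hy⟩, hxy, rfl, rfl⟩
      have hx : x ∈ A ∪ C := hU ▸ Set.mem_univ x
      have hy : y ∈ A ∪ C := hU ▸ Set.mem_univ y
      rcases hx with hx | hx <;> rcases hy with hy | hy
      · exact Or.inl (ha hx hy)
      · rcases h.cross x hx y hy hxy with h' | h'
        · exact Or.inl (ha hx h')
        · exact Or.inr (hc h' hy)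
      · rcases h.cross y hy x hx hxy.symm with h' | h'
        · exact Or.inl (ha h' hy)
        · exact Or.inr (hc hx h')
      · exact Or.inr (hc hx hy)
    · rintro (⟨x', y', h', rfl, rfl⟩ | ⟨x', y', h', rfl, rfl⟩)
      · exact h'
      · exact e.map_adj_iff.2 h'

/-- Restriction of a gluing to a subset containing the first part. -/
theorem induce (h : MeetInEdge T A C p q) {S : Set V} (hA : A ⊆ S) :
    MeetInEdge (T.induce S) (Subtype.val ⁻¹' A) (Subtype.val ⁻¹' C) ⟨p, hA h.left_mem.1⟩
      ⟨q, hA h.right_mem.1⟩ where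
  adj := h.adj
  inter := by
    rw [← Set.preimage_inter, h.inter]
    ext x
    simp [Subtype.ext_iff]
  cross x hx y hy hxy := h.cross x.1 hx y.1 hy hxy

theorem glue_union (h : MeetInEdge T A C p q) (hC : IsCycleSet T C)
    (hA : IsTreeOfCycles (T.induce A)) : IsTreeOfCycles (T.induce (A ∪ C)) := by
  refine (h.induce Set.subset_union_left).glue ?_
    ((isCycleSet_induce_preimage_iff Set.subset_union_right).2 hC)
    (hA.iso (induceInduceIso T Set.subset_union_left).symm)
  rw [← Set.preimage_union, Subtype.coe_preimage_self]

/-- A detour of `S` outside `A` leaves and returns through `p` or `q`, and the edge `pq` shortcuts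
it. -/
theorem conn_inter (h : MeetInEdge T A C p q) (hU : A ∪ C = Set.univ) {S : Set V}
    (hS : Conn T S) (hne : (S ∩ A).Nonempty) : Conn T (S ∩ A) := by
  have hC : ∀ x, x ∉ A → x ∈ C := fun x hx =>
    (show x ∈ A ∪ C from hU ▸ Set.mem_univ x).resolve_left hx
  refine conn_of_closed hne fun U hUS hne' hcl => ?_
  -- A closed `U ⊆ S ∩ A` is enlarged by all of `S \ A` as soon as it contains `p` or `q`, which
  -- makes it closed in `S`.
  have h1 := hS.eq_of_closed (U := U ∪ {w | w ∈ S ∧ w ∉ A ∧ (p ∈ U ∨ q ∈ U)}) ?_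
    (hne'.mono Set.subset_union_left) ?_
  · refine Set.Subset.antisymm hUS fun x hx => ?_
    have h2 : x ∈ U ∪ {w | w ∈ S ∧ w ∉ A ∧ (p ∈ U ∨ q ∈ U)} := h1.symm.subset hx.1
    exact h2.resolve_right fun h3 => h3.2.1 hx.2
  · exact Set.union_subset (hUS.trans Set.inter_subset_left) fun w hw => hw.1
  · have hpq : ∀ x ∈ A, x ∈ C → x = p ∨ x = q := fun x hx hx' => by
      have : x ∈ A ∩ C := ⟨hx, hx'⟩
      rwa [h.inter] at this
    rintro x (hx | ⟨hxS, hxA, hx⟩) y hy hxy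
    · by_cases hyA : y ∈ A
      · exact Or.inl (hcl x hx y ⟨hy, hyA⟩ hxy)
      · refine Or.inr ⟨hy, hyA, ?_⟩
        rcases hpq x (hUS hx).2 ((h.cross x (hUS hx).2 y (hC y hyA) hxy).resolve_left hyA) with
          rfl | rfl
        · exact Or.inl hx
        · exact Or.inr hx
    · by_cases hyA : y ∈ A
      · left
        rcases hpq y hyA ((h.cross y hyA x (hC x hxA) hxy.symm).resolve_left hxA) with
          rfl | rfl <;> rcases hx with hx | hx
        · exact hx
        · exact hcl _ hx _ ⟨hy, hyA⟩ h.adj.symm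
        · exact hcl _ hx _ ⟨hy, hyA⟩ h.adj
        · exact hx
      · exact Or.inr ⟨hy, hyA, hx⟩

theorem mem_of_notMem (hU : A ∪ C = Set.univ) {x : V} (hx : x ∉ A) : x ∈ C :=
  (show x ∈ A ∪ C from hU ▸ Set.mem_univ x).resolve_left hx

theorem eq_or_eq_of_adj (h : MeetInEdge T A C p q) (hU : A ∪ C = Set.univ) {x y : V} (hx : x ∉ A)
    (hy : y ∈ A) (hxy : T.Adj x y) : y = p ∨ y = q := by
  have : y ∈ A ∩ C := ⟨hy, (h.cross y hy x (mem_of_notMem hU hx) hxy.symm).resolve_left hx⟩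
  rwa [h.inter] at this

theorem mem_of_adj (h : MeetInEdge T A C p q) (hU : A ∪ C = Set.univ) {x y : V} (hx : x ∉ A)
    (hxy : T.Adj x y) : y ∈ C := by
  by_cases hy : y ∈ A
  · exact (h.cross y hy x (mem_of_notMem hU hx) hxy.symm).resolve_left hx
  · exact mem_of_notMem hU hy

theorem eq_of_three_adj (h : MeetInEdge T A C p q) (hU : A ∪ C = Set.univ) (hC : IsCycleSet T C)
    {x : V} (hx : x ∉ A) (u v w : V) (hu : T.Adj x u) (hv : T.Adj x v) (hw : T.Adj x w) :
    u = v ∨ u = w ∨ v = w := by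
  by_cases huv : u = v
  · exact Or.inl huv
  · rcases hC.eq_of_adj (mem_of_notMem hU hx) (h.mem_of_adj hU hx hu) (h.mem_of_adj hU hx hv)
      (h.mem_of_adj hU hx hw) hu hv huv hw with rfl | rfl
    · exact Or.inr (Or.inl rfl)
    · exact Or.inr (Or.inr rfl)

/-- A connected set that meets both `A` and its complement contains an end of the common edge. -/
theorem mem_or_mem (h : MeetInEdge T A C p q) (hU : A ∪ C = Set.univ) {S : Set V} (hS : Conn T S)
    (hne : (S ∩ A).Nonempty) {x : V} (hx : x ∈ S) (hxA : x ∉ A) : p ∈ S ∨ q ∈ S := by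
  obtain ⟨z, hzS, hzA⟩ := hne
  obtain ⟨y, ⟨hyS, hyA⟩, w, hwS, hw, hyw⟩ := hS.exists_adj (U := S \ A) Set.sdiff_subset
    ⟨x, hx, hxA⟩ (fun h' => (h'.symm.subset hzS).2 hzA)
  have hwA : w ∈ A := by
    by_contra hwA
    exact hw ⟨hwS, hwA⟩
  rcases h.eq_or_eq_of_adj hU hyA hwA hyw with rfl | rfl
  · exact Or.inl hwS
  · exact Or.inr hwS

/-- If the joining edge is not inside `A`, each of the two sets contains an end of `pq`, and this
edge joins them instead. -/
theorem exists_adj_inter (h : MeetInEdge T A C p q) (hU : A ∪ C = Set.univ) {S S' : Set V}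
    (hS : Conn T S) (hS' : Conn T S') (hne : (S ∩ A).Nonempty) (hne' : (S' ∩ A).Nonempty)
    (hd : Disjoint S S') (hadj : ∃ x ∈ S, ∃ y ∈ S', T.Adj x y) :
    ∃ x ∈ S ∩ A, ∃ y ∈ S' ∩ A, T.Adj x y := by
  obtain ⟨x, hx, y, hy, hxy⟩ := hadj
  have hp := h.left_mem.1
  have hq := h.right_mem.1
  have key : (p ∈ S ∨ q ∈ S) → (p ∈ S' ∨ q ∈ S') → ∃ x ∈ S ∩ A, ∃ y ∈ S' ∩ A, T.Adj x y := by
    rintro (h1 | h1) (h2 | h2)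
    · exact absurd h2 (Set.disjoint_left.1 hd h1)
    · exact ⟨p, ⟨h1, hp⟩, q, ⟨h2, hq⟩, h.adj⟩
    · exact ⟨q, ⟨h1, hq⟩, p, ⟨h2, hp⟩, h.adj.symm⟩
    · exact absurd h2 (Set.disjoint_left.1 hd h1)
  by_cases hxA : x ∈ A <;> by_cases hyA : y ∈ A
  · exact ⟨x, ⟨hx, hxA⟩, y, ⟨hy, hyA⟩, hxy⟩
  · refine key ?_ (h.mem_or_mem hU hS' hne' hy hyA)
    rcases h.eq_or_eq_of_adj hU hyA hxA hxy.symm with rfl | rfl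
    · exact Or.inl hx
    · exact Or.inr hx
  · refine key (h.mem_or_mem hU hS hne hx hxA) ?_
    rcases h.eq_or_eq_of_adj hU hxA hyA hxy with rfl | rfl
    · exact Or.inl hy
    · exact Or.inr hy
  · exact key (h.mem_or_mem hU hS hne hx hxA) (h.mem_or_mem hU hS' hne' hy hyA)

/-- Vertices outside `A` have only their two neighbours on `C`. A cycle through one of them must
therefore follow the path `C \ {p, q}` completely, then contains `p` and `q`, and so equals `C`. -/
theorem isCycleSet_eq_or_subset (h : MeetInEdge T A C p q) (hU : A ∪ C = Set.univ)
    (hC : IsCycleSet T C) {K : Set V} (hK : IsCycleSet T K) : K = C ∨ K ⊆ A := by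
  by_cases hKA : K ⊆ A
  · exact Or.inr hKA
  left
  obtain ⟨x, hxK, hxA⟩ := Set.not_subset.1 hKA
  have hint : C \ {p, q} = Aᶜ := by
    rw [← h.inter]
    ext z
    have : z ∈ A ∪ C := hU ▸ Set.mem_univ z
    simp only [Set.mem_sdiff, Set.mem_inter_iff, Set.mem_compl_iff, Set.mem_union] at this ⊢
    tauto
  have hAc : Conn T Aᶜ := hint ▸ hC.conn_diff h.left_mem.2 h.right_mem.2 h.adj
  have h1 : K ∩ Aᶜ = Aᶜ := hAc.eq_of_closed Set.inter_subset_right ⟨x, hxK, hxA⟩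
    fun y hy z hz hyz => ⟨hK.mem_of_adj hy.1 hyz (h.eq_of_three_adj hU hC hy.2), hz⟩
  have h2 : ∀ y ∉ A, ∀ z, T.Adj y z → z ∈ K := fun y hy z hyz =>
    hK.mem_of_adj (h1.symm.subset hy).1 hyz (h.eq_of_three_adj hU hC hy)
  have h3 : ∀ y ∈ A ∩ C, y ∈ K := by
    intro y hy
    obtain ⟨z, hz, w, hw, hzw, hyz, hyw⟩ := hC.exists_nbrs hy.2
    by_cases hzA : z ∈ A
    · by_cases hwA : w ∈ A
      · exfalso
        have hz' : z ∈ A ∩ C := ⟨hzA, hz⟩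
        have hw' : w ∈ A ∩ C := ⟨hwA, hw⟩
        rw [h.inter] at hz' hw' hy
        have e1 := hyz.ne
        have e2 := hyw.ne
        simp only [Set.mem_insert_iff, Set.mem_singleton_iff] at hz' hw' hy
        rcases hz' with rfl | rfl <;> rcases hw' with rfl | rfl <;> rcases hy with rfl | rfl <;>
          simp_all
      · exact h2 w hwA y hyw.symm
    · exact h2 z hzA y hyz.symm
  refine (hC.eq_of_subset hK fun y hy => ?_).symm
  by_cases hyA : y ∈ A
  · exact h3 y ⟨hyA, hy⟩
  · exact (h1.symm.subset hyA).1

end MeetInEdge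

/-! ### Excluded minor, uniqueness of cycles and gluing for trees of cycles -/

section TreeFacts

/-- Every vertex has at most two neighbours. -/
theorem IsCycleGraph.eq_of_three_adj {V : Type u} {G : SimpleGraph V} (hG : IsCycleGraph G)
    (x u v w : V) (hu : G.Adj x u) (hv : G.Adj x v) (hw : G.Adj x w) : u = v ∨ u = w ∨ v = w := by
  by_cases huv : u = v
  · exact Or.inl huv
  · rcases hG.isTwoRegular.eq_of_adj hu hv huv hw with rfl | rfl
    · exact Or.inr (Or.inl rfl)
    · exact Or.inr (Or.inr rfl)

theorem not_three_disjoint {V : Type u} {G : SimpleGraph V} {x : V} {Y : Fin 3 → Set V}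
    (h : ∀ u v w, G.Adj x u → G.Adj x v → G.Adj x w → u = v ∨ u = w ∨ v = w)
    (hd : ∀ i j, i ≠ j → Disjoint (Y i) (Y j)) (hadj : ∀ i, ∃ y ∈ Y i, G.Adj x y) : False := by
  choose y hy hxy using hadj
  have hne : ∀ i j, i ≠ j → y i ≠ y j := fun i j hij h' =>
    Set.disjoint_left.1 (hd i j hij) (hy i) (h' ▸ hy j)
  rcases h _ _ _ (hxy 0) (hxy 1) (hxy 2) with h | h | h
  · exact hne 0 1 (by decide) h
  · exact hne 0 2 (by decide) h
  · exact hne 1 2 (by decide) h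

theorem IsTreeOfCycles.finite {V : Type u} {G : SimpleGraph V} (hG : IsTreeOfCycles G) :
    Finite V := by
  have hcyc : ∀ {V : Type u} {G : SimpleGraph V}, IsCycleGraph G → Finite V := by
    rintro V G ⟨n, -, ⟨e⟩⟩
    exact Finite.of_equiv _ e.toEquiv
  refine IsTreeOfCycles.induction_sets (P := fun {V} _ => Finite V) (fun G h => hcyc h) ?_ hG
  intro V T A C p q h hU hC hA
  have h1 : Finite C := hcyc hC
  rw [← Set.finite_univ_iff, ← hU]
  exact (Set.toFinite A).union (Set.toFinite C)

/-- Shrinking one branch set to a vertex leaves that vertex with neighbours in three disjoint sets.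
-/
theorem not_isMinor_K4_of_degree {V : Type u} [Finite V] {G : SimpleGraph V} {B : Fin 4 → Set V}
    (hB : ∀ i, Conn G (B i)) (hd : ∀ i j, i ≠ j → Disjoint (B i) (B j))
    (hadj : ∀ i j, i ≠ j → ∃ x ∈ B i, ∃ y ∈ B j, G.Adj x y) (k : Fin 4)
    (h : ∀ x ∈ B k, ∀ u v w, G.Adj x u → G.Adj x v → G.Adj x w → u = v ∨ u = w ∨ v = w) :
    False := by
  have hsa := Fin.succAbove_right_injective (p := k)
  obtain ⟨b, hb, Y', -, -, -, hd', hadj'⟩ := (hB k).exists_shrink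
    (Y := fun i : Fin 3 => B (k.succAbove i)) (fun i => hB _)
    (fun i j hij => hd _ _ (hsa.ne hij)) (fun i => hd _ _ (Fin.succAbove_ne k i).symm)
    (fun i => hadj _ _ (Fin.succAbove_ne k i).symm)
  exact not_three_disjoint (h b hb) hd' hadj'

/-- Every branch set meets `A`, since the vertices outside have at most two neighbours. Intersecting
with `A` therefore moves a `K4` minor into the smaller tree. -/
theorem IsTreeOfCycles.not_isMinor_K4 {V : Type u} {G : SimpleGraph V} (hG : IsTreeOfCycles G) :
    ¬ IsMinor K4 G := by
  have hfin := hG.finite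
  suffices h : Finite V → ¬ IsMinor K4 G from h hfin
  refine IsTreeOfCycles.induction_sets (P := fun {V} G => Finite V → ¬ IsMinor K4 G) ?_ ?_ hG
  · rintro V G hG hfin ⟨B, hB, hd, hadj⟩
    exact not_isMinor_K4_of_degree hB hd hadj 0 fun x _ => hG.eq_of_three_adj x
  · rintro V T A C p q h hU hC ih hfin ⟨B, hB, hd, hadj⟩
    have hne : ∀ i, (B i ∩ A).Nonempty := by
      intro i
      by_contra hne
      exact not_isMinor_K4_of_degree hB hd hadj i fun x hx =>
        h.eq_of_three_adj hU hC fun hxA => hne ⟨x, hx, hxA⟩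
    refine ih inferInstance ⟨fun i => Subtype.val ⁻¹' (B i ∩ A), fun i => ?_, fun i j hij => ?_,
      fun i j hij => ?_⟩
    · exact (conn_induce_preimage_iff Set.inter_subset_right).2 (h.conn_inter hU (hB i) (hne i))
    · exact ((hd i j hij).mono Set.inter_subset_left Set.inter_subset_left).preimage _
    · obtain ⟨x, hx, y, hy, hxy⟩ := h.exists_adj_inter hU (hB i) (hB j) (hne i) (hne j)
        (hd i j hij) (hadj i j hij)
      exact ⟨⟨x, hx.2⟩, hx, ⟨y, hy.2⟩, hy, hxy⟩

/-- Two chordless cycles of a tree of cycles through an edge `st` that meet the same component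
after removing `s` and `t` coincide. -/
theorem IsTreeOfCycles.cycleSet_unique {V : Type u} {G : SimpleGraph V} (hG : IsTreeOfCycles G)
    {s t : V} {C₁ C₂ S : Set V} (hC₁ : IsCycleSet G C₁) (hC₂ : IsCycleSet G C₂)
    (hs₁ : s ∈ C₁) (ht₁ : t ∈ C₁) (hs₂ : s ∈ C₂) (ht₂ : t ∈ C₂) (hst : s ≠ t)
    (hS : Conn G S) (hsS : s ∉ S) (htS : t ∉ S) (h₁ : (S ∩ C₁).Nonempty)
    (h₂ : (S ∩ C₂).Nonempty) : C₁ = C₂ := by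
  refine IsTreeOfCycles.induction_sets (P := fun {V} G => ∀ {s t : V} {C₁ C₂ S : Set V},
    IsCycleSet G C₁ → IsCycleSet G C₂ → s ∈ C₁ → t ∈ C₁ → s ∈ C₂ → t ∈ C₂ → s ≠ t → Conn G S →
    s ∉ S → t ∉ S → (S ∩ C₁).Nonempty → (S ∩ C₂).Nonempty → C₁ = C₂) ?_ ?_ hG hC₁ hC₂ hs₁ ht₁
    hs₂ ht₂ hst hS hsS htS h₁ h₂
  · intro V G hG s t C₁ C₂ S hC₁ hC₂ _ _ _ _ _ _ _ _ _ _
    rw [hC₁.eq_of_subset (isCycleSet_univ_iff.2 hG) (Set.subset_univ _),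
      hC₂.eq_of_subset (isCycleSet_univ_iff.2 hG) (Set.subset_univ _)]
  · intro V T A C p q h hU hC ih s t C₁ C₂ S hC₁ hC₂ hs₁ ht₁ hs₂ ht₂ hst hS hsS htS h₁ h₂
    -- When one of the cycles is the glued one and the other lies in `A`, the vertices `s, t` are
    -- the glued edge, and `S` would have to cross it.
    have hmix : ∀ {K : Set V}, K ⊆ A → s ∈ C → t ∈ C → s ∈ K → t ∈ K → (S ∩ C).Nonempty →
        (S ∩ K).Nonempty → False := by
      rintro K hKA hsC htC hsK htK ⟨x, hxS, hxC⟩ ⟨y, hyS, hyK⟩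
      have hs : s ∈ A ∩ C := ⟨hKA hsK, hsC⟩
      have ht : t ∈ A ∩ C := ⟨hKA htK, htC⟩
      rw [h.inter] at hs ht
      have hpq : p ∉ S ∧ q ∉ S := by
        rcases hs with rfl | rfl <;> rcases ht with rfl | rfl
        · exact absurd rfl hst
        · exact ⟨hsS, htS⟩
        · exact ⟨htS, hsS⟩
        · exact absurd rfl hst
      have hxA : x ∉ A := by
        intro hxA
        have : x ∈ A ∩ C := ⟨hxA, hxC⟩
        rw [h.inter] at this
        rcases this with rfl | rfl
        · exact hpq.1 hxS
        · exact hpq.2 hxS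
      rcases h.mem_or_mem hU hS ⟨y, hyS, hKA hyK⟩ hxS hxA with h' | h'
      · exact hpq.1 h'
      · exact hpq.2 h'
    rcases h.isCycleSet_eq_or_subset hU hC hC₁ with rfl | hA₁ <;>
      rcases h.isCycleSet_eq_or_subset hU hC hC₂ with rfl | hA₂
    · rfl
    · exact (hmix hA₂ hs₁ ht₁ hs₂ ht₂ h₁ h₂).elim
    · exact (hmix hA₁ hs₂ ht₂ hs₁ ht₁ h₂ h₁).elim
    · have hne : (S ∩ A).Nonempty := h₁.mono (Set.inter_subset_inter_right _ hA₁)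
      have := ih (s := ⟨s, hA₁ hs₁⟩) (t := ⟨t, hA₁ ht₁⟩) (S := Subtype.val ⁻¹' (S ∩ A))
        ((isCycleSet_induce_preimage_iff hA₁).2 hC₁) ((isCycleSet_induce_preimage_iff hA₂).2 hC₂)
        hs₁ ht₁ hs₂ ht₂ (fun h' => hst (congrArg Subtype.val h'))
        ((conn_induce_preimage_iff Set.inter_subset_right).2 (h.conn_inter hU hS hne))
        (fun h' => hsS h'.1) (fun h' => htS h'.1)
        (by obtain ⟨x, hx, hx'⟩ := h₁; exact ⟨⟨x, hA₁ hx'⟩, ⟨hx, hA₁ hx'⟩, hx'⟩)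
        (by obtain ⟨x, hx, hx'⟩ := h₂; exact ⟨⟨x, hA₂ hx'⟩, ⟨hx, hA₂ hx'⟩, hx'⟩)
      have h3 := congrArg (Set.image Subtype.val) this
      rwa [Subtype.image_preimage_coe, Subtype.image_preimage_coe,
        Set.inter_eq_self_of_subset_right hA₁, Set.inter_eq_self_of_subset_right hA₂] at h3

/-- Gluing two trees of cycles along an edge. -/
theorem IsTreeOfCycles.glue_trees {V : Type u} {T : SimpleGraph V} {A B : Set V} {p q : V}
    (hA : IsTreeOfCycles (T.induce A)) (hB : IsTreeOfCycles (T.induce B))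
    (h : MeetInEdge T A B p q) : IsTreeOfCycles (T.induce (A ∪ B)) := by
  have key := IsTreeOfCycles.induction_sets (P := fun {W} H => ∀ {V : Type u} {T : SimpleGraph V}
    (e : H ↪g T) {A : Set V} {p q : V}, IsTreeOfCycles (T.induce A) →
    MeetInEdge T A (Set.range e) p q → IsTreeOfCycles (T.induce (A ∪ Set.range e))) ?_ ?_ hB
    (Embedding.induce B) hA (p := p) (q := q)
  · rw [show Set.range (Embedding.induce (G := T) B) = B from Subtype.range_coe] at key
    exact key h
  · intro W H hH V T e A p q hA h
    refine h.glue_union ?_ hA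
    rw [← Set.image_univ, isCycleSet_image_iff, isCycleSet_univ_iff]
    exact hH
  · intro W H B C x y hm hU hC ih V T e A p q hA h
    have hC' : IsCycleSet T (e '' C) := (isCycleSet_image_iff e).2 hC
    have hrange : Set.range e = e '' B ∪ e '' C := by
      rw [← Set.image_union, hU, Set.image_univ]
    have hrB : Set.range (e.comp (Embedding.induce B)) = e '' B := by
      ext z
      constructor
      · rintro ⟨w, rfl⟩
        exact ⟨w.1, w.2, rfl⟩
      · rintro ⟨w, hw, rfl⟩
        exact ⟨⟨w, hw⟩, rfl⟩
    have hBC : e '' B ∩ e '' C = {e x, e y} := by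
      rw [← Set.image_inter e.injective, hm.inter, Set.image_pair]
    have hxy : T.Adj (e x) (e y) := e.map_adj_iff.2 hm.adj
    have hcrossBC : ∀ z ∈ e '' B, ∀ w ∈ e '' C, T.Adj z w → w ∈ e '' B ∨ z ∈ e '' C := by
      rintro _ ⟨z, hz, rfl⟩ _ ⟨w, hw, rfl⟩ hzw
      rcases hm.cross z hz w hw (e.map_adj_iff.1 hzw) with h' | h'
      · exact Or.inl ⟨w, h', rfl⟩
      · exact Or.inr ⟨z, h', rfl⟩
    have hp : p ∈ A ∩ Set.range e := h.left_mem
    have hq : q ∈ A ∩ Set.range e := h.right_mem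
    have hsubA : ∀ z ∈ A, z ∈ Set.range e → z = p ∨ z = q := fun z hz hz' => by
      have : z ∈ A ∩ Set.range e := ⟨hz, hz'⟩
      rwa [h.inter] at this
    have hBr : e '' B ⊆ Set.range e := Set.image_subset_range _ _
    have hCr : e '' C ⊆ Set.range e := Set.image_subset_range _ _
    -- No edge runs between the private vertices of the last cycle and those of the rest, so the
    -- edge `pq` lies entirely on one side. This decides which piece is glued to `A` first.
    have hside : (p ∈ e '' B ∧ q ∈ e '' B) ∨ (p ∈ e '' C ∧ q ∈ e '' C) := by
      have hp' := hp.2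
      have hq' := hq.2
      rw [hrange] at hp' hq'
      rcases hp' with hp' | hp' <;> rcases hq' with hq' | hq'
      · exact Or.inl ⟨hp', hq'⟩
      · rcases hcrossBC p hp' q hq' h.adj with h' | h'
        · exact Or.inl ⟨hp', h'⟩
        · exact Or.inr ⟨h', hq'⟩
      · rcases hcrossBC q hq' p hp' h.adj.symm with h' | h'
        · exact Or.inl ⟨h', hq'⟩
        · exact Or.inr ⟨hp', h'⟩
      · exact Or.inr ⟨hp', hq'⟩
    -- the part of the second tree containing the common edge is attached first
    have hsub : ∀ {D : Set V}, D ⊆ Set.range e → p ∈ D → q ∈ D → MeetInEdge T A D p q := by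
      intro D hD hpD hqD
      refine ⟨h.adj, Set.Subset.antisymm ?_ ?_, fun z hz w hw hzw => ?_⟩
      · exact fun z hz => hsubA z hz.1 (hD hz.2)
      · rintro z (rfl | rfl)
        · exact ⟨hp.1, hpD⟩
        · exact ⟨hq.1, hqD⟩
      · rcases h.cross z hz w (hD hw) hzw with h' | h'
        · exact Or.inl h'
        · right
          rcases hsubA z hz h' with rfl | rfl
          · exact hpD
          · exact hqD
    have hrest : ∀ {D E : Set V}, D ⊆ Set.range e → E ⊆ Set.range e → p ∈ D → q ∈ D →
        D ∩ E = {e x, e y} → (∀ z ∈ D, ∀ w ∈ E, T.Adj z w → w ∈ D ∨ z ∈ E) →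
        MeetInEdge T (A ∪ D) E (e x) (e y) := by
      intro D E hD hE hpD hqD hDE hcr
      have hAE : ∀ z ∈ A, z ∈ Set.range e → z ∈ D := fun z hz hz' => by
        rcases hsubA z hz hz' with rfl | rfl
        · exact hpD
        · exact hqD
      refine ⟨hxy, ?_, ?_⟩
      · rw [← hDE]
        refine Set.Subset.antisymm ?_ (Set.inter_subset_inter_left _ Set.subset_union_right)
        rintro z ⟨hz | hz, hzE⟩
        · exact ⟨hAE z hz (hE hzE), hzE⟩
        · exact ⟨hz, hzE⟩
      · rintro z (hz | hz) w hw hzw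
        · rcases h.cross z hz w (hE hw) hzw with h' | h'
          · exact Or.inl (Or.inl h')
          · rcases hcr z (hAE z hz h') w hw hzw with h'' | h''
            · exact Or.inl (Or.inr h'')
            · exact Or.inr h''
        · rcases hcr z hz w hw hzw with h'' | h''
          · exact Or.inl (Or.inr h'')
          · exact Or.inr h''
    rcases hside with ⟨h1, h2⟩ | ⟨h1, h2⟩
    · have h3 := ih (e.comp (Embedding.induce B)) hA (p := p) (q := q)
      rw [hrB] at h3
      have h4 := (hrest hBr hCr h1 h2 hBC hcrossBC).glue_union hC' (h3 (hsub hBr h1 h2))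
      rwa [Set.union_assoc, ← hrange] at h4
    · have h3 := (hsub hCr h1 h2).glue_union hC' hA
      have h4 := ih (e.comp (Embedding.induce B)) h3 (p := e x) (q := e y)
      rw [hrB] at h4
      have h5 := h4 (hrest hCr hBr h1 h2 (by rw [Set.inter_comm]; exact hBC)
        fun z hz w hw hzw => (hcrossBC w hw z hz hzw.symm).symm)
      rwa [Set.union_assoc, Set.union_comm (e '' C), ← hrange] at h5

end TreeFacts

end

end SpaghettiTw

namespace SpaghettiTw

open SimpleGraph

noncomputable section

/-! ### The cell completion of a 2-connected graph without `K₄` minor -/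

section CellCompletion

variable {V : Type u} {G : SimpleGraph V}

/-- A connected set adjacent to both ends of an edge `pq` contains the rest of a chordless cycle
through this edge. -/
theorem exists_cycleSet {p q : V} {D : Set V} (hpq : G.Adj p q) (hD : Conn G D) (hpD : p ∉ D)
    (hqD : q ∉ D) (hp : ∃ x ∈ D, G.Adj p x) (hq : ∃ x ∈ D, G.Adj q x) :
    ∃ C, IsCycleSet G C ∧ p ∈ C ∧ q ∈ C ∧ C ⊆ D ∪ {p, q} := by
  -- `H` is `G` on `D ∪ {p, q}` without the edge `pq`. A shortest `p`–`q` walk in `H` has no chords,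
  -- and `pq` closes it to a chordless cycle; distances from `p` in `H` identify the positions on
  -- it.
  let H : SimpleGraph V :=
    { Adj := fun x y => G.Adj x y ∧ (x ∈ D ∪ {p, q} ∧ y ∈ D ∪ {p, q}) ∧ (x ∈ D ∨ y ∈ D)
      symm := ⟨fun x y h => ⟨h.1.symm, h.2.1.symm, h.2.2.symm⟩⟩
      loopless := ⟨fun x h => G.loopless.irrefl x h.1⟩ }
  have hpS : p ∈ D ∪ {p, q} := Or.inr (Or.inl rfl)
  have hqS : q ∈ D ∪ {p, q} := Or.inr (Or.inr rfl)
  obtain ⟨x, hx, hpx⟩ := hp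
  obtain ⟨y, hy, hqy⟩ := hq
  have hreach : ∀ z ∈ D, H.Reachable p z := by
    have h1 := hD.eq_of_closed (U := {z | z ∈ D ∧ H.Reachable p z}) (fun z hz => hz.1)
      ⟨x, hx, Adj.reachable (G := H) ⟨hpx, ⟨hpS, Or.inl hx⟩, Or.inr hx⟩⟩
      (fun a ha b hb hab => ⟨hb, ha.2.trans (Adj.reachable (G := H)
        ⟨hab, ⟨Or.inl ha.1, Or.inl hb⟩, Or.inl ha.1⟩)⟩)
    exact fun z hz => (h1.symm.subset hz).2
  have hr : H.Reachable p q := (hreach y hy).trans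
    (Adj.reachable (G := H) ⟨hqy.symm, ⟨Or.inl hy, hqS⟩, Or.inl hy⟩)
  obtain ⟨w, hw⟩ := hr.exists_walk_length_eq_dist
  have hdist : ∀ i ≤ w.length, H.Reachable p (w.getVert i) ∧ H.dist p (w.getVert i) = i := by
    intro i hi
    have h1 := dist_le (w.take i)
    have h2 := dist_le (w.drop i)
    have h3 := (w.take i).reachable.dist_triangle_left q
    rw [Walk.take_length] at h1
    rw [Walk.drop_length] at h2
    exact ⟨(w.take i).reachable, by omega⟩
  have hne : ¬ H.Adj p q := fun h => h.2.2.elim hpD hqD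
  have hlen : 2 ≤ w.length := by
    have h0 := hr.pos_dist_of_ne hpq.ne
    have h1 : H.dist p q ≠ 1 := fun h => hne (dist_eq_one_iff_adj.1 h)
    omega
  have hinj : ∀ i ≤ w.length, ∀ j ≤ w.length, w.getVert i = w.getVert j → i = j := by
    intro i hi j hj hij
    rw [← (hdist i hi).2, hij, (hdist j hj).2]
  have hstep : ∀ i ≤ w.length, ∀ j ≤ w.length, H.Adj (w.getVert i) (w.getVert j) ↔
      j = i + 1 ∨ i = j + 1 := by
    intro i hi j hj
    constructor
    · intro h
      have h1 := (hdist i hi).1.dist_triangle_left (w.getVert j)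
      have h2 := (hdist j hj).1.dist_triangle_left (w.getVert i)
      have h3 : H.dist (w.getVert i) (w.getVert j) = 1 := dist_eq_one_iff_adj.2 h
      have h4 : H.dist (w.getVert j) (w.getVert i) = 1 := dist_eq_one_iff_adj.2 h.symm
      rw [(hdist i hi).2, (hdist j hj).2] at h1 h2
      have h5 : i ≠ j := fun h' => h.ne (by rw [h'])
      omega
    · rintro (rfl | rfl)
      · exact w.adj_getVert_succ (by omega)
      · exact (w.adj_getVert_succ (by omega)).symm
  have hmem : ∀ i ≤ w.length, w.getVert i ∈ D ∪ {p, q} := by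
    intro i hi
    rcases Nat.eq_zero_or_pos i with rfl | h0
    · rwa [Walk.getVert_zero]
    · exact ((hstep (i - 1) (by omega) i hi).2 (by omega)).2.1.2
  have hends : ∀ i ≤ w.length, w.getVert i ∉ D → i = 0 ∨ i = w.length := by
    intro i hi hiD
    rcases (hmem i hi).resolve_left hiD with h | h
    · exact Or.inl (hinj i hi 0 (by omega) (by rw [Walk.getVert_zero]; exact h))
    · exact Or.inr (hinj i hi _ le_rfl (by rw [Walk.getVert_length]; exact h))
  have hG : ∀ i ≤ w.length, ∀ j ≤ w.length, G.Adj (w.getVert i) (w.getVert j) ↔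
      (j = i + 1 ∨ i = j + 1) ∨ (i = 0 ∧ j = w.length) ∨ (j = 0 ∧ i = w.length) := by
    intro i hi j hj
    constructor
    · intro h
      by_cases hD' : w.getVert i ∈ D ∨ w.getVert j ∈ D
      · exact Or.inl ((hstep i hi j hj).1 ⟨h, ⟨hmem i hi, hmem j hj⟩, hD'⟩)
      · push Not at hD'
        have h1 := hends i hi hD'.1
        have h2 := hends j hj hD'.2
        have h5 : i ≠ j := fun h' => h.ne (by rw [h'])
        omega
    · rintro (h | ⟨rfl, rfl⟩ | ⟨rfl, rfl⟩)
      · exact ((hstep i hi j hj).2 h).1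
      · rwa [Walk.getVert_zero, Walk.getVert_length]
      · rw [Walk.getVert_zero, Walk.getVert_length]
        exact hpq.symm
  let e : cycleGraph (w.length + 1) ↪g G :=
    { toFun := fun i => w.getVert i.val
      inj' := fun i j hij => Fin.ext (hinj i (by omega) j (by omega) hij)
      map_rel_iff' := by
        intro i j
        have hi := i.isLt
        have hj := j.isLt
        change G.Adj (w.getVert i.val) (w.getVert j.val) ↔ _
        rw [hG i (by omega) j (by omega), cycleGraph_adj_iff (by omega)]
        have key : ∀ k : ℕ, k < w.length + 1 → (k + 1) % (w.length + 1) =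
            if k = w.length then 0 else k + 1 := by
          intro k hk
          split_ifs with h
          · rw [h, Nat.mod_self]
          · exact Nat.mod_eq_of_lt (by omega)
        rw [key i hi, key j hj]
        split_ifs <;> omega }
  refine ⟨Set.range e, ?_, ⟨0, w.getVert_zero⟩, ⟨Fin.last _, w.getVert_length⟩, ?_⟩
  · obtain ⟨e'⟩ := nonempty_iso_induce_range e
    exact ⟨_, by omega, ⟨e'⟩⟩
  · rintro _ ⟨i, rfl⟩
    exact hmem i (by omega)

/-- Three disjoint nonempty unions of components serve as well as three components, and are easier
to carry between graphs. -/
theorem three_le_card_connectedComponent_iff [Finite V] {a b : V} :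
    3 ≤ Nat.card (G.induce ({a, b}ᶜ : Set V)).ConnectedComponent ↔
      ∃ X : Fin 3 → Set V, (∀ i, (X i).Nonempty) ∧ (∀ i j, i ≠ j → Disjoint (X i) (X j)) ∧
        ∀ i, IsClosedAt G a b (X i) := by
  have : Fintype (G.induce ({a, b}ᶜ : Set V)).ConnectedComponent := Fintype.ofFinite _
  constructor
  · intro h
    obtain ⟨c⟩ : Nonempty (Fin 3 ↪ (G.induce ({a, b}ᶜ : Set V)).ConnectedComponent) := by
      rw [Function.Embedding.nonempty_iff_card_le, Fintype.card_fin, ← Nat.card_eq_fintype_card]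
      exact h
    refine ⟨fun i => Subtype.val '' (c i).supp, fun i => ?_, fun i j hij => ?_, fun i => ?_⟩
    · exact (c i).nonempty_supp.image _
    · rw [Set.disjoint_image_iff Subtype.val_injective]
      exact Set.disjoint_left.2 fun x hx hx' => hij (c.injective (hx.symm.trans hx'))
    · refine ⟨?_, ?_, ?_⟩
      · rintro ⟨x, -, hx⟩
        exact x.2 (Or.inl hx)
      · rintro ⟨x, -, hx⟩
        exact x.2 (Or.inr hx)
      · rintro _ ⟨x, hx, rfl⟩ y hxy
        by_cases hy : y = a ∨ y = b
        · exact Or.inr hy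
        · refine Or.inl ⟨⟨y, hy⟩, ?_, rfl⟩
          have hxy' : (G.induce ({a, b}ᶜ : Set V)).Adj x ⟨y, hy⟩ := hxy
          exact (ConnectedComponent.mem_supp_congr_adj _ hxy').1 hx
  · rintro ⟨X, hne, hd, hcl⟩
    have hsub : ∀ i, ∀ x ∈ X i, x ∈ ({a, b}ᶜ : Set V) := by
      rintro i x hx (rfl | rfl)
      · exact (hcl i).1 hx
      · exact (hcl i).2.1 hx
    choose x hx using hne
    have hinj : Function.Injective fun i =>
        (G.induce ({a, b}ᶜ : Set V)).connectedComponentMk ⟨x i, hsub i _ (hx i)⟩ := by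
      intro i j hij
      by_contra hne
      obtain ⟨w⟩ := ConnectedComponent.exact hij
      have key : ∀ (s t : ({a, b}ᶜ : Set V)) (w : (G.induce ({a, b}ᶜ : Set V)).Walk s t),
          s.1 ∈ X i → t.1 ∈ X i := by
        intro s t w
        induction w with
        | nil => exact id
        | @cons s m t hadj _ ih =>
          exact fun hs => ih (((hcl i).2.2 _ hs _ hadj).resolve_right m.2)
      exact Set.disjoint_left.1 (hd i j hne) (key _ _ w (hx i)) (hx j)
    have := Fintype.card_le_of_injective _ hinj
    rw [Nat.card_eq_fintype_card]
    simpa using this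

theorem cellCompletion_adj_iff [Finite V] {a b : V} : (cellCompletion G).Adj a b ↔ G.Adj a b ∨
    (a ≠ b ∧ ∃ X : Fin 3 → Set V, (∀ i, (X i).Nonempty) ∧
      (∀ i j, i ≠ j → Disjoint (X i) (X j)) ∧ ∀ i, IsClosedAt G a b (X i)) := by
  rw [← three_le_card_connectedComponent_iff]
  rfl

theorem le_cellCompletion : G ≤ cellCompletion G := fun _ _ h => Or.inl h

/-- A 2-connected graph without three neighbours at any vertex is a cycle. -/
theorem IsTwoConnected.isCycleGraph (hG : IsTwoConnected G)
    (h : ∀ x u v w, G.Adj x u → G.Adj x v → G.Adj x w → u = v ∨ u = w ∨ v = w) :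
    IsCycleGraph G := by
  obtain ⟨p, q, hpq⟩ := hG.exists_edge
  obtain ⟨z, hzp, hzq⟩ := hG.exists_third p q
  have hz : z ∈ ({p, q}ᶜ : Set V) := fun h => h.elim hzp hzq
  have hD := (isClosedAt_compl G p q).compIn hz
  obtain ⟨C, hC, hp, hq, -⟩ := exists_cycleSet hpq hD.1 hD.2.1 hD.2.2.1
    (hG.exists_adj_of_isComp hpq.ne hD.2 hD.1.nonempty)
    (hG.exists_adj_of_isComp hpq.ne.symm hD.2.symm hD.1.nonempty)
  have : C = Set.univ := hG.conn_univ.eq_of_closed (Set.subset_univ _) ⟨p, hp⟩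
    fun x hx y _ hxy => hC.mem_of_adj hx hxy (h x)
  rwa [this, isCycleSet_univ_iff] at hC

theorem IsTwoConnected.cellCompletion_eq_self [Finite V] (hG : IsTwoConnected G)
    (h : ∀ x u v w, G.Adj x u → G.Adj x v → G.Adj x w → u = v ∨ u = w ∨ v = w) :
    cellCompletion G = G := by
  ext a b
  rw [cellCompletion_adj_iff]
  refine ⟨?_, Or.inl⟩
  rintro (h' | ⟨hab, X, hne, hd, hcl⟩)
  · exact h'
  · exact (not_three_disjoint (h a) hd fun i => hG.exists_adj_of_isComp hab (hcl i) (hne i)).elim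

/-- Three disjoint connections between `a` and `b`, two of which meet one connected set avoiding
`a` and `b`, give a `K₄` minor. -/
theorem isMinor_K4_of_three_routes {a b : V} (hab : a ≠ b) {X : Fin 3 → Set V}
    (hX : ∀ i, Conn G (X i)) (hd : ∀ i j, i ≠ j → Disjoint (X i) (X j)) (haX : ∀ i, a ∉ X i)
    (hbX : ∀ i, b ∉ X i) (ha : ∀ i, ∃ x ∈ X i, G.Adj a x) (hb : ∀ i, ∃ x ∈ X i, G.Adj b x)
    {E : Set V} (hE : Conn G E) (haE : a ∉ E) (hbE : b ∉ E) {i j : Fin 3} (hij : i ≠ j)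
    (hiE : X i ⊆ E) (hjE : (X j ∩ E).Nonempty) : IsMinor K4 G := by
  obtain ⟨k, hik, hjk⟩ : ∃ k : Fin 3, i ≠ k ∧ j ≠ k := by
    revert hij
    clear hiE hjE
    revert i j
    decide
  obtain ⟨x, hx⟩ := (hX i).nonempty
  have hxS : x ∈ E \ (X j ∪ X k) := ⟨hiE hx, fun h => h.elim
    (Set.disjoint_left.1 (hd i j hij) hx) (Set.disjoint_left.1 (hd i k hik) hx)⟩
  have hUc := conn_compIn (G := G) hxS
  have hUs := compIn_subset (G := G) (E \ (X j ∪ X k)) x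
  have hiU : X i ⊆ compIn G (E \ (X j ∪ X k)) x := (hX i).subset_compIn
    (fun y hy => ⟨hiE hy, fun h => h.elim (Set.disjoint_left.1 (hd i j hij) hy)
      (Set.disjoint_left.1 (hd i k hik) hy)⟩) hx
  obtain ⟨z, hzj, hzE⟩ := hjE
  obtain ⟨y, hy, w, hw, hwU, hyw⟩ := hE.exists_adj (hUs.trans Set.sdiff_subset) hUc.nonempty
    (fun h => (hUs (h.symm.subset hzE)).2 (Or.inl hzj))
  have hwX : w ∈ X j ∪ X k := by
    by_contra hwX
    exact hwU (compIn_closed hy ⟨hw, hwX⟩ hyw)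
  -- The component of `E \ (X j ∪ X k)` around `X i` is adjacent to another route `X l`. Their union
  -- contains two disjoint routes, and the remaining `X m` is the route outside.
  have main : ∀ l m : Fin 3, i ≠ l → i ≠ m → l ≠ m → X m ⊆ X j ∪ X k → w ∈ X l →
      IsMinor K4 G := by
    intro l m hil him hlm hm hwl
    refine isMinor_K4_of_two_routes hab (hUc.union_of_adj (hX l) hy hwl hyw) ?_ ?_
      (hiU.trans Set.subset_union_left) Set.subset_union_right (hX i) (hX l) (hd i l hil) (ha i)
      (hb i) (ha l) (hb l) (Or.inr ⟨X m, hX m, ?_, haX m, hbX m, ha m, hb m⟩)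
    · rintro (h | h)
      · exact haE (hUs h).1
      · exact haX l h
    · rintro (h | h)
      · exact hbE (hUs h).1
      · exact hbX l h
    · refine Set.disjoint_union_right.2 ⟨Set.disjoint_left.2 fun s hs hs' => (hUs hs').2 (hm hs), ?_⟩
      exact hd m l hlm.symm
  rcases hwX with h | h
  · exact main j k hij hik hjk Set.subset_union_right h
  · exact main k j hik hij hjk.symm Set.subset_union_left h

/-- A vertex with three neighbours in a 2-connected graph without `K₄` minor yields an edge of the
cell completion whose ends separate the graph. -/
theorem IsTwoConnected.exists_split [Finite V] (hG : IsTwoConnected G) (hK : ¬ IsMinor K4 G)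
    {a : V} {n : Fin 3 → V} (hn : Function.Injective n) (han : ∀ i, G.Adj a (n i)) :
    ∃ (b : V) (D : Set V), a ≠ b ∧ (cellCompletion G).Adj a b ∧ IsClosedAt G a b D ∧
      D.Nonempty ∧ ((D ∪ {a, b})ᶜ : Set V).Nonempty := by
  -- A tripod in `G - a` with its feet at three neighbours of `a` gives three routes from `a` to its
  -- centre `b`; an empty leg means that `b` is itself one of these neighbours.
  obtain ⟨b, hb, X, hXs, hd, hX⟩ := (hG.conn_compl a).exists_tripod (fun i => {n i})
    (fun i => Set.singleton_subset_iff.2 (han i).ne.symm) (fun i => Set.singleton_nonempty _)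
  have hab : a ≠ b := fun h => hb h.symm
  have haX : ∀ i, a ∉ X i := fun i h => (hXs i h).1 rfl
  have hbX : ∀ i, b ∉ X i := fun i h => (hXs i h).2 rfl
  have hnX : ∀ i, X i ≠ ∅ → Conn G (X i) ∧ (∃ x ∈ X i, G.Adj b x) ∧ n i ∈ X i := by
    intro i hi
    rcases hX i with ⟨h, -⟩ | ⟨h1, h2, y, hy, hy'⟩
    · exact absurd h hi
    · obtain rfl : y = n i := hy'
      exact ⟨h1, h2, hy⟩
  have hnab : ∀ i, X i ≠ ∅ → n i ∈ ({a, b}ᶜ : Set V) := by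
    rintro i hi (h | h)
    · exact (han i).ne h.symm
    · exact hbX i (h ▸ (hnX i hi).2.2)
  have hcomp : ∀ i, X i ≠ ∅ → IsComp G a b (compIn G {a, b}ᶜ (n i)) := fun i hi =>
    (isClosedAt_compl G a b).compIn (hnab i hi)
  have hsub : ∀ i, X i ≠ ∅ → X i ⊆ compIn G {a, b}ᶜ (n i) := fun i hi =>
    (hnX i hi).1.subset_compIn (fun x hx h => h.elim (fun h => haX i (h ▸ hx))
      fun h => hbX i (h ▸ hx)) (hnX i hi).2.2
  have hsplit : ∀ i j, X i ≠ ∅ → X j ≠ ∅ → (cellCompletion G).Adj a b →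
      n j ∉ compIn G {a, b}ᶜ (n i) → ∃ (b : V) (D : Set V), a ≠ b ∧
      (cellCompletion G).Adj a b ∧ IsClosedAt G a b D ∧
      D.Nonempty ∧ ((D ∪ {a, b})ᶜ : Set V).Nonempty := by
    intro i j hi hj hadj hni
    exact ⟨b, _, hab, hadj, (hcomp i hi).2, (hcomp i hi).1.nonempty, n j,
      fun h => h.elim hni (hnab j hj)⟩
  by_cases hall : ∀ i, X i ≠ ∅
  · have hsep : ∀ i j, i ≠ j → Disjoint (X j) (compIn G {a, b}ᶜ (n i)) := by
      intro i j hij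
      rw [Set.disjoint_iff_inter_eq_empty]
      by_contra hne
      exact hK (isMinor_K4_of_three_routes hab (fun i => (hnX i (hall i)).1) hd haX hbX
        (fun i => ⟨n i, (hnX i (hall i)).2.2, han i⟩) (fun i => (hnX i (hall i)).2.1)
        (hcomp i (hall i)).1 (hcomp i (hall i)).2.1 (hcomp i (hall i)).2.2.1 hij
        (hsub i (hall i)) (Set.nonempty_iff_ne_empty.2 hne))
    refine hsplit 0 1 (hall 0) (hall 1) (cellCompletion_adj_iff.2 (Or.inr ⟨hab,
      fun i => compIn G {a, b}ᶜ (n i), fun i => (hcomp i (hall i)).1.nonempty, fun i j hij => ?_,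
      fun i => (hcomp i (hall i)).2⟩)) (Set.disjoint_left.1 (hsep 0 1 (by decide))
        (hnX 1 (hall 1)).2.2)
    refine Set.disjoint_left.2 fun x hx hx' => ?_
    have h1 := (conn_compIn (G := G) (hnab i (hall i))).union_of_mem
      (conn_compIn (G := G) (hnab j (hall j))) hx hx'
    have h2 := h1.subset_compIn (Set.union_subset (compIn_subset _ _) (compIn_subset _ _))
      (Or.inl (mem_compIn_self (hnab i (hall i))))
    exact Set.disjoint_left.1 (hsep i j hij) (hnX j (hall j)).2.2
      (h2 (Or.inr (mem_compIn_self (hnab j (hall j)))))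
  · push Not at hall
    obtain ⟨k, hk⟩ := hall
    have hbk : b = n k := by
      rcases hX k with ⟨-, h⟩ | ⟨h, -⟩
      · exact h
      · exact absurd hk h.nonempty.ne_empty
    have hoth : ∀ i, i ≠ k → X i ≠ ∅ := by
      intro i hik hi
      rcases hX i with ⟨-, h⟩ | ⟨h, -⟩
      · exact hik (hn ((show b = n i from h).symm.trans hbk))
      · exact absurd hi h.nonempty.ne_empty
    obtain ⟨i, j, hik, hjk, hij⟩ : ∃ i j : Fin 3, i ≠ k ∧ j ≠ k ∧ i ≠ j := by
      clear * -
      revert k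
      decide
    have hi := hoth i hik
    have hj := hoth j hjk
    have hadj : G.Adj a b := hbk ▸ han k
    refine hsplit i j hi hj (le_cellCompletion hadj) fun hmem => hK ?_
    have h1 := (conn_compIn (G := G) (hnab i hi)).union_of_mem (hnX j hj).1 hmem (hnX j hj).2.2
    exact isMinor_K4_of_two_routes hab h1
      (fun h => h.elim (fun h => compIn_subset _ _ h (Or.inl rfl)) (haX j))
      (fun h => h.elim (fun h => compIn_subset _ _ h (Or.inr rfl)) (hbX j))
      ((hsub i hi).trans Set.subset_union_left) Set.subset_union_right (hnX i hi).1 (hnX j hj).1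
      (hd i j hij) ⟨_, (hnX i hi).2.2, han i⟩ (hnX i hi).2.1 ⟨_, (hnX j hj).2.2, han j⟩
      (hnX j hj).2.1 (Or.inl hadj)

end CellCompletion

end

end SpaghettiTw

namespace SpaghettiTw

open SimpleGraph

noncomputable section

/-! ### The cell completion of a 2-connected graph without `K₄` minor is a tree of cycles -/

section Split

variable {V : Type u} {G : SimpleGraph V} {a b : V} {D : Set V}

theorem sup_edge_adj_iff (hab : a ≠ b) {x y : V} :
    (G ⊔ edge a b).Adj x y ↔ G.Adj x y ∨ (x = a ∧ y = b) ∨ (x = b ∧ y = a) := by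
  rw [sup_adj, edge_adj]
  constructor
  · rintro (h | ⟨h, -⟩)
    · exact Or.inl h
    · exact Or.inr h
  · rintro (h | h)
    · exact Or.inl h
    · refine Or.inr ⟨h, ?_⟩
      rcases h with ⟨rfl, rfl⟩ | ⟨rfl, rfl⟩
      · exact hab
      · exact hab.symm

theorem IsClosedAt.meetInEdge {T : SimpleGraph V} (hD : IsClosedAt T a b D) (hT : T.Adj a b) :
    MeetInEdge T (D ∪ {a, b}) ((D ∪ {a, b})ᶜ ∪ {a, b}) a b where
  adj := hT
  inter := by
    refine Set.Subset.antisymm ?_ fun x hx => ⟨Or.inr hx, Or.inr hx⟩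
    rintro x ⟨h, h' | h'⟩
    · exact absurd h h'
    · exact h'
  cross x hx y _ hxy := by
    rcases hx with hx | hx
    · exact Or.inl ((hD.2.2 x hx y hxy).imp_right id)
    · exact Or.inr (Or.inr hx)

theorem union_compl_union (D P : Set V) : (D ∪ P) ∪ ((D ∪ P)ᶜ ∪ P) = Set.univ := by
  rw [← Set.union_assoc, Set.union_compl_self, Set.univ_union]

theorem IsClosedAt.sup_edge (hab : a ≠ b) (hD : IsClosedAt G a b D) :
    IsClosedAt (G ⊔ edge a b) a b D := by
  refine ⟨hD.1, hD.2.1, fun x hx y hxy => ?_⟩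
  rcases (sup_edge_adj_iff hab).1 hxy with h | ⟨rfl, rfl⟩ | ⟨rfl, rfl⟩
  · exact hD.2.2 x hx y h
  · exact Or.inr (Or.inr rfl)
  · exact Or.inr (Or.inl rfl)

theorem IsTwoConnected.sup_edge_induce [Finite V] (hG : IsTwoConnected G) (hab : a ≠ b)
    (hD : IsClosedAt G a b D) (hne : D.Nonempty) :
    IsTwoConnected ((G ⊔ edge a b).induce (D ∪ {a, b})) := by
  have hT : (G ⊔ edge a b).Adj a b := (sup_edge_adj_iff hab).2 (Or.inr (Or.inl ⟨rfl, rfl⟩))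
  constructor
  · obtain ⟨d, hd⟩ := hne
    rw [Nat.card_coe_set_eq]
    have h1 : ({d, a, b} : Set V) ⊆ D ∪ {a, b} := by
      rintro x (rfl | hx)
      · exact Or.inl hd
      · exact Or.inr hx
    have h2 := Set.ncard_le_ncard h1 (Set.toFinite _)
    rw [Set.ncard_insert_of_notMem _ (Set.toFinite _), Set.ncard_pair hab] at h2
    · exact h2
    · rintro (rfl | rfl)
      · exact hD.1 hd
      · exact hD.2.1 hd
  · intro X hX
    change Conn _ _
    have hX' : (Subtype.val '' X).encard ≤ 1 := by
      rwa [Subtype.val_injective.encard_image]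
    have h1 : Conn (G ⊔ edge a b) (Subtype.val '' X)ᶜ := Conn.mono_graph (hG.2 _ hX') le_sup_left
    have h2 : ((Subtype.val '' X)ᶜ ∩ (D ∪ {a, b})).Nonempty := by
      by_cases ha : a ∈ Subtype.val '' X
      · refine ⟨b, fun hb => hab (Set.encard_le_one_iff.1 hX' a b ha hb), Or.inr (Or.inr rfl)⟩
      · exact ⟨a, ha, Or.inr (Or.inl rfl)⟩
    rw [conn_induce_iff]
    convert ((hD.sup_edge hab).meetInEdge hT).conn_inter (union_compl_union _ _) h1 h2 using 1
    ext x
    constructor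
    · rintro ⟨y, hy, rfl⟩
      exact ⟨fun ⟨z, hz, hzy⟩ => hy (Subtype.ext hzy ▸ hz), y.2⟩
    · rintro ⟨hx, hxS⟩
      exact ⟨⟨x, hxS⟩, fun h => hx ⟨_, h, rfl⟩, rfl⟩

theorem Conn.of_sup_edge (hab : a ≠ b) {R : Set V} (hR : Conn (G ⊔ edge a b) R) (ha : a ∉ R) :
    Conn G R := by
  refine conn_of_closed hR.nonempty fun U hU hne hcl => hR.eq_of_closed hU hne
    fun x hx y hy hxy => ?_
  rcases (sup_edge_adj_iff hab).1 hxy with h | ⟨rfl, rfl⟩ | ⟨rfl, rfl⟩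
  · exact hcl x hx y hy h
  · exact absurd (hU hx) ha
  · exact absurd hy ha

/-- Inside the union, `O` takes the place of the added edge `ab`. -/
theorem Conn.union_of_sup_edge (hab : a ≠ b) {R O : Set V} (hR : Conn (G ⊔ edge a b) R)
    (ha : a ∈ R) (hO : Conn G O) (haO : ∃ x ∈ O, G.Adj a x) (hbO : ∃ x ∈ O, G.Adj b x) :
    Conn G (R ∪ O) := by
  obtain ⟨s, hs, has⟩ := haO
  obtain ⟨t, ht, hbt⟩ := hbO
  refine conn_of_closed ⟨a, Or.inl ha⟩ fun U hU hne hcl => ?_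
  have h1 : (U ∩ O).Nonempty → O ⊆ U := by
    intro h
    have := hO.eq_of_closed (U := U ∩ O) Set.inter_subset_right h
      fun x hx y hy hxy => ⟨hcl x hx.1 y (Or.inr hy) hxy, hy⟩
    exact fun x hx => (this.symm.subset hx).1
  have h2 : (U ∩ O).Nonempty → a ∈ U := fun h => hcl s (h1 h hs) a (Or.inl ha) has.symm
  have h3 : a ∈ U → O ⊆ U := fun h => h1 ⟨s, hcl a h s (Or.inr hs) has, hs⟩
  have h4 : (U ∩ R).Nonempty := by
    obtain ⟨x, hx⟩ := hne
    rcases hU hx with h | h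
    · exact ⟨x, hx, h⟩
    · exact ⟨a, h2 ⟨x, hx, h⟩, ha⟩
  have h5 : U ∩ R = R := by
    refine hR.eq_of_closed Set.inter_subset_right h4 fun x hx y hy hxy => ⟨?_, hy⟩
    rcases (sup_edge_adj_iff hab).1 hxy with h | ⟨rfl, rfl⟩ | ⟨rfl, rfl⟩
    · exact hcl x hx.1 y (Or.inl hy) h
    · exact hcl t (h3 hx.1 ht) _ (Or.inl hy) hbt.symm
    · exact h2 ⟨t, hcl _ hx.1 t (Or.inr ht) hbt, ht⟩
  exact Set.Subset.antisymm hU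
    (Set.union_subset (fun x hx => (h5.symm.subset hx).1) (h3 (h5.symm.subset ha).1))

/-- A component `O` on the other side is adjacent to both `a` and `b`. Adding it to the branch set
containing `a` simulates the edge `ab`; if no branch set contains `a`, that edge is not used. -/
theorem IsTwoConnected.isMinor_of_sup_edge_induce (hG : IsTwoConnected G) (hab : a ≠ b)
    (hD : IsClosedAt G a b D) (hne : ((D ∪ {a, b})ᶜ : Set V).Nonempty)
    (hK : IsMinor K4 ((G ⊔ edge a b).induce (D ∪ {a, b}))) : IsMinor K4 G := by
  classical
  obtain ⟨z, hz⟩ := hne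
  have hO := hD.compl.compIn hz
  set O := compIn G (D ∪ {a, b})ᶜ z with hOdef
  have hOD : ∀ x ∈ O, x ∉ D ∪ {a, b} := fun x hx => compIn_subset _ _ hx
  have haO := hG.exists_adj_of_isComp hab hO.2 hO.1.nonempty
  have hbO := hG.exists_adj_of_isComp hab.symm hO.2.symm hO.1.nonempty
  obtain ⟨B, hB, hd, hadj⟩ := hK
  have hB' : ∀ i, Conn (G ⊔ edge a b) (Subtype.val '' B i) := fun i => conn_induce_iff.1 (hB i)
  have hd' : ∀ i j, i ≠ j → Disjoint (Subtype.val '' B i) (Subtype.val '' B j) := fun i j hij =>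
    (Set.disjoint_image_iff Subtype.val_injective).2 (hd i j hij)
  have hBO : ∀ i, Disjoint (Subtype.val '' B i) O := by
    intro i
    refine Set.disjoint_left.2 ?_
    rintro _ ⟨x, -, rfl⟩ hx
    exact hOD _ hx x.2
  refine ⟨fun i => Subtype.val '' B i ∪ if a ∈ Subtype.val '' B i then O else ∅, fun i => ?_,
    fun i j hij => ?_, fun i j hij => ?_⟩
  · change Conn G (_ ∪ if _ then _ else _)
    split_ifs with h
    · exact (hB' i).union_of_sup_edge hab h hO.1 haO hbO
    · rw [Set.union_empty]
      exact (hB' i).of_sup_edge hab h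
  · beta_reduce
    split_ifs with h h' h'
    · exact absurd h' (Set.disjoint_left.1 (hd' i j hij) h)
    all_goals
      simp only [Set.union_empty, Set.disjoint_union_left, Set.disjoint_union_right]
      simp [hd' i j hij, hBO, (hBO _).symm]
  · obtain ⟨x, hx, y, hy, hxy⟩ := hadj i j hij
    rcases (sup_edge_adj_iff hab).1 hxy with h | ⟨h1, h2⟩ | ⟨h1, h2⟩
    · exact ⟨x.1, Or.inl ⟨x, hx, rfl⟩, y.1, Or.inl ⟨y, hy, rfl⟩, h⟩
    · obtain ⟨t, ht, hbt⟩ := hbO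
      have ha : a ∈ Subtype.val '' B i := ⟨x, hx, h1⟩
      have h2' : y.1 = b := h2
      refine ⟨t, ?_, y.1, Or.inl ⟨y, hy, rfl⟩, h2'.symm ▸ hbt.symm⟩
      simp only [ha, if_true]
      exact Or.inr ht
    · obtain ⟨t, ht, hbt⟩ := hbO
      have ha : a ∈ Subtype.val '' B j := ⟨y, hy, h2⟩
      have h1' : x.1 = b := h1
      refine ⟨x.1, Or.inl ⟨x, hx, rfl⟩, t, ?_, h1'.symm ▸ hbt⟩
      simp only [ha, if_true]
      exact Or.inr ht

/-- The added edge stands for the removed side: three sets separated by `x, y` in one graph are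
extended or restricted to three such sets in the other. -/
theorem IsTwoConnected.cellCompletion_sup_edge_induce [Finite V] (hG : IsTwoConnected G)
    (hab : a ≠ b) (hadj : (cellCompletion G).Adj a b) (hD : IsClosedAt G a b D)
    (hne : ((D ∪ {a, b})ᶜ : Set V).Nonempty) :
    cellCompletion ((G ⊔ edge a b).induce (D ∪ {a, b})) =
      (cellCompletion G).induce (D ∪ {a, b}) := by
  have hO := hD.compl
  set S := D ∪ {a, b} with hS
  ext x y
  rw [cellCompletion_adj_iff]
  change _ ↔ (cellCompletion G).Adj x.1 y.1
  by_cases hxy : (x.1 = a ∧ y.1 = b) ∨ (x.1 = b ∧ y.1 = a)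
  · refine iff_of_true (Or.inl ((sup_edge_adj_iff hab).2 (Or.inr hxy))) ?_
    rcases hxy with ⟨h1, h2⟩ | ⟨h1, h2⟩
    · rwa [h1, h2]
    · rw [h1, h2]
      exact hadj.symm
  rw [cellCompletion_adj_iff]
  have hadj' : ((G ⊔ edge a b).induce S).Adj x y ↔ G.Adj x y :=
    (sup_edge_adj_iff hab).trans (or_iff_left hxy)
  rw [hadj']
  by_cases hxy' : x.1 = y.1
  · obtain rfl := Subtype.ext hxy'
    simp
  refine or_congr Iff.rfl (and_congr ⟨fun h h' => h (Subtype.ext h'), fun h h' => h (h' ▸ rfl)⟩ ?_)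
  constructor
  · rintro ⟨X, hXne, hXd, hX⟩
    -- The removed side is added to the set containing `a` or `b`. The edge `ab` prevents these from
    -- lying in two different sets.
    refine ⟨fun i => Subtype.val '' X i ∪ {z | z ∉ S ∧ (a ∈ Subtype.val '' X i ∨
      b ∈ Subtype.val '' X i)}, fun i => ((hXne i).image _).mono Set.subset_union_left,
      fun i j hij => ?_, fun i => ?_⟩
    · have hd : Disjoint (Subtype.val '' X i) (Subtype.val '' X j) :=
        (Set.disjoint_image_iff Subtype.val_injective).2 (hXd i j hij)
      refine Set.disjoint_left.2 ?_
      rintro z (hz | ⟨hz, hzi⟩) (hz' | ⟨hz', hzj⟩)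
      · exact Set.disjoint_left.1 hd hz hz'
      · obtain ⟨w, -, rfl⟩ := hz
        exact hz' w.2
      · obtain ⟨w, -, rfl⟩ := hz'
        exact hz w.2
      · have key : ∀ c c' : V, (c = a ∧ c' = b ∨ c = b ∧ c' = a) → c ∈ Subtype.val '' X i →
            c' ∈ Subtype.val '' X j → False := by
          rintro _ _ hcc ⟨c, hc, rfl⟩ ⟨c', hc', rfl⟩
          rcases (hX i).2.2 c hc c' ((sup_edge_adj_iff hab).2 (Or.inr hcc)) with h | h | h
          · exact Set.disjoint_left.1 (hXd i j hij) h hc'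
          · exact (hX j).1 (h ▸ hc')
          · exact (hX j).2.1 (h ▸ hc')
        rcases hzi with hzi | hzi <;> rcases hzj with hzj | hzj
        · exact Set.disjoint_left.1 hd hzi hzj
        · exact key a b (Or.inl ⟨rfl, rfl⟩) hzi hzj
        · exact key b a (Or.inr ⟨rfl, rfl⟩) hzi hzj
        · exact Set.disjoint_left.1 hd hzi hzj
    · refine ⟨?_, ?_, ?_⟩
      · rintro (⟨z, hz, hzx⟩ | ⟨h, -⟩)
        · exact (hX i).1 (Subtype.ext hzx ▸ hz)
        · exact h x.2
      · rintro (⟨z, hz, hzx⟩ | ⟨h, -⟩)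
        · exact (hX i).2.1 (Subtype.ext hzx ▸ hz)
        · exact h y.2
      · have hnb : ∀ c : S, c ∈ X i → ∀ w : S, (G ⊔ edge a b).Adj c.1 w.1 →
            w.1 ∈ Subtype.val '' X i ∨ w.1 = x.1 ∨ w.1 = y.1 := by
          intro c hc w hcw
          rcases (hX i).2.2 c hc w hcw with h | rfl | rfl
          · exact Or.inl ⟨w, h, rfl⟩
          · exact Or.inr (Or.inl rfl)
          · exact Or.inr (Or.inr rfl)
        rintro _ (⟨z, hz, rfl⟩ | ⟨hz, hzi⟩) w hzw
        · by_cases hw : w ∈ S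
          · exact (hnb z hz ⟨w, hw⟩ ((sup_edge_adj_iff hab).2 (Or.inl hzw))).imp_left Or.inl
          · refine Or.inl (Or.inr ⟨hw, ?_⟩)
            rcases z.2 with hzD | hzab
            · exact absurd ((hD.2.2 _ hzD w hzw).imp_right id) hw
            · rcases hzab with h | h
              · exact Or.inl ⟨z, hz, h⟩
              · exact Or.inr ⟨z, hz, h⟩
        · rcases hO.2.2 _ hz w hzw with hw | hw
          · exact Or.inl (Or.inr ⟨hw, hzi⟩)
          · have hwS : w ∈ S := Or.inr hw
            have hpass : ∀ c c' : V, (c = a ∧ c' = b ∨ c = b ∧ c' = a) →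
                c ∈ Subtype.val '' X i → ∀ hc' : c' ∈ S,
                c' ∈ Subtype.val '' X i ∨ c' = x.1 ∨ c' = y.1 := by
              rintro _ c' hcc ⟨c, hc, rfl⟩ hc'
              exact hnb c hc ⟨c', hc'⟩ ((sup_edge_adj_iff hab).2 (Or.inr hcc))
            have : w ∈ Subtype.val '' X i ∨ w = x.1 ∨ w = y.1 := by
              rcases hw with rfl | rfl <;> rcases hzi with h | h
              · exact Or.inl h
              · exact hpass _ _ (Or.inr ⟨rfl, rfl⟩) h hwS
              · exact hpass _ _ (Or.inl ⟨rfl, rfl⟩) h hwS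
              · exact Or.inl h
            exact this.imp_left Or.inl
  · rintro ⟨X, hXne, hXd, hX⟩
    obtain ⟨z, hz⟩ := hne
    have hOc := hO.compIn hz
    have hOs := compIn_subset (G := G) Sᶜ z
    set O := compIn G Sᶜ z
    -- Neither `x` nor `y` lies in `O`, so a set with a vertex adjacent to `O` contains `O`; hence
    -- closedness also respects the added edge.
    have hmeet : ∀ i c, c ∈ X i → (∃ o ∈ O, G.Adj c o) → O ⊆ X i := by
      rintro i c hc ⟨o, ho, hco⟩
      have hoX : o ∈ X i := by
        rcases (hX i).2.2 c hc o hco with h | h | h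
        · exact h
        · exact absurd x.2 (h ▸ hOs ho)
        · exact absurd y.2 (h ▸ hOs ho)
      have := hOc.1.eq_of_closed (U := O ∩ X i) Set.inter_subset_left ⟨o, ho, hoX⟩
        fun s hs t ht hst => ⟨ht, by
          rcases (hX i).2.2 s hs.2 t hst with h | h | h
          · exact h
          · exact absurd x.2 (h ▸ hOs ht)
          · exact absurd y.2 (h ▸ hOs ht)⟩
      exact fun s hs => (this.symm.subset hs).2
    have hpass : ∀ i c c', c ∈ X i → (∃ o ∈ O, G.Adj c o) → (∃ o ∈ O, G.Adj c' o) →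
        c' ∈ X i ∨ c' = x.1 ∨ c' = y.1 := by
      rintro i c c' hc hco ⟨o, ho, hco'⟩
      exact (hX i).2.2 o (hmeet i c hc hco ho) c' hco'.symm
    have haO := hG.exists_adj_of_isComp hab hOc.2 hOc.1.nonempty
    have hbO := hG.exists_adj_of_isComp hab.symm hOc.2.symm hOc.1.nonempty
    refine ⟨fun i => Subtype.val ⁻¹' X i, fun i => ?_, fun i j hij => (hXd i j hij).preimage _,
      fun i => ⟨(hX i).1, (hX i).2.1, ?_⟩⟩
    · by_contra hemp
      -- A set lying entirely on the removed side is adjacent only to `a` and `b`, which would force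
      -- `{x, y} = {a, b}`, already excluded.
      have hXO : ∀ w ∈ X i, w ∉ S := fun w hw hwS => hemp ⟨⟨w, hwS⟩, hw⟩
      have hend : ∀ c : S, (∃ w ∈ X i, G.Adj c w) → c.1 = a ∨ c.1 = b := by
        rintro c ⟨w, hw, hcw⟩
        rcases hO.2.2 w (hXO w hw) c hcw.symm with h | h
        · exact absurd c.2 h
        · exact h
      have h1 := hend x (hG.exists_adj_of_isComp hxy' (hX i) (hXne i))
      have h2 := hend y (hG.exists_adj_of_isComp (Ne.symm hxy') (hX i).symm (hXne i))
      rcases h1 with h1 | h1 <;> rcases h2 with h2 | h2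
      · exact hxy' (h1.trans h2.symm)
      · exact hxy (Or.inl ⟨h1, h2⟩)
      · exact hxy (Or.inr ⟨h1, h2⟩)
      · exact hxy' (h1.trans h2.symm)
    · intro c hc w hcw
      have : w.1 ∈ X i ∨ w.1 = x.1 ∨ w.1 = y.1 := by
        rcases (sup_edge_adj_iff hab).1 hcw with h | ⟨h1, h2⟩ | ⟨h1, h2⟩
        · exact (hX i).2.2 c.1 hc w.1 h
        · have h1' : c.1 = a := h1
          have h2' : w.1 = b := h2
          exact hpass i c.1 w.1 hc (h1'.symm ▸ haO) (h2'.symm ▸ hbO)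
        · have h1' : c.1 = b := h1
          have h2' : w.1 = a := h2
          exact hpass i c.1 w.1 hc (h1'.symm ▸ hbO) (h2'.symm ▸ haO)
      exact this.imp_right fun h => h.imp Subtype.ext Subtype.ext

/-- No edge of the cell completion crosses a pair of vertices that separates its ends. -/
theorem IsTwoConnected.isClosedAt_cellCompletion [Finite V] (hG : IsTwoConnected G)
    (hD : IsClosedAt G a b D) : IsClosedAt (cellCompletion G) a b D := by
  refine ⟨hD.1, hD.2.1, fun x hx y hxy => ?_⟩
  rcases cellCompletion_adj_iff.1 hxy with h | ⟨hne, X, hXne, hXd, hX⟩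
  · exact hD.2.2 x hx y h
  by_contra hy
  push Not at hy
  -- Of three disjoint sets, one avoids both `a` and `b`. Its part in `D` contains a neighbour of
  -- `x` and is bounded by `x, y` only, so `y` has a neighbour in `D` too, which is impossible.
  obtain ⟨i, hai, hbi⟩ : ∃ i, a ∉ X i ∧ b ∉ X i := by
    by_contra! hcon
    have h1 : ∀ i j, i ≠ j → a ∈ X i → a ∉ X j := fun i j hij h =>
      Set.disjoint_left.1 (hXd i j hij) h
    have h2 : ∀ i j, i ≠ j → b ∈ X i → b ∉ X j := fun i j hij h =>
      Set.disjoint_left.1 (hXd i j hij) h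
    have h01 := h1 0 1 (by decide)
    have h02 := h1 0 2 (by decide)
    have h12 := h1 1 2 (by decide)
    have g01 := h2 0 1 (by decide)
    have g02 := h2 0 2 (by decide)
    have g12 := h2 1 2 (by decide)
    have c0 := hcon 0
    have c1 := hcon 1
    have c2 := hcon 2
    tauto
  obtain ⟨e, he, hxe⟩ := hG.exists_adj_of_isComp hne (hX i) (hXne i)
  have heD : e ∈ D := by
    rcases hD.2.2 x hx e hxe with h | rfl | rfl
    · exact h
    · exact absurd he hai
    · exact absurd he hbi
  have hcl : IsClosedAt G y x (X i ∩ D) := by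
    refine ⟨fun h => (hX i).2.1 h.1, fun h => (hX i).1 h.1, fun z hz w hzw => ?_⟩
    rcases (hX i).2.2 z hz.1 w hzw with h | h | h
    · rcases hD.2.2 z hz.2 w hzw with h' | rfl | rfl
      · exact Or.inl ⟨h, h'⟩
      · exact absurd h hai
      · exact absurd h hbi
    · exact Or.inr (Or.inr h)
    · exact Or.inr (Or.inl h)
  obtain ⟨f, hf, hyf⟩ := hG.exists_adj_of_isComp hne.symm hcl ⟨e, he, heD⟩
  rcases hD.2.2 f hf.2 y hyf.symm with h | h | h
  · exact hy.1 h
  · exact hy.2.1 h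
  · exact hy.2.2 h

/-- Induction on the number of vertices. Without a vertex of degree three the graph is a cycle.
Otherwise it splits at an edge `ab` of the completion; both sides with `ab` added are smaller,
2-connected and free of `K4` minors, and their completions are glued along `ab`. -/
theorem IsTwoConnected.isTreeOfCycles_cellCompletion [Finite V] (hG : IsTwoConnected G)
    (hK : ¬ IsMinor K4 G) : IsTreeOfCycles (cellCompletion G) := by
  induction hn : Nat.card V using Nat.strong_induction_on generalizing V with
  | _ n ih =>
  by_cases hdeg : ∀ x u v w, G.Adj x u → G.Adj x v → G.Adj x w → u = v ∨ u = w ∨ v = w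
  · rw [hG.cellCompletion_eq_self hdeg]
    exact .cycle _ (hG.isCycleGraph hdeg)
  push Not at hdeg
  obtain ⟨a, u, v, w, hu, hv, hw, huv, huw, hvw⟩ := hdeg
  obtain ⟨b, D, hab, hadj, hD, hDne, hOne⟩ := hG.exists_split hK (a := a) (n := ![u, v, w])
    (by
      intro i j hij
      fin_cases i <;> fin_cases j <;> simp_all)
    (by
      intro i
      fin_cases i <;> assumption)
  have key : ∀ {D : Set V}, IsClosedAt G a b D → D.Nonempty →
      ((D ∪ {a, b})ᶜ : Set V).Nonempty →
      IsTreeOfCycles ((cellCompletion G).induce (D ∪ {a, b})) := by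
    intro D hD hDne hOne
    rw [← hG.cellCompletion_sup_edge_induce hab hadj hD hOne]
    refine ih _ ?_ (hG.sup_edge_induce hab hD hDne)
      (fun h => hK (hG.isMinor_of_sup_edge_induce hab hD hOne h)) rfl
    rw [← hn, Nat.card_coe_set_eq, ← Set.ncard_univ]
    obtain ⟨z, hz⟩ := hOne
    exact Set.ncard_lt_ncard ⟨Set.subset_univ _, fun h => hz (h (Set.mem_univ z))⟩
  have h1 := (key hD hDne hOne).glue_trees (key hD.compl hOne ?_)
    ((hG.isClosedAt_cellCompletion hD).meetInEdge hadj)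
  · rw [union_compl_union] at h1
    exact h1.iso (induceUnivIso _)
  · obtain ⟨d, hd⟩ := hDne
    refine ⟨d, fun h => ?_⟩
    rcases h with h | rfl | rfl
    · exact h (Or.inl hd)
    · exact hD.1 hd
    · exact hD.2.1 hd

end Split

end

end SpaghettiTw

namespace SpaghettiTw

open SimpleGraph

noncomputable section

/-! ### `D₃` minors and chain trees of cycles -/

section Chain

variable {V : Type u} {G : SimpleGraph V} {a b : V}

theorem isMinor_D3 (hab : a ≠ b) {S T : Fin 3 → Set V} (hS : ∀ i, Conn G (S i))
    (hT : ∀ i, Conn G (T i)) (hSS : ∀ i j, i ≠ j → Disjoint (S i) (S j))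
    (hTT : ∀ i j, i ≠ j → Disjoint (T i) (T j)) (hST : ∀ i j, Disjoint (S i) (T j))
    (haS : ∀ i, a ∉ S i) (haT : ∀ i, a ∉ T i) (hbS : ∀ i, b ∉ S i) (hbT : ∀ i, b ∉ T i)
    (ha : ∀ i, ∃ x ∈ S i, G.Adj a x) (hb : ∀ i, ∃ x ∈ T i, G.Adj b x)
    (hST' : ∀ i, ∃ x ∈ S i, ∃ y ∈ T i, G.Adj x y) : IsMinor D3 G := by
  have haS' : ∀ i, Disjoint {a} (S i) := fun i => Set.disjoint_singleton_left.2 (haS i)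
  have haT' : ∀ i, Disjoint {a} (T i) := fun i => Set.disjoint_singleton_left.2 (haT i)
  have hbS' : ∀ i, Disjoint {b} (S i) := fun i => Set.disjoint_singleton_left.2 (hbS i)
  have hbT' : ∀ i, Disjoint {b} (T i) := fun i => Set.disjoint_singleton_left.2 (hbT i)
  have hab' : Disjoint ({a} : Set V) {b} := by simpa using hab
  have ha' : ∀ i, ∃ x ∈ ({a} : Set V), ∃ y ∈ S i, G.Adj x y := fun i =>
    let ⟨x, hx, h⟩ := ha i; ⟨a, rfl, x, hx, h⟩
  have hb' : ∀ i, ∃ x ∈ T i, ∃ y ∈ ({b} : Set V), G.Adj x y := fun i =>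
    let ⟨x, hx, h⟩ := hb i; ⟨x, hx, b, rfl, h.symm⟩
  have flip : ∀ {S T : Set V}, (∃ x ∈ S, ∃ y ∈ T, G.Adj x y) → ∃ x ∈ T, ∃ y ∈ S, G.Adj x y :=
    fun ⟨x, hx, y, hy, h⟩ => ⟨y, hy, x, hx, h.symm⟩
  have hT1 : ∀ i : Fin 3, i = 0 ∨ i = 1 ∨ i = 2 := by decide
  refine ⟨![{a}, {b}, S 0, T 0, S 1, T 1, S 2, T 2], fun i => ?_, fun i j hij => ?_,
    fun i j hij => ?_⟩
  · fin_cases i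
    · exact conn_singleton a
    · exact conn_singleton b
    all_goals first | exact hS _ | exact hT _
  · wlog hlt : i < j generalizing i j
    · exact (this j i hij.symm (lt_of_le_of_ne (not_lt.1 hlt) hij.symm)).symm
    fin_cases i <;> fin_cases j <;> first
      | exact absurd hlt (by decide)
      | exact hab'
      | exact haS' _
      | exact haT' _
      | exact hbS' _
      | exact hbT' _
      | exact hST _ _
      | exact (hST _ _).symm
      | exact hSS _ _ (by decide)
      | exact hTT _ _ (by decide)
  · simp only [D3, fromEdgeSet_adj, Set.mem_insert_iff, Set.mem_singleton_iff, Sym2.eq_iff] at hij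
    obtain ⟨h, -⟩ := hij
    rcases h with (⟨rfl, rfl⟩ | ⟨rfl, rfl⟩) | (⟨rfl, rfl⟩ | ⟨rfl, rfl⟩) |
      (⟨rfl, rfl⟩ | ⟨rfl, rfl⟩) | (⟨rfl, rfl⟩ | ⟨rfl, rfl⟩) | (⟨rfl, rfl⟩ | ⟨rfl, rfl⟩) |
      (⟨rfl, rfl⟩ | ⟨rfl, rfl⟩) | (⟨rfl, rfl⟩ | ⟨rfl, rfl⟩) | (⟨rfl, rfl⟩ | ⟨rfl, rfl⟩) |
      (⟨rfl, rfl⟩ | ⟨rfl, rfl⟩)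
    · exact ha' 0
    · exact flip (ha' 0)
    · exact hST' 0
    · exact flip (hST' 0)
    · exact hb' 0
    · exact flip (hb' 0)
    · exact ha' 1
    · exact flip (ha' 1)
    · exact hST' 1
    · exact flip (hST' 1)
    · exact hb' 1
    · exact flip (hb' 1)
    · exact ha' 2
    · exact flip (ha' 2)
    · exact hST' 2
    · exact flip (hST' 2)
    · exact hb' 2
    · exact flip (hb' 2)

/-- A component with at least two vertices left by deleting `a` and `b` contains two adjacent
disjoint connected sets, the first adjacent to `a` and the second to `b`. -/
theorem IsTwoConnected.exists_two_step (hG : IsTwoConnected G) (hab : a ≠ b) {D : Set V}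
    (hD : IsComp G a b D) (hlarge : ¬ D.Subsingleton) :
    ∃ S T, S ⊆ D ∧ T ⊆ D ∧ Conn G S ∧ Conn G T ∧ Disjoint S T ∧ (∃ x ∈ S, G.Adj a x) ∧
      (∃ x ∈ T, G.Adj b x) ∧ ∃ x ∈ S, ∃ y ∈ T, G.Adj x y := by
  obtain ⟨y, hy, z, hz, hyz, hay, hbz⟩ : ∃ y ∈ D, ∃ z ∈ D, y ≠ z ∧ G.Adj a y ∧ G.Adj b z := by
    obtain ⟨y, hy, hay⟩ := hG.exists_adj_of_isComp hab hD.2 hD.1.nonempty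
    obtain ⟨z, hz, hbz⟩ := hG.exists_adj_of_isComp hab.symm hD.2.symm hD.1.nonempty
    by_cases hyz : y = z
    · subst hyz
      obtain ⟨w, hw, hwy⟩ : ∃ w ∈ D, w ≠ y := by
        by_contra! hcon
        exact hlarge fun s hs t ht => (hcon s hs).trans (hcon t ht).symm
      by_cases hcl : ∃ e ∈ D \ {y}, G.Adj b e
      · obtain ⟨e, he, hbe⟩ := hcl
        exact ⟨y, hy, e, he.1, fun h => he.2 h.symm, hay, hbe⟩
      · push Not at hcl
        -- Here `b` has no neighbour in `D \ {y}`, so this set is bounded by `a` and `y` alone and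
        -- `a` must have a neighbour in it.
        obtain ⟨e, he, hae⟩ := hG.exists_adj (E := D \ {y}) (x := a) (y := y)
          (fun h => hD.2.1 (h ▸ hy)) ⟨w, hw, hwy⟩ (fun h => hD.2.1 h.1) (fun h => h.2 rfl) (by
            intro e he z hez
            rcases hD.2.2.2 e he.1 z hez with h | h | rfl
            · by_cases hzy : z = y
              · exact Or.inr (Or.inr hzy)
              · exact Or.inl ⟨h, hzy⟩
            · exact Or.inr (Or.inl h)
            · exact absurd hez.symm (hcl e he))
        exact ⟨e, he.1, y, hy, he.2, hae, hbz⟩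
    · exact ⟨y, hy, z, hz, hyz, hay, hbz⟩
  have hyD : y ∈ D \ {z} := ⟨hy, hyz⟩
  have hs := compIn_subset (G := G) (D \ {z}) y
  refine ⟨compIn G (D \ {z}) y, {z}, hs.trans Set.sdiff_subset, Set.singleton_subset_iff.2 hz,
    conn_compIn hyD, conn_singleton z, ?_, ⟨y, mem_compIn_self hyD, hay⟩, ⟨z, rfl, hbz⟩, ?_⟩
  · exact Set.disjoint_singleton_right.2 fun h => (hs h).2 rfl
  · obtain ⟨x, hx, w, hw, hwS, hxw⟩ := hD.1.exists_adj (hs.trans Set.sdiff_subset)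
      ⟨y, mem_compIn_self hyD⟩ (fun h => (hs (h.symm.subset hz)).2 rfl)
    refine ⟨x, hx, w, ?_, hxw⟩
    by_contra hwz
    exact hwS (compIn_closed hx ⟨hw, hwz⟩ hxw)

theorem IsTwoConnected.noThreeLarge (hG : IsTwoConnected G) (h3 : ¬ IsMinor D3 G) :
    NoThreeLarge G := by
  intro a b hab X Y Z hX hY hZ hXY hXZ hYZ
  by_contra! hcon
  obtain ⟨hXl, hYl, hZl⟩ := hcon
  have hD : ∀ i, IsComp G a b (![X, Y, Z] i) := by
    intro i
    fin_cases i <;> assumption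
  have hd : ∀ i j, i ≠ j → Disjoint (![X, Y, Z] i) (![X, Y, Z] j) := by
    intro i j hij
    fin_cases i <;> fin_cases j <;> first
      | exact absurd rfl hij
      | assumption
      | exact Disjoint.symm (by assumption)
  have hl : ∀ i, ¬ (![X, Y, Z] i).Subsingleton := by
    intro i
    fin_cases i
    · exact Set.not_subsingleton_iff.2 hXl
    · exact Set.not_subsingleton_iff.2 hYl
    · exact Set.not_subsingleton_iff.2 hZl
  choose S T hS hT hSc hTc hST ha hb hST' using fun i => hG.exists_two_step hab (hD i) (hl i)
  refine h3 (isMinor_D3 hab hSc hTc (fun i j hij => (hd i j hij).mono (hS i) (hS j))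
    (fun i j hij => (hd i j hij).mono (hT i) (hT j)) (fun i j => ?_)
    (fun i h => (hD i).2.1 (hS i h)) (fun i h => (hD i).2.1 (hT i h))
    (fun i h => (hD i).2.2.1 (hS i h)) (fun i h => (hD i).2.2.1 (hT i h)) ha hb hST')
  by_cases hij : i = j
  · exact hij ▸ hST i
  · exact (hd i j hij).mono (hS i) (hT j)

theorem isChordlessCycle_iff {K : G.Subgraph} :
    IsChordlessCycle K ↔ K.IsInduced ∧ IsCycleSet G K.verts := by
  have key : K.IsInduced → K.coe = G.induce K.verts := by
    intro hK
    ext x y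
    exact ⟨fun h => h.adj_sub, fun h => hK x.2 y.2 h⟩
  constructor
  · rintro ⟨h1, h2⟩
    refine ⟨h2, ?_⟩
    rw [IsCycleSet, ← key h2]
    exact h1
  · rintro ⟨h1, h2⟩
    refine ⟨?_, h1⟩
    rw [key h1]
    exact h2

theorem IsChordlessCycle.eq_of_verts {K L : G.Subgraph} (hK : IsChordlessCycle K)
    (hL : IsChordlessCycle L) (h : K.verts = L.verts) : K = L := by
  refine Subgraph.ext h ?_
  ext x y
  constructor
  · exact fun h' => hL.2 (h ▸ K.edge_vert h') (h ▸ K.edge_vert h'.symm) h'.adj_sub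
  · exact fun h' => hK.2 (h ▸ L.edge_vert h') (h ▸ L.edge_vert h'.symm) h'.adj_sub

theorem IsCycleSet.isChordlessCycle {C : Set V} (hC : IsCycleSet G C) :
    IsChordlessCycle ((⊤ : G.Subgraph).induce C) := by
  refine isChordlessCycle_iff.2 ⟨fun x hx y hy hxy => ?_, hC⟩
  exact ⟨hx, hy, hxy⟩

/-- Apart from `a` and `b`, a chordless cycle through `ab` lies in one component of `G - {a, b}`; a
one-vertex component makes it a simplicial triangle. Different cycles use different components by
`IsTreeOfCycles.cycleSet_unique`, so three cycles violating the chain condition give three large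
components. -/
theorem IsTwoConnected.isChainTreeOfCycles [Finite V] (hG : IsTwoConnected G)
    (hK : ¬ IsMinor K4 G) (h3 : NoThreeLarge G) : IsChainTreeOfCycles (cellCompletion G) := by
  have hT := hG.isTreeOfCycles_cellCompletion hK
  refine ⟨hT, fun e he m hm hm3 => ?_⟩
  induction e with
  | _ a b =>
  have hab : (cellCompletion G).Adj a b := he
  set 𝒞 := {C : (cellCompletion G).Subgraph | IsChordlessCycle C ∧ s(a, b) ∈ C.edgeSet}
  set 𝒮 := {C : (cellCompletion G).Subgraph | IsChordlessCycle C ∧ s(a, b) ∈ C.edgeSet ∧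
    IsSimplicialTriangle C} with h𝒮
  have hsub : 𝒮 ⊆ 𝒞 := fun C hC => ⟨hC.1, hC.2.1⟩
  by_contra hlt
  have h1 : 2 < (𝒞 \ 𝒮).ncard := by
    have := Set.ncard_sdiff_add_ncard_of_subset hsub
    omega
  obtain ⟨K₀, hK₀, K₁, hK₁, K₂, hK₂, h01, h02, h12⟩ := (Set.two_lt_ncard).1 h1
  have main : ∀ K ∈ 𝒞 \ 𝒮, a ∈ K.verts ∧ b ∈ K.verts ∧ IsCycleSet (cellCompletion G) K.verts ∧
      ∃ E, IsComp G a b E ∧ (E ∩ K.verts).Nonempty ∧ ¬ E.Subsingleton := by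
    rintro K ⟨⟨hKc, hKe⟩, hKs⟩
    have hKab : K.Adj a b := hKe
    have ha := K.edge_vert hKab
    have hb := K.edge_vert hKab.symm
    have hC := (isChordlessCycle_iff.1 hKc).2
    refine ⟨ha, hb, hC, ?_⟩
    have hconn := hC.conn_diff ha hb hab
    obtain ⟨x, hx⟩ := hconn.nonempty
    have hE := (isClosedAt_compl G a b).compIn hx.2
    refine ⟨_, hE, ⟨x, mem_compIn_self hx.2, hx.1⟩, fun hss => hKs ⟨hKc, hKe, ?_⟩⟩
    set E := compIn G {a, b}ᶜ x
    have hET := hG.isClosedAt_cellCompletion hE.2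
    have hxE : x ∈ E := mem_compIn_self hx.2
    have hsubE : K.verts \ {a, b} ⊆ E := by
      have := hconn.eq_of_closed (U := E ∩ (K.verts \ {a, b})) Set.inter_subset_right ⟨x, hxE, hx⟩
        fun s hs t ht hst => ⟨(hET.2.2 s hs.1 t hst).resolve_right ht.2, ht⟩
      exact fun s hs => (this.symm.subset hs).1
    refine ⟨?_, x, hx.1, ?_⟩
    · obtain ⟨n, hn, ⟨f⟩⟩ := hKc.1
      have h2 : n = K.verts.ncard := by
        rw [← Nat.card_coe_set_eq, ← Nat.card_congr f.toEquiv, Nat.card_fin]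
      have h4 : K.verts ⊆ {x, a, b} := by
        intro y hy
        by_cases hyab : y ∈ ({a, b} : Set V)
        · exact Or.inr hyab
        · exact Or.inl (hss (hsubE ⟨hy, hyab⟩) hxE)
      have h5 := Set.ncard_le_ncard h4 (Set.toFinite _)
      have h6 := Set.ncard_insert_le x {a, b}
      rw [Set.ncard_pair hab.ne] at h6
      obtain rfl : n = 3 := by omega
      exact ⟨f⟩
    · have hnb : ∀ y, (cellCompletion G).Adj x y → y = a ∨ y = b := by
        intro y hxy
        exact (hET.2.2 x hxE y hxy).resolve_left fun hy => hxy.ne (hss hxE hy)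
      intro y hy z hz hyz
      rcases hnb y hy with rfl | rfl <;> rcases hnb z hz with rfl | rfl
      · exact absurd rfl hyz
      · exact hab
      · exact hab.symm
      · exact absurd rfl hyz
  have hdisj : ∀ K ∈ 𝒞 \ 𝒮, ∀ L ∈ 𝒞 \ 𝒮, K ≠ L → ∀ E F, IsComp G a b E → IsComp G a b F →
      (E ∩ K.verts).Nonempty → (F ∩ L.verts).Nonempty → Disjoint E F := by
    intro K hK L hL hKL E F hE hF hEK hFL
    obtain ⟨haK, hbK, hKC, -⟩ := main K hK
    obtain ⟨haL, hbL, hLC, -⟩ := main L hL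
    refine Set.disjoint_left.2 fun x hxE hxF => hKL (hK.1.1.eq_of_verts hL.1.1 ?_)
    refine hT.cycleSet_unique hKC hLC haK hbK haL hbL hab.ne
      ((hE.1.union_of_mem hF.1 hxE hxF).mono_graph le_cellCompletion) ?_ ?_
      (hEK.mono (Set.inter_subset_inter_left _ Set.subset_union_left))
      (hFL.mono (Set.inter_subset_inter_left _ Set.subset_union_right))
    · exact fun h => h.elim hE.2.1 hF.2.1
    · exact fun h => h.elim hE.2.2.1 hF.2.2.1
  obtain ⟨-, -, -, E₀, hE₀, hm₀, hl₀⟩ := main K₀ hK₀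
  obtain ⟨-, -, -, E₁, hE₁, hm₁, hl₁⟩ := main K₁ hK₁
  obtain ⟨-, -, -, E₂, hE₂, hm₂, hl₂⟩ := main K₂ hK₂
  rcases h3 a b hab.ne E₀ E₁ E₂ hE₀ hE₁ hE₂
    (hdisj K₀ hK₀ K₁ hK₁ h01 E₀ E₁ hE₀ hE₁ hm₀ hm₁)
    (hdisj K₀ hK₀ K₂ hK₂ h02 E₀ E₂ hE₀ hE₂ hm₀ hm₂)
    (hdisj K₁ hK₁ K₂ hK₂ h12 E₁ E₂ hE₁ hE₂ hm₁ hm₂) with h | h | h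
  · exact hl₀ h
  · exact hl₁ h
  · exact hl₂ h

/-- Three large components make `ab` an edge of the completion, and each contains the rest of a
chordless cycle through `ab` without simplicial vertices. -/
theorem IsTwoConnected.noThreeLarge_of_isChainTreeOfCycles [Finite V] (hG : IsTwoConnected G)
    (hC : IsChainTreeOfCycles (cellCompletion G)) : NoThreeLarge G := by
  obtain ⟨hT, hchain⟩ := hC
  have hK := hT.not_isMinor_K4
  intro a b hab X Y Z hX hY hZ hXY hXZ hYZ
  by_contra! hcon
  obtain ⟨hXl, hYl, hZl⟩ := hcon
  have hadj : (cellCompletion G).Adj a b := by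
    refine cellCompletion_adj_iff.2 (Or.inr ⟨hab, ![X, Y, Z], fun i => ?_, fun i j hij => ?_,
      fun i => ?_⟩)
    · fin_cases i
      · exact hX.1.nonempty
      · exact hY.1.nonempty
      · exact hZ.1.nonempty
    · fin_cases i <;> fin_cases j <;> first
        | exact absurd rfl hij
        | assumption
        | exact Disjoint.symm (by assumption)
    · fin_cases i
      · exact hX.2
      · exact hY.2
      · exact hZ.2
  -- `a` and `b` have neighbours in different components, and these are not adjacent even in the
  -- completion.
  have hclique : ∀ c : V, (c = a ∨ c = b) → ¬ IsSimplicialVertex (cellCompletion G) c := by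
    intro c hc hs
    have hnb : ∀ {D : Set V}, IsComp G a b D → ∃ x ∈ D, (cellCompletion G).Adj c x := by
      intro D hD
      rcases hc with rfl | rfl
      · obtain ⟨x, hx, h⟩ := hG.exists_adj_of_isComp hab hD.2 hD.1.nonempty
        exact ⟨x, hx, le_cellCompletion h⟩
      · obtain ⟨x, hx, h⟩ := hG.exists_adj_of_isComp hab.symm hD.2.symm hD.1.nonempty
        exact ⟨x, hx, le_cellCompletion h⟩
    obtain ⟨x, hx, hcx⟩ := hnb hX
    obtain ⟨y, hy, hcy⟩ := hnb hY
    have hxy := hs hcx hcy fun h => Set.disjoint_left.1 hXY hx (h ▸ hy)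
    rcases (hG.isClosedAt_cellCompletion hX.2).2.2 x hx y hxy with h | h | h
    · exact Set.disjoint_left.1 hXY h hy
    · exact hY.2.1 (h ▸ hy)
    · exact hY.2.2.1 (h ▸ hy)
  have main : ∀ {D : Set V}, IsComp G a b D → D.Nontrivial → ∃ C, IsCycleSet (cellCompletion G) C ∧
      a ∈ C ∧ b ∈ C ∧ C ⊆ D ∪ {a, b} ∧ ∀ x ∈ C, ¬ IsSimplicialVertex (cellCompletion G) x := by
    intro D hD hDl
    have hDT := hD.1.mono_graph (le_cellCompletion (G := G))
    have hac := hG.exists_adj_of_isComp hab hD.2 hD.1.nonempty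
    have hbc := hG.exists_adj_of_isComp hab.symm hD.2.symm hD.1.nonempty
    obtain ⟨C, hC, ha, hb, hCD⟩ := exists_cycleSet hadj hDT hD.2.1 hD.2.2.1
      (hac.imp fun x hx => ⟨hx.1, le_cellCompletion hx.2⟩)
      (hbc.imp fun x hx => ⟨hx.1, le_cellCompletion hx.2⟩)
    refine ⟨C, hC, ha, hb, hCD, fun x hx hs => ?_⟩
    have hxab : x ∉ ({a, b} : Set V) := fun h => hclique x h hs
    have hxD : x ∈ D := (hCD hx).resolve_right hxab
    obtain ⟨y, hy, z, hz, hyz, hxy, hxz⟩ := hC.exists_nbrs hx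
    have hyz' := hs hxy hxz hyz
    -- A simplicial `x` makes the cycle the triangle `x, a, b`. Its component is large, so `x` has
    -- another neighbour `w` there, and `x, w, a, b` would form a `K4` in a tree of cycles.
    have htri : ({x, y, z} : Set V) = C := by
      refine hC.conn.eq_of_closed ?_ ⟨x, Or.inl rfl⟩ ?_
      · rintro w (rfl | rfl | rfl) <;> assumption
      · rintro w (rfl | rfl | rfl) t ht hwt
        · exact Or.inr (hC.eq_of_adj hx hy hz ht hxy hxz hyz hwt)
        · rcases hC.eq_of_adj hy hx hz ht hxy.symm hyz' hxz.ne hwt with h | h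
          · exact Or.inl h
          · exact Or.inr (Or.inr h)
        · rcases hC.eq_of_adj hz hx hy ht hxz.symm hyz'.symm hxy.ne hwt with h | h
          · exact Or.inl h
          · exact Or.inr (Or.inl h)
    have hxadj : ∀ c ∈ C, c ∈ ({a, b} : Set V) → (cellCompletion G).Adj x c := by
      intro c hc hcab
      rcases htri.symm.subset hc with rfl | rfl | rfl
      · exact absurd hcab hxab
      · exact hxy
      · exact hxz
    have hxa := hxadj a ha (Or.inl rfl)
    have hxb := hxadj b hb (Or.inr rfl)
    obtain ⟨x', hx', w, hw, -, hxw⟩ := hDT.exists_adj (U := {x}) (Set.singleton_subset_iff.2 hxD)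
      ⟨x, rfl⟩ (fun h => (h ▸ hDl).not_subsingleton Set.subsingleton_singleton)
    rw [show x' = x from hx'] at hxw
    have hwa : w ≠ a := fun h => hD.2.1 (h ▸ hw)
    have hwb : w ≠ b := fun h => hD.2.2.1 (h ▸ hw)
    have haw := hs hxa hxw hwa.symm
    have hbw := hs hxb hxw hwb.symm
    refine hK (isMinor_K4 (conn_singleton x) (conn_singleton w) (conn_singleton a)
      (conn_singleton b) ?_ ?_ ?_ ?_ ?_ ?_ ⟨x, rfl, w, rfl, hxw⟩ ⟨x, rfl, a, rfl, hxa⟩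
      ⟨x, rfl, b, rfl, hxb⟩ ⟨w, rfl, a, rfl, haw.symm⟩ ⟨w, rfl, b, rfl, hbw.symm⟩
      ⟨a, rfl, b, rfl, hadj⟩)
    · simpa using hxw.ne
    · simpa using hxa.ne
    · simpa using hxb.ne
    · simpa using hwa
    · simpa using hwb
    · simpa using hab
  have hdist : ∀ {D E C C' : Set V}, Disjoint D E → IsCycleSet (cellCompletion G) C → a ∈ C →
      b ∈ C → C ⊆ D ∪ {a, b} → C' ⊆ E ∪ {a, b} →
      (⊤ : (cellCompletion G).Subgraph).induce C ≠ (⊤ : (cellCompletion G).Subgraph).induce C' := by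
    intro D E C C' hDE hC ha hb hCD hCE h
    have hv : C = C' := congrArg Subgraph.verts h
    obtain ⟨x, hx, hxab⟩ := (hC.conn_diff ha hb hadj).nonempty
    exact Set.disjoint_left.1 hDE ((hCD hx).resolve_right hxab)
      ((hCE (hv ▸ hx)).resolve_right hxab)
  obtain ⟨C₀, hC₀, ha₀, hb₀, hs₀, hn₀⟩ := main hX hXl
  obtain ⟨C₁, hC₁, ha₁, hb₁, hs₁, hn₁⟩ := main hY hYl
  obtain ⟨C₂, hC₂, ha₂, hb₂, hs₂, hn₂⟩ := main hZ hZl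
  have hmem : ∀ {C : Set V}, IsCycleSet (cellCompletion G) C → a ∈ C → b ∈ C →
      (∀ x ∈ C, ¬ IsSimplicialVertex (cellCompletion G) x) →
      (⊤ : (cellCompletion G).Subgraph).induce C ∈
        {C : (cellCompletion G).Subgraph | IsChordlessCycle C ∧ s(a, b) ∈ C.edgeSet} \
        {C : (cellCompletion G).Subgraph | IsChordlessCycle C ∧ s(a, b) ∈ C.edgeSet ∧
          IsSimplicialTriangle C} := by
    intro C hC ha hb hn
    refine ⟨⟨hC.isChordlessCycle, ⟨ha, hb, hadj⟩⟩, ?_⟩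
    rintro ⟨-, -, -, x, hx, hxs⟩
    exact hn x hx hxs
  have hchain' := hchain s(a, b) hadj _ rfl
  have h2 := (Set.two_lt_ncard).2 ⟨_, hmem hC₀ ha₀ hb₀ hn₀, _, hmem hC₁ ha₁ hb₁ hn₁, _,
    hmem hC₂ ha₂ hb₂ hn₂, hdist hXY hC₀ ha₀ hb₀ hs₀ hs₁, hdist hXZ hC₀ ha₀ hb₀ hs₀ hs₂,
    hdist hYZ hC₁ ha₁ hb₁ hs₁ hs₂⟩
  have h3 := Set.ncard_sdiff_add_ncard_of_subset
    (s := {C : (cellCompletion G).Subgraph | IsChordlessCycle C ∧ s(a, b) ∈ C.edgeSet ∧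
      IsSimplicialTriangle C})
    (t := {C : (cellCompletion G).Subgraph | IsChordlessCycle C ∧ s(a, b) ∈ C.edgeSet})
    fun C hC => ⟨hC.1, hC.2.1⟩
  omega

theorem IsMinor.mono_graph {W : Type v} {H : SimpleGraph W} {G' : SimpleGraph V}
    (h : IsMinor H G) (hle : G ≤ G') : IsMinor H G' := by
  obtain ⟨B, hB, hd, hadj⟩ := h
  refine ⟨B, fun w => Conn.mono_graph (hB w) hle, hd, fun w w' hw => ?_⟩
  obtain ⟨x, hx, y, hy, hxy⟩ := hadj w w' hw
  exact ⟨x, hx, y, hy, hle hxy⟩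

theorem IsMinor.map {U : Type v} {W : Type*} {H : SimpleGraph W} {K : SimpleGraph U}
    (h : IsMinor H K) (f : K →g G) (hf : Function.Injective f) : IsMinor H G := by
  obtain ⟨B, hB, hd, hadj⟩ := h
  refine ⟨fun w => f '' B w, fun w => Conn.image f (hB w), fun w w' hw =>
    (Set.disjoint_image_iff hf).2 (hd w w' hw), fun w w' hw => ?_⟩
  obtain ⟨x, hx, y, hy, hxy⟩ := hadj w w' hw
  exact ⟨f x, ⟨x, hx, rfl⟩, f y, ⟨y, hy, rfl⟩, f.map_adj hxy⟩

/-- For 2-connected graphs the three descriptions agree. -/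
theorem IsTwoConnected.isChainTreeOfCycles_iff [Finite V] (hG : IsTwoConnected G) :
    IsChainTreeOfCycles (cellCompletion G) ↔ ¬ IsMinor K4 G ∧ NoThreeLarge G :=
  ⟨fun h => ⟨fun hK => h.1.not_isMinor_K4 (hK.mono_graph le_cellCompletion),
    hG.noThreeLarge_of_isChainTreeOfCycles h⟩, fun h => hG.isChainTreeOfCycles h.1 h.2⟩

end Chain

end

end SpaghettiTw

namespace SpaghettiTw

open SimpleGraph

noncomputable section

/-! ### Blocks -/

section Blocks

variable {V : Type u} {G : SimpleGraph V}

theorem Conn.congr_graph {G' : SimpleGraph V} {S : Set V} (hS : Conn G S)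
    (h : ∀ x ∈ S, ∀ y ∈ S, G.Adj x y → G'.Adj x y) : Conn G' S :=
  conn_of_closed hS.nonempty fun _ hU hne hcl => hS.eq_of_closed hU hne
    fun x hx y hy hxy => hcl x hx y hy (h x (hU hx) y hy hxy)

theorem coe_deleteVerts_eq (K : G.Subgraph) (X : Set V) :
    (K.deleteVerts X).coe = K.spanningCoe.induce (K.verts \ X) := by
  ext ⟨x, hx⟩ ⟨y, hy⟩
  change (K.deleteVerts X).Adj x y ↔ K.Adj x y
  rw [Subgraph.deleteVerts_adj]
  exact ⟨fun h => h.2.2.2.2, fun h => ⟨hx.1, hx.2, hy.1, hy.2, h⟩⟩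

/-- Connected subgraphs without cut vertex, in terms of vertex sets. -/
theorem connected_and_not_isCutVertex_iff {K : G.Subgraph} :
    (K.Connected ∧ ∀ v, ¬ IsCutVertex K v) ↔ Conn K.spanningCoe K.verts ∧
      ∀ v ∈ K.verts, (K.verts \ {v}).Nonempty → Conn K.spanningCoe (K.verts \ {v}) := by
  refine and_congr ⟨fun h => h.coe, fun h => ⟨h⟩⟩ (forall_congr' fun v => ?_)
  rw [IsCutVertex, not_and, not_not]
  refine imp_congr_right fun _ => ?_
  have h1 : (K.deleteVerts {v}).Preconnected ↔
      (K.spanningCoe.induce (K.verts \ {v})).Preconnected := by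
    rw [← coe_deleteVerts_eq]
    exact ⟨fun h => h.coe, fun h => ⟨h⟩⟩
  rw [h1]
  constructor
  · intro h hne
    have : Nonempty ↥(K.verts \ {v}) := hne.to_subtype
    exact ⟨h⟩
  · intro h x
    exact (h ⟨x.1, x.2⟩).preconnected x

/-- Adding all edges of `G` on the same vertices creates no cut vertex, so maximality includes them
already. -/
theorem IsBlock.isInduced {H : G.Subgraph} (hH : IsBlock H) : H.IsInduced := by
  have hle : H ≤ (⊤ : G.Subgraph).induce H.verts :=
    ⟨subset_rfl, fun x y h => ⟨H.edge_vert h, H.edge_vert h.symm, h.adj_sub⟩⟩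
  have hmono : H.spanningCoe ≤ ((⊤ : G.Subgraph).induce H.verts).spanningCoe :=
    fun x y h => hle.2 h
  have h1 := connected_and_not_isCutVertex_iff.1 hH.1
  have h2 := hH.2 (y := (⊤ : G.Subgraph).induce H.verts) (connected_and_not_isCutVertex_iff.2
    ⟨h1.1.mono_graph hmono, fun v hv hne => (h1.2 v hv hne).mono_graph hmono⟩) hle
  exact fun x hx y hy hxy => h2.2 ⟨hx, hy, hxy⟩

theorem connected_subgraphOfAdj_and_not_isCutVertex {a b : V} (hab : G.Adj a b) :
    (G.subgraphOfAdj hab).Connected ∧ ∀ v, ¬ IsCutVertex (G.subgraphOfAdj hab) v := by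
  rw [connected_and_not_isCutVertex_iff]
  constructor
  · have hadj : (G.subgraphOfAdj hab).spanningCoe.Adj a b := by simp [hab.ne]
    have := (conn_singleton (G := (G.subgraphOfAdj hab).spanningCoe) a).union_of_adj
      (conn_singleton b) rfl rfl hadj
    exact this
  · rintro v hv ⟨x, hx, hxv⟩
    have : (G.subgraphOfAdj hab).verts \ {v} = {x} := by
      ext y
      simp only [subgraphOfAdj_verts, Set.mem_sdiff, Set.mem_insert_iff,
        Set.mem_singleton_iff] at hv hx hxv ⊢
      constructor
      · rintro ⟨hy, hyv⟩
        rcases hv with rfl | rfl <;> rcases hx with rfl | rfl <;> rcases hy with rfl | rfl <;>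
          first | rfl | contradiction
      · rintro rfl
        exact ⟨hx, hxv⟩
    rw [this]
    exact conn_singleton x

theorem isTwoConnected_coe [Finite V] {K : G.Subgraph}
    (hK : K.Connected ∧ ∀ v, ¬ IsCutVertex K v) (h3 : 3 ≤ K.verts.ncard) :
    IsTwoConnected K.coe := by
  have h1 := connected_and_not_isCutVertex_iff.1 hK
  refine ⟨h3, fun X hX => ?_⟩
  change Conn (K.spanningCoe.induce K.verts) Xᶜ
  rw [conn_induce_iff]
  rcases Set.eq_empty_or_nonempty X with rfl | ⟨x, hx⟩
  · rw [Set.compl_empty, Set.image_univ, Subtype.range_coe]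
    exact h1.1
  · have : Subtype.val '' Xᶜ = K.verts \ {x.1} := by
      ext y
      constructor
      · rintro ⟨z, hz, rfl⟩
        exact ⟨z.2, fun h => hz (Subtype.ext (show z.1 = x.1 from h) ▸ hx)⟩
      · rintro ⟨hy, hyx⟩
        exact ⟨⟨y, hy⟩, fun h => hyx (congrArg Subtype.val
          (Set.encard_le_one_iff.1 hX _ _ h hx)), rfl⟩
    rw [this]
    refine h1.2 x.1 x.2 ?_
    by_contra hne
    rw [Set.not_nonempty_iff_eq_empty, Set.sdiff_eq_empty] at hne
    have := Set.ncard_le_ncard hne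
    rw [Set.ncard_singleton] at this
    omega

/-- The cases are at least three, exactly two and exactly one vertex; in the last, an edge at the
vertex would be a larger candidate for a block. -/
theorem IsBlock.cases [Finite V] {H : G.Subgraph} (hH : IsBlock H) : IsTwoConnected H.coe ∨
    (∃ (a b : V) (hab : G.Adj a b), H = G.subgraphOfAdj hab) ∨
    (∃ a : V, H = G.singletonSubgraph a ∧ ∀ b, ¬ G.Adj a b) := by
  have hconn := (connected_and_not_isCutVertex_iff.1 hH.1).1
  by_cases h3 : 3 ≤ H.verts.ncard
  · exact Or.inl (isTwoConnected_coe hH.1 h3)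
  right
  obtain ⟨a, ha⟩ := hconn.nonempty
  by_cases hsub : H.verts = {a}
  · refine Or.inr ⟨a, ?_, fun b hab => ?_⟩
    · refine Subgraph.ext hsub ?_
      ext x y
      refine iff_of_false (fun h => h.ne ?_) (by simp)
      have hx := hsub.subset (H.edge_vert h)
      have hy := hsub.subset (H.edge_vert h.symm)
      exact (show x = a from hx).trans (show y = a from hy).symm
    · have hle : H ≤ G.subgraphOfAdj hab := by
        refine ⟨hsub.subset.trans (by simp), fun x y h => (h.ne ?_).elim⟩
        have hx := hsub.subset (H.edge_vert h)
        have hy := hsub.subset (H.edge_vert h.symm)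
        exact (show x = a from hx).trans (show y = a from hy).symm
      have h2 := (hH.2 (connected_subgraphOfAdj_and_not_isCutVertex hab) hle).1
      have hb : b ∈ H.verts := h2 (Or.inr rfl)
      rw [hsub] at hb
      exact hab.ne (show b = a from hb).symm
  · left
    obtain ⟨x, hx, b, hb, hba, hadj⟩ := hconn.exists_adj (U := {a})
      (Set.singleton_subset_iff.2 ha) ⟨a, rfl⟩ (Ne.symm hsub)
    rw [show x = a from hx] at hadj
    have hab : H.Adj a b := hadj
    have hverts : H.verts = {a, b} := by
      refine (Set.eq_of_subset_of_ncard_le (Set.insert_subset ha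
        (Set.singleton_subset_iff.2 hb)) ?_ (Set.toFinite _)).symm
      rw [Set.ncard_pair hab.ne]
      omega
    refine ⟨a, b, hab.adj_sub, Subgraph.ext hverts ?_⟩
    ext x y
    constructor
    · intro h
      have hx := hverts.subset (H.edge_vert h)
      have hy := hverts.subset (H.edge_vert h.symm)
      have hne := h.ne
      rcases hx with rfl | rfl <;> rcases hy with rfl | rfl
      · exact absurd rfl hne
      · simp
      · simp [Sym2.eq_swap]
      · exact absurd rfl hne
    · intro h
      rw [subgraphOfAdj_adj, Sym2.eq_iff] at h
      rcases h with ⟨rfl, rfl⟩ | ⟨rfl, rfl⟩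
      · exact hab
      · exact hab.symm

theorem exists_isBlock_of_isTwoConnected [Finite V] {S : Set V}
    (hS : IsTwoConnected (G.induce S)) : ∃ H : G.Subgraph, IsBlock H ∧ S ⊆ H.verts := by
  let K : G.Subgraph := (⊤ : G.Subgraph).induce S
  have hadj : ∀ x ∈ S, ∀ y ∈ S, G.Adj x y → K.spanningCoe.Adj x y :=
    fun x hx y hy hxy => ⟨hx, hy, hxy⟩
  have hK : K.Connected ∧ ∀ v, ¬ IsCutVertex K v := by
    rw [connected_and_not_isCutVertex_iff]
    constructor
    · have h1 := hS.conn_univ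
      rw [conn_induce_iff, Set.image_univ, Subtype.range_coe] at h1
      exact h1.congr_graph hadj
    · intro v hv _
      have h1 := hS.conn_compl ⟨v, hv⟩
      rw [conn_induce_iff] at h1
      have h2 : Subtype.val '' ({⟨v, hv⟩}ᶜ : Set S) = S \ {v} := by
        ext y
        constructor
        · rintro ⟨z, hz, rfl⟩
          exact ⟨z.2, fun h => hz (Subtype.ext h)⟩
        · rintro ⟨hy, hyv⟩
          exact ⟨⟨y, hy⟩, fun h => hyv (congrArg Subtype.val h), rfl⟩
      rw [h2] at h1
      exact h1.congr_graph fun x hx y hy hxy => hadj x hx.1 y hy.1 hxy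
  obtain ⟨H, hKH, hH⟩ := (Set.toFinite
    {K : G.Subgraph | K.Connected ∧ ∀ v, ¬ IsCutVertex K v}).exists_le_maximal hK
  exact ⟨H, hH, hKH.1⟩

/-- Every 2-connected induced subgraph lies in a 2-connected block; the decomposition of that block,
restricted to the subgraph, feeds the assembly along cut vertices. -/
theorem spaghettiTreewidth_le_of_blocks [Finite V]
    (h : ∀ H : G.Subgraph, IsBlock H → IsTwoConnected H.coe →
      IsChainTreeOfCycles (cellCompletion H.coe)) : spaghettiTreewidth G ≤ 2 := by
  obtain ⟨D, hD⟩ := exists_decomposes_of_twoConnected (G := G) (fun S hS => by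
    obtain ⟨H, hH, hSH⟩ := exists_isBlock_of_isTwoConnected hS
    have h3 : 3 ≤ H.verts.ncard := hS.1.trans (Set.ncard_le_ncard hSH)
    have h2 := isTwoConnected_coe hH.1 h3
    obtain ⟨hK, hN⟩ := h2.isChainTreeOfCycles_iff.1 (h H hH h2)
    obtain ⟨D, hD⟩ := h2.exists_decomposes hK hN
    have h4 := hD.map (H := G) (Function.Embedding.subtype _)
      fun x _ y _ hxy => hH.isInduced x.2 y.2 hxy
    exact ⟨_, h4.restrict (S := S) fun x hx => ⟨⟨x, hSH hx⟩, Set.mem_univ _, rfl⟩⟩) Set.univ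
  exact hD.spaghettiTreewidth_le

end Blocks

end

end SpaghettiTw

/-! ### The main theorem -/

theorem mainTheorem4 {V : Type u} [Finite V] (G : SimpleGraph V) :
    ([SpaghettiTw.spaghettiTreewidth G ≤ 2,
      ∀ H : G.Subgraph, SpaghettiTw.IsBlock H →
        (SpaghettiTw.IsTwoConnected H.coe ∧
          SpaghettiTw.IsChainTreeOfCycles (SpaghettiTw.cellCompletion H.coe)) ∨
        (∃ (a b : V) (hab : G.Adj a b), H = G.subgraphOfAdj hab) ∨
        (∃ a : V, H = G.singletonSubgraph a ∧ ∀ b, ¬ G.Adj a b),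
      ¬ SpaghettiTw.IsMinor SpaghettiTw.K4 G ∧
        ¬ SpaghettiTw.IsMinor SpaghettiTw.D3 G].TFAE) ∧
    (SpaghettiTw.IsTwoConnected G →
      (SpaghettiTw.spaghettiTreewidth G = 2 ↔
        SpaghettiTw.IsChainTreeOfCycles (SpaghettiTw.cellCompletion G))) ∧
    (SpaghettiTw.IsTwoConnected G →
      (SpaghettiTw.spaghettiTreewidth G = 2 ↔
        ¬ SpaghettiTw.IsMinor SpaghettiTw.K4 G ∧
          ¬ SpaghettiTw.IsMinor SpaghettiTw.D3 G)) := by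
  have hle : SpaghettiTw.IsTwoConnected G → ¬ SpaghettiTw.IsMinor SpaghettiTw.K4 G →
      SpaghettiTw.NoThreeLarge G → SpaghettiTw.spaghettiTreewidth G = 2 := fun hG hK hN =>
    have ⟨_, hD⟩ := hG.exists_decomposes hK hN
    le_antisymm hD.spaghettiTreewidth_le hG.two_le_spaghettiTreewidth
  refine ⟨?_, fun hG => ⟨fun h => ?_, fun h => ?_⟩, fun hG => ⟨fun h => ?_, fun h => ?_⟩⟩
  · tfae_have 1 → 3 := SpaghettiTw.not_isMinor_of_spaghettiTreewidth_le
    tfae_have 3 → 2 := by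
      rintro ⟨hK, h3⟩ H hH
      refine hH.cases.imp_left fun h2 => ⟨h2, h2.isChainTreeOfCycles ?_ (h2.noThreeLarge ?_)⟩
      · exact fun h => hK (h.map H.hom H.hom_injective)
      · exact fun h => h3 (h.map H.hom H.hom_injective)
    tfae_have 2 → 1 := by
      intro h
      refine SpaghettiTw.spaghettiTreewidth_le_of_blocks fun H hH h2 => ?_
      -- A single edge or an isolated vertex has fewer than three vertices, so a 2-connected block
      -- can only be of the first kind.
      rcases h H hH with ⟨-, hc⟩ | ⟨a, b, hab, rfl⟩ | ⟨a, rfl, -⟩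
      · exact hc
      · have h3 : 3 ≤ (G.subgraphOfAdj hab).verts.ncard := h2.1
        rw [SimpleGraph.subgraphOfAdj_verts, Set.ncard_pair hab.ne] at h3
        omega
      · have h3 : 3 ≤ (G.singletonSubgraph a).verts.ncard := h2.1
        rw [SimpleGraph.singletonSubgraph_verts, Set.ncard_singleton] at h3
        omega
    tfae_finish
  · obtain ⟨hK, h3⟩ := SpaghettiTw.not_isMinor_of_spaghettiTreewidth_le h.le
    exact hG.isChainTreeOfCycles hK (hG.noThreeLarge h3)
  · obtain ⟨hK, hN⟩ := hG.isChainTreeOfCycles_iff.1 h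
    exact hle hG hK hN
  · exact SpaghettiTw.not_isMinor_of_spaghettiTreewidth_le h.le
  · exact hle hG h.1 (hG.noThreeLarge h.2)
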